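/- Let $m\ge1$, $0\le k<m$ and $d\ge1$ be integers. For a field $K$ with $m\ne0$ in $K$ and $\varphi\in K(z)$, the $(m,k)$-Landen transform $\mathfrak F_{m,k}(\varphi)\in K(z)$ is the rational function with $\mathfrak F_{m,k}(\varphi)(w^m)=\frac1{mw^k}\sum_{t=0}^{m-1}\zeta_m^{-kt}\varphi(\zeta_m^tw)$, where $\zeta_m$ is a primitive $m$-th root of unity in an extension field of $K$. A rational function $\varphi_{\mathbf a,\mathbf b}(z)=\frac{a_0z^d+a_1z^{d-1}+\cdots+a_d}{b_0z^d+b_1z^{d-1}+\cdots+b_d}$ of degree $d$ is identified with the point $[\mathbf a,\mathbf b]=[a_0,\dots,a_d,b_0,\dots,b_d]$ of $\mathbb P^{2d+1}(K)$. A rational map between projective spaces over $\mathbb Z$ or over a field has algebraic degree $n$ if it is given by forms of degree $n$ over that ring without a common non-unit factor. (a) There is a unique rational map $\mathfrak R_{d,m,k}:\mathbb P^{2d+1}_{\mathbb Z}\dashrightarrow\mathbb P^{2d+1}_{\mathbb Z}$ such that for all fields $K$ in which $m\ne0$ and all $\varphi_{\mathbf a,\mathbf b}\in K(z)$ of degree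 $d$ for which $\mathfrak F_{m,k}(\varphi_{\mathbf a,\mathbf b})$ also has degree $d$, we have $\mathfrak F_{m,k}(\varphi_{\mathbf a,\mathbf b})=\mathfrak R_{d,m,k}([\mathbf a,\mathbf b])$. (The map $\mathfrak R_{d,m,k}$ is defined at all these points; it is already the only rational map for which the equality holds at those of these points at which the map is defined.) (b) Let $Z=\{[\mathbf a,\mathbf b]\in\mathbb P^{2d+1}_{\mathbb Z}:\mathbf b=\mathbf 0\}$. If $m\ge2$, then the indeterminacy locus of $\mathfrak R_{d,m,k}$ is $Z$. For all $m\ge1$ the map $\mathfrak R_{d,m,k}$ induces a morphism $\mathbb P^{2d+1}_{\mathbb Z}\setminus Z\to\mathbb P^{2d+1}_{\mathbb Z}\setminus Z$. (c) The map $\mathfrak R_{d,m,0}$ is a dominant rational map of algebraic degree $m$, and so is its base change to $\mathbb P^{2d+1}_F$ for every field $F$ (of any characteristic). (d) For $1\le k<m$, the (Zariski closure of the) image of $\mathfrak R_{d,m,k}$ is the hyperplane $\{a_0=0\}\cong\mathbb P^{2d}_{\mathbb Z}$. For all $0\le k<m$, the map $\mathfrak R_{d,m,k}$ induces a dominant rational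 self-map of algebraic degree $m$ of the hyperplane $\{a_0=0\}$, and the base change of this self-map to every field $F$ is again dominant of algebraic degree $m$. -/

import Mathlib

open CategoryTheory AlgebraicGeometry

attribute [local instance] MvPolynomial.gradedAlgebra

noncomputable section

/-! ### Projective space over a ring, its field-valued points, and rational maps -/

/-- The projective space over `R` with homogeneous coordinates indexed by `σ`,
i.e. `Proj R[x_i : i ∈ σ]`. -/
abbrev ProjSpace (σ R : Type) [CommRing R] : Scheme.{0} :=
  Proj (MvPolynomial.homogeneousSubmodule σ R)

/-- The evaluation of polynomials over `R` at the vector `x`, as a ring homomorphism to the global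
sections of `Spec K`. -/
def evalSections {σ R K : Type} [CommRing R] [Field K] [Algebra R K] (x : σ → K) :
    MvPolynomial σ R →+* Γ(Spec (.of K), ⊤) :=
  (Scheme.ΓSpecIso (.of K)).inv.hom.comp (MvPolynomial.aeval x).toRingHom

theorem evalSections_irrelevant {σ R K : Type} [CommRing R] [Field K] [Algebra R K]
    (x : σ → K) (hx : x ≠ 0) :
    (HomogeneousIdeal.irrelevant (MvPolynomial.homogeneousSubmodule σ R)).toIdeal.map
      (evalSections (R := R) x) = ⊤ := by
  obtain ⟨i, hi⟩ := Function.ne_iff.mp hx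
  refine Ideal.eq_top_of_isUnit_mem _ (x := evalSections (R := R) x (MvPolynomial.X i))
    (Ideal.mem_map_of_mem _ ?_) ?_
  · change MvPolynomial.X i ∈ HomogeneousIdeal.irrelevant _
    rw [HomogeneousIdeal.mem_irrelevant_iff, GradedRing.proj_apply,
      DirectSum.decompose_of_mem_ne (i := 1) _ _ one_ne_zero]
    exact MvPolynomial.isHomogeneous_X R i
  · simp only [evalSections, RingHom.comp_apply]
    refine IsUnit.map _ ?_
    have h : (MvPolynomial.aeval (R := R) x).toRingHom (MvPolynomial.X i) = x i := by simp
    rw [h]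
    exact (isUnit_iff_ne_zero.mpr hi : IsUnit (x i))

/-- The point `[x]` of projective space over `R` with values in a field `K` (an `R`-algebra),
for a nonzero vector `x` of homogeneous coordinates. -/
def projPoint {σ : Type} (R : Type) {K : Type} [CommRing R] [Field K] [Algebra R K]
    (x : σ → K) (hx : x ≠ 0) : Spec (.of K) ⟶ ProjSpace σ R :=
  Proj.fromOfGlobalSections _ (evalSections x) (evalSections_irrelevant x hx)

/-- The rational map `Φ` is defined at the `K`-valued point `[x]`, and `Φ([x]) = [y]`. -/
def SendsTo {σ τ R K : Type} [CommRing R] [Field K] [Algebra R K]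
    (Φ : (ProjSpace σ R).RationalMap (ProjSpace τ R)) (x : σ → K) (y : τ → K) : Prop :=
  ∃ (hx : x ≠ 0) (hy : y ≠ 0) (g : (ProjSpace σ R).PartialMap (ProjSpace τ R)),
    g.toRationalMap = Φ ∧
    ∃ p : Spec (.of K) ⟶ g.domain.toScheme,
      p ≫ g.domain.ι = projPoint R x hx ∧ p ≫ g.hom = projPoint R y hy

/-- The rational map `Φ` of projective spaces over `R` has algebraic degree `n`: it is given by
`[x] ↦ [F_j(x)]_j` for forms `F_j` of degree `n` over `R` without a common nonunit factor
(for `R` a unique factorization domain, this says that `Φ` pulls `O(1)` back to `O(n)`). -/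
def HasAlgebraicDegree {σ τ R : Type} [CommRing R]
    (Φ : (ProjSpace σ R).RationalMap (ProjSpace τ R)) (n : ℕ) : Prop :=
  ∃ F : τ → MvPolynomial σ R,
    (∀ j, (F j).IsHomogeneous n) ∧
    (∀ u : MvPolynomial σ R, (∀ j, u ∣ F j) → IsUnit u) ∧
    ∀ (K : Type) [Field K] [Algebra R K] (x : σ → K),
      (fun j => MvPolynomial.aeval x (F j)) ≠ 0 →
        SendsTo Φ x (fun j => MvPolynomial.aeval x (F j))

/-- `Φk` is the base change to the field `k` of the rational map `Φ` of projective spaces over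
`ℤ`: the map `Φ` is defined somewhere on the fibre over `k`, and wherever it is defined there,
`Φk` is defined and takes the same value. -/
def HasBaseChange {σ τ k : Type} [Field k]
    (Φ : (ProjSpace σ ℤ).RationalMap (ProjSpace τ ℤ))
    (Φk : (ProjSpace σ k).RationalMap (ProjSpace τ k)) : Prop :=
  (∃ (K : Type) (_ : Field K) (_ : Algebra k K) (x : σ → K) (y : τ → K), SendsTo Φ x y) ∧
  ∀ (K : Type) [Field K] [Algebra k K] (x : σ → K) (y : τ → K),
    SendsTo Φ x y → SendsTo Φk x y

/-! ### The coordinates `[a, b]` of rational functions of degree `d` -/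

/-- Index set of the homogeneous coordinates `[a_0, …, a_d, b_0, …, b_d]`. -/
abbrev Coord (d : ℕ) : Type := Fin (d + 1) ⊕ Fin (d + 1)

/-- Index set of the homogeneous coordinates `[a_1, …, a_d, b_0, …, b_d]` on the hyperplane
`a_0 = 0`. -/
abbrev HypCoord (d : ℕ) : Type := Fin d ⊕ Fin (d + 1)

/-- The inclusion of the hyperplane `a_0 = 0`, in coordinates. -/
def hypIncl {d : ℕ} {K : Type} [Zero K] (x : HypCoord d → K) : Coord d → K :=
  Sum.elim (Fin.cons 0 fun i => x (Sum.inl i)) fun i => x (Sum.inr i)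

/-- `Φ` induces the rational self-map `Ψ` of the hyperplane `a_0 = 0`: the map `Φ` is defined
somewhere on the hyperplane, and wherever it is defined there, its value lies on the hyperplane
and is the value of `Ψ`. -/
def RestrictsToHyperplane {d : ℕ}
    (Φ : (ProjSpace (Coord d) ℤ).RationalMap (ProjSpace (Coord d) ℤ))
    (Ψ : (ProjSpace (HypCoord d) ℤ).RationalMap (ProjSpace (HypCoord d) ℤ)) : Prop :=
  (∃ (K : Type) (_ : Field K) (x : HypCoord d → K) (y : Coord d → K),
    SendsTo Φ (hypIncl x) y) ∧
  ∀ (K : Type) [Field K] (x : HypCoord d → K) (y : Coord d → K), SendsTo Φ (hypIncl x) y →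
    ∃ y' : HypCoord d → K, y = hypIncl y' ∧ SendsTo Ψ x y'

/-- The polynomial `a_0 z^d + a_1 z^(d-1) + ⋯ + a_d`. -/
def coeffPoly {d : ℕ} {K : Type} [Field K] (a : Fin (d + 1) → K) : Polynomial K :=
  ∑ i : Fin (d + 1), Polynomial.C (a i) * Polynomial.X ^ (d - (i : ℕ))

/-- The rational function `(a_0 z^d + ⋯ + a_d) / (b_0 z^d + ⋯ + b_d)`. -/
def ratFun {d : ℕ} {K : Type} [Field K] (a b : Fin (d + 1) → K) : RatFunc K :=
  algebraMap (Polynomial K) (RatFunc K) (coeffPoly a) /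
    algebraMap (Polynomial K) (RatFunc K) (coeffPoly b)

/-- The degree of a rational function as a self-map of the projective line. -/
def ratDegree {K : Type} [Field K] (φ : RatFunc K) : ℕ :=
  max φ.num.natDegree φ.denom.natDegree

/-! ### The Landen transform -/

/-- The rational function `φ(s)`, where `s` lies in `L(w)` for an extension field `L` of `K`. -/
def substRat {K L : Type} [Field K] [Field L] [Algebra K L] (s : RatFunc L) (φ : RatFunc K) :
    RatFunc L :=
  RatFunc.eval ((RatFunc.C : L →+* RatFunc L).comp (algebraMap K L)) s φ

/-- `ψ` is the `(m, k)`-Landen transform of `φ`: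
`ψ(w^m) = (m w^k)⁻¹ ∑_{t < m} ζ^(-kt) φ(ζ^t w)` for every primitive `m`-th root of unity `ζ` in an
extension field of `K`. -/
def IsLandenTransform {K : Type} [Field K] (m k : ℕ) (φ ψ : RatFunc K) : Prop :=
  ∀ (L : Type) [Field L] [Algebra K L] (ζ : L), IsPrimitiveRoot ζ m →
    substRat (L := L) (RatFunc.X ^ m) ψ =
      ((m : RatFunc L) * RatFunc.X ^ k)⁻¹ *
        ∑ t ∈ Finset.range m,
          RatFunc.C (ζ⁻¹ ^ (k * t)) * substRat (L := L) (RatFunc.C (ζ ^ t) * RatFunc.X) φ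

/-- The pairs consisting of a degree `d` rational function `f_{a,b}` over a field `K` in which
`m ≠ 0` and its `(m, k)`-Landen transform `f_{a',b'}`, which is required to have degree `d` too. -/
structure IsLandenPair {d : ℕ} (m k : ℕ) {K : Type} [Field K]
    (a b a' b' : Fin (d + 1) → K) : Prop where
  cast_ne_zero : (m : K) ≠ 0
  degree_source : ratDegree (ratFun a b) = d
  isLanden : IsLandenTransform m k (ratFun a b) (ratFun a' b')
  degree_target : ratDegree (ratFun a' b') = d

/-- `Φ` is defined at every degree `d` rational function whose Landen transform has degree `d`,
and its value is the Landen transform. -/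
def InducedByLanden (d m k : ℕ)
    (Φ : (ProjSpace (Coord d) ℤ).RationalMap (ProjSpace (Coord d) ℤ)) : Prop :=
  ∀ (K : Type) [Field K] (a b a' b' : Fin (d + 1) → K), IsLandenPair m k a b a' b' →
    SendsTo Φ (Sum.elim a b) (Sum.elim a' b')

/-- The same, but only at those rational functions at which `Φ` happens to be defined. -/
def AgreesWithLanden (d m k : ℕ)
    (Φ : (ProjSpace (Coord d) ℤ).RationalMap (ProjSpace (Coord d) ℤ)) : Prop :=
  ∀ (K : Type) [Field K] (a b a' b' : Fin (d + 1) → K), IsLandenPair m k a b a' b' →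
    (∃ y, SendsTo Φ (Sum.elim a b) y) → SendsTo Φ (Sum.elim a b) (Sum.elim a' b')

/-- The open complement of the linear subspace `b = 0`. -/
def bNonzero (d : ℕ) : (ProjSpace (Coord d) ℤ).Opens :=
  ⨆ i : Fin (d + 1), Proj.basicOpen _ (MvPolynomial.X (Sum.inr i))

end

/-! Write the rational function as `A / B` and regard polynomials in `w` as a free module of rank
`m` over polynomials in `w ^ m`, with basis `1, w, …, w ^ (m - 1)`. The determinant of
multiplication by `B` is its norm `D`, and the adjugate gives a cofactor `E` with `E * B = D(w ^ m)`
(`normCofactor_mul`). Thus `φ(w) = A E / D(w ^ m)`. The substitutions `w ↦ ζ ^ t w` fix the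
denominator, and the weighted average keeps exactly the exponents of `A E` congruent to `k` modulo
`m`. The transform is therefore the `k`-th residue part of `A E`, divided by `D`
(`isLandenTransform_landenVec`).

This formula uses no roots of unity and no division by `m`, so it makes sense over every commutative
ring and commutes with ring homomorphisms. Its coordinates are forms of degree `m`: the entries of
`D` have degree `m` in `b`, those of `E` degree `m - 1`. Up to sign, two of the coordinates are `b_0
^ m` and `b_d ^ m`, so the forms have no common factor, also on the hyperplane `a_0 = 0`. Counting
degrees in `A E` shows that the `a_0`-coordinate vanishes if `k > 0` or if `a_0 = 0`.

Over a unique factorization domain, a map given by forms without a common factor is undefined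
exactly where all the forms vanish (`IsGivenBy.mem_domain_iff`). The norm of a nonzero `B` is
nonzero, and for `B = 0`, `m ≥ 2` both `D` and `E` vanish; this gives (b).

Dominance and the shape of the image come from a preimage of the generic vector over an
algebraically closed field (`exists_landenVec_eq`). If `D` has distinct nonzero roots `r`, let the
roots of `B` be chosen `m`-th roots `β r`. In partial fractions the map `A ↦ N` is then diagonal,
since `1 / (w - β) = (∑ w ^ i β ^ (m - 1 - i)) / (w ^ m - β ^ m)`, with nonzero factors in every
characteristic. Hence the forms satisfy no relation for `k = 0`, nor do those on the hyperplane for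
any `k`; for `k > 0` the relations among the full set of forms are those vanishing on `a_0 = 0`.

Uniqueness holds because a rational map is determined by its value at the generic point. That point
is a Landen pair: one generic coefficient is transcendental over the others, so numerator and
denominator are coprime, both before and after the transform. -/

noncomputable section

/-! ### Morphisms to `Proj` that factor through one chart -/

namespace AlgebraicGeometry.Proj
open HomogeneousLocalization

/-- If `f t` is a unit, then `f` induces a ring homomorphism out of the degree zero part of the
localization away from `t`. -/
def awayLift {σ A B : Type} [CommRing A] [SetLike σ A] [AddSubgroupClass σ A] (𝒜 : ℕ → σ)
    [GradedRing 𝒜] [CommRing B] (f : A →+* B) (t : A) (h : IsUnit (f t)) : Away 𝒜 t →+* B :=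
  (IsLocalization.Away.lift (S := Localization.Away t) t h).comp
    (algebraMap (Away 𝒜 t) (Localization.Away t))

variable {σ A : Type} [CommRing A] [SetLike σ A] [AddSubgroupClass σ A] (𝒜 : ℕ → σ)
    [GradedRing 𝒜]

theorem awayLift_mk {B : Type} [CommRing B] (f : A →+* B) (t : A) (h : IsUnit (f t)) {d : ℕ}
    (hd : t ∈ 𝒜 d) (n : ℕ) (a : A) (ha : a ∈ 𝒜 (n • d)) :
    awayLift 𝒜 f t h (Away.mk 𝒜 hd n a ha) * f t ^ n = f a := by
  simp only [awayLift, RingHom.comp_apply, HomogeneousLocalization.algebraMap_apply,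
    Away.val_mk]
  rw [← map_pow, ← IsLocalization.Away.lift_eq (S := Localization.Away t) t h (t ^ n),
    ← map_mul, ← IsLocalization.Away.lift_eq (S := Localization.Away t) t h a]
  congr 1
  rw [Localization.mk_eq_mk', mul_comm]
  exact IsLocalization.mk'_spec' _ _ (⟨t ^ n, n, rfl⟩ : Submonoid.powers t)

theorem awayLift_comp {B C : Type} [CommRing B] [CommRing C] (f : A →+* B) (g : B →+* C) (t : A)
    (h : IsUnit (f t)) (h' : IsUnit ((g.comp f) t)) :
    awayLift 𝒜 (g.comp f) t h' = g.comp (awayLift 𝒜 f t h) := by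
  simp only [awayLift, ← RingHom.comp_assoc]
  congr 1
  refine IsLocalization.ringHom_ext (Submonoid.powers t) ?_
  ext x
  simp [IsLocalization.Away.lift_eq]

variable {X : Scheme.{0}} (f : A →+* Γ(X, ⊤))
    (hf : (HomogeneousIdeal.irrelevant 𝒜).toIdeal.map f = ⊤)

/-- The morphism is glued from its restrictions to the basic opens of `f t`. When `f t` is a unit,
this basic open is all of `X`, so a single chart describes the morphism. -/
theorem fromOfGlobalSections_eq (t : A) {d : ℕ} (hd : t ∈ 𝒜 d) (h0 : 0 < d) (h : IsUnit (f t)) :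
    fromOfGlobalSections 𝒜 f hf =
      X.toSpecΓ ≫ Spec.map (CommRingCat.ofHom (awayLift 𝒜 f t h)) ≫ awayι 𝒜 t hd h0 := by
  have htop : X.basicOpen (f t) = ⊤ := X.basicOpen_of_isUnit h
  have : IsIso (X.basicOpen (f t)).ι := by
    rw [htop]
    exact inferInstanceAs (IsIso X.topIso.hom)
  rw [← cancel_epi (X.basicOpen (f t)).ι]
  have k2 : (X.basicOpen (f t)).ι ≫ fromOfGlobalSections 𝒜 f hf =
      toBasicOpenOfGlobalSections 𝒜 f rfl h0 hd ≫ Scheme.Opens.ι _ := by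
    exact (openCoverOfMapIrrelevantEqTop 𝒜 f hf).ι_glueMorphisms _ _ ⟨_, _, h0, hd⟩
  rw [k2]
  simp only [toBasicOpenOfGlobalSections, Category.assoc, basicOpenIsoSpec_inv_ι]
  rw [Iso.inv_comp_eq]
  rw [Scheme.isoOfEq_hom_ι_assoc]
  refine Eq.trans ?_ (morphismRestrict_ι_assoc X.toSpecΓ (PrimeSpectrum.basicOpen (f t)) _)
  refine congrArg (fun g => X.toSpecΓ ∣_ PrimeSpectrum.basicOpen (f t) ≫ g) ?_
  simp only [basicOpenIsoSpecAway, ← Iso.eq_inv_comp, IsOpenImmersion.isoOfRangeEq_inv_fac_assoc]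
  rw [← Category.assoc, ← Spec.map_comp, ← CommRingCat.ofHom_comp]
  congr 3
  rw [awayLift, ← RingHom.comp_assoc]
  congr 1
  refine IsLocalization.ringHom_ext (Submonoid.powers t) ?_
  ext x
  simp [IsLocalization.Away.lift_eq]

end AlgebraicGeometry.Proj

end

/-! ### Field-valued points of projective space and their homogeneous coordinates -/

noncomputable section

open HomogeneousLocalization Proj

variable {σ τ R K : Type} [CommRing R] [Field K] [Algebra R K]

/-- Evaluation at the vector `x` as a ring homomorphism out of the ring of functions on the
basic open `t ≠ 0`. -/
abbrev evalAway (x : σ → K) (t : MvPolynomial σ R) (h : MvPolynomial.aeval x t ≠ 0) :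
    Away (MvPolynomial.homogeneousSubmodule σ R) t →+* K :=
  awayLift _ (MvPolynomial.aeval x).toRingHom t (isUnit_iff_ne_zero.mpr h)

theorem evalAway_mk (x : σ → K) (t : MvPolynomial σ R) (h : MvPolynomial.aeval x t ≠ 0)
    {d : ℕ} (hd : t ∈ MvPolynomial.homogeneousSubmodule σ R d) (n : ℕ) (a : MvPolynomial σ R)
    (ha : a ∈ MvPolynomial.homogeneousSubmodule σ R (n • d)) :
    evalAway x t h (Away.mk (MvPolynomial.homogeneousSubmodule σ R) hd n a ha) =
      MvPolynomial.aeval x a / MvPolynomial.aeval x t ^ n := by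
  have := awayLift_mk (MvPolynomial.homogeneousSubmodule σ R) (MvPolynomial.aeval x).toRingHom t
    (isUnit_iff_ne_zero.mpr h) hd n a ha
  refine (eq_div_iff (pow_ne_zero _ h)).mpr ?_
  exact this

/-- This makes points computable: on the chart `t ≠ 0` the point is the ring homomorphism `a / t ^ n
↦ a(x) / t(x) ^ n`. -/
theorem projPoint_eq_awayι (x : σ → K) (hx : x ≠ 0) (t : MvPolynomial σ R) {d : ℕ}
    (hd : t ∈ MvPolynomial.homogeneousSubmodule σ R d) (h0 : 0 < d)
    (h : MvPolynomial.aeval x t ≠ 0) :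
    projPoint R x hx = Spec.map (CommRingCat.ofHom (evalAway x t h)) ≫
      awayι (MvPolynomial.homogeneousSubmodule σ R) t hd h0 := by
  have hu : IsUnit ((MvPolynomial.aeval x).toRingHom t) := isUnit_iff_ne_zero.mpr h
  have hu' : IsUnit (evalSections (R := R) x t) := hu.map (Scheme.ΓSpecIso (.of K)).inv.hom
  refine (fromOfGlobalSections_eq _ (evalSections x) (evalSections_irrelevant x hx) t hd h0
    hu').trans ?_
  rw [← Category.assoc]
  congr 1
  have e : awayLift (MvPolynomial.homogeneousSubmodule σ R) (evalSections x) t hu' =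
      (Scheme.ΓSpecIso (.of K)).inv.hom.comp (evalAway x t h) :=
    awayLift_comp _ _ _ t hu hu'
  have e2 : CommRingCat.ofHom (awayLift (MvPolynomial.homogeneousSubmodule σ R)
      (evalSections x) t hu') = CommRingCat.ofHom (evalAway x t h) ≫ (Scheme.ΓSpecIso (.of K)).inv := by
    ext a
    exact DFunLike.congr_fun e a
  rw [e2, Spec.map_comp, ← Category.assoc]
  have h1 : (Spec (.of K)).toSpecΓ ≫ Spec.map (Scheme.ΓSpecIso (.of K)).inv = 𝟙 _ := by
    simp
  rw [h1, Category.id_comp]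

instance (K : Type) [Field K] : Unique (Spec (.of K)) :=
  inferInstanceAs (Unique (PrimeSpectrum K))

/-- The point of projective space underlying the field-valued point `[x]`. -/
def projPt (R : Type) [CommRing R] [Algebra R K] (x : σ → K) (hx : x ≠ 0) : ProjSpace σ R :=
  projPoint R x hx default

theorem projPoint_apply (x : σ → K) (hx : x ≠ 0) (z : Spec (.of K)) :
    projPoint R x hx z = projPt R x hx := by
  rw [projPt, Unique.eq_default z]

theorem mem_projPt_of_pos (x : σ → K) (hx : x ≠ 0) {f : MvPolynomial σ R} {n : ℕ}
    (hn : 0 < n) (hf : f.IsHomogeneous n) :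
    f ∈ (projPt R x hx).asHomogeneousIdeal ↔ MvPolynomial.aeval x f = 0 := by
  have h := fromOfGlobalSections_preimage_basicOpen (MvPolynomial.homogeneousSubmodule σ R)
    (evalSections (R := R) x) (evalSections_irrelevant x hx) hn hf
  have h1 : (default : Spec (.of K)) ∈ projPoint R x hx ⁻¹ᵁ Proj.basicOpen _ f ↔
      f ∉ (projPt R x hx).asHomogeneousIdeal := Iff.rfl
  rw [← not_iff_not, ← h1, projPoint, h, Scheme.mem_basicOpen_top]
  constructor
  · intro hu h0
    have : evalSections x f = 0 := by
      change (Scheme.ΓSpecIso (.of K)).inv.hom (MvPolynomial.aeval x f) = 0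
      rw [h0, map_zero]
    rw [this, map_zero] at hu
    exact not_isUnit_zero hu
  · intro h0
    refine IsUnit.map _ ?_
    exact (isUnit_iff_ne_zero.mpr h0 : IsUnit (MvPolynomial.aeval x f)).map
      (Scheme.ΓSpecIso (.of K)).inv.hom

theorem mem_projPt (x : σ → K) (hx : x ≠ 0) {f : MvPolynomial σ R} {n : ℕ}
    (hf : f.IsHomogeneous n) :
    f ∈ (projPt R x hx).asHomogeneousIdeal ↔ MvPolynomial.aeval x f = 0 := by
  obtain ⟨i, hi⟩ := Function.ne_iff.mp hx
  -- Multiplication by a coordinate that is nonzero at `x` makes the degree positive, which covers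
  -- `n = 0`.
  have h1 := mem_projPt_of_pos x hx (Nat.succ_pos n) (hf.mul (MvPolynomial.isHomogeneous_X R i))
  have h2 := mem_projPt_of_pos x hx one_pos (MvPolynomial.isHomogeneous_X R i)
  have hp := (projPt R x hx).isPrime
  rw [MvPolynomial.aeval_X] at h2
  have h3 : MvPolynomial.X i ∉ (projPt R x hx).asHomogeneousIdeal := fun h => hi (h2.mp h)
  have hi' : x i ≠ 0 := hi
  rw [map_mul, MvPolynomial.aeval_X, mul_eq_zero, or_iff_left hi'] at h1
  refine Iff.trans ?_ h1
  exact ⟨fun h => Ideal.mul_mem_right _ _ h, fun h => (hp.mem_or_mem h).resolve_right h3⟩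

/-- The coordinates generate the polynomial ring over its degree zero part, so the charts they
define cover. -/
theorem exists_notMem_X (p : ProjSpace σ R) :
    ∃ i : σ, (MvPolynomial.X i : MvPolynomial σ R) ∉ p.asHomogeneousIdeal := by
  have h := iSup_basicOpen_eq_top' (MvPolynomial.homogeneousSubmodule σ R)
    (fun i : σ => (MvPolynomial.X i : MvPolynomial σ R))
    (fun i => ⟨1, MvPolynomial.isHomogeneous_X R i⟩) (by
      rw [eq_top_iff]
      rintro f -
      induction f using MvPolynomial.induction_on with
      | C r =>
        exact Subalgebra.algebraMap_mem (Algebra.adjoin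
          (MvPolynomial.homogeneousSubmodule σ R 0) _) ⟨_, MvPolynomial.isHomogeneous_C σ r⟩
      | add f g hf hg => exact add_mem hf hg
      | mul_X f i hf => exact mul_mem hf (Algebra.subset_adjoin ⟨i, rfl⟩))
  have hp : p ∈ (⊤ : (ProjSpace σ R).Opens) := trivial
  rw [← h] at hp
  exact TopologicalSpace.Opens.mem_iSup.mp hp

/-- A point of projective space is the underlying point of a field-valued point. -/
theorem exists_projPt_eq (p : ProjSpace σ R) :
    ∃ (K : Type) (_ : Field K) (_ : Algebra R K) (x : σ → K) (hx : x ≠ 0), projPt R x hx = p := by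
  have hp := p.isPrime
  -- The coordinates are the classes of the variables in the function field of the affine cone over
  -- the closure of `p`.
  let A := MvPolynomial σ R ⧸ p.asHomogeneousIdeal.toIdeal
  let K := FractionRing A
  let φ : MvPolynomial σ R →ₐ[R] K :=
    (IsScalarTower.toAlgHom R A K).comp (Ideal.Quotient.mkₐ R p.asHomogeneousIdeal.toIdeal)
  have hφ : ∀ f, φ f = 0 ↔ f ∈ p.asHomogeneousIdeal := by
    intro f
    change algebraMap A K (Ideal.Quotient.mk _ f) = 0 ↔ _
    rw [FaithfulSMul.algebraMap_eq_zero_iff, Ideal.Quotient.eq_zero_iff_mem]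
    rfl
  let x : σ → K := fun i => φ (MvPolynomial.X i)
  have hx : MvPolynomial.aeval x = φ := (MvPolynomial.aeval_unique φ).symm
  obtain ⟨i, hi⟩ := exists_notMem_X p
  have hx0 : x ≠ 0 := fun h => hi ((hφ _).mp (congrFun h i))
  refine ⟨K, inferInstance, inferInstance, x, hx0, ?_⟩
  refine ProjectiveSpectrum.ext (HomogeneousIdeal.ext'
    (𝒜 := MvPolynomial.homogeneousSubmodule σ R) fun n f hf => ?_)
  rw [mem_projPt x hx0 hf, hx, hφ]

theorem aeval_mul_of_isHomogeneous {S : Type} [CommRing S] [Algebra R S] (c : S) (x : σ → S)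
    {f : MvPolynomial σ R} {n : ℕ} (hf : f.IsHomogeneous n) :
    MvPolynomial.aeval (fun i => c * x i) f = c ^ n * MvPolynomial.aeval x f := by
  rw [MvPolynomial.aeval_def, MvPolynomial.aeval_def, MvPolynomial.eval₂_eq, MvPolynomial.eval₂_eq,
    Finset.mul_sum]
  refine Finset.sum_congr rfl fun e he => ?_
  have h := hf (MvPolynomial.mem_support_iff.mp he)
  have h' : Finsupp.degree e = n := by
    rw [Finsupp.degree_eq_weight_one]
    exact h
  rw [← h', Finsupp.degree_apply, ← Finset.prod_pow_eq_pow_sum]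
  simp only [mul_pow, Finset.prod_mul_distrib]
  ring

theorem aeval_smul_of_isHomogeneous (c : K) (x : σ → K) {f : MvPolynomial σ R} {n : ℕ}
    (hf : f.IsHomogeneous n) :
    MvPolynomial.aeval (c • x) f = c ^ n * MvPolynomial.aeval x f :=
  aeval_mul_of_isHomogeneous c x hf

theorem projPoint_smul (x : σ → K) (hx : x ≠ 0) (c : K) (hcx : c • x ≠ 0) :
    projPoint R (c • x) hcx = projPoint R x hx := by
  obtain ⟨i, hi⟩ := Function.ne_iff.mp hcx
  have hc : c ≠ 0 := fun h => hcx (by rw [h, zero_smul])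
  have hi' : x i ≠ 0 := fun h => hi (by simp [h])
  have hX : MvPolynomial.X i ∈ MvPolynomial.homogeneousSubmodule σ R 1 :=
    MvPolynomial.isHomogeneous_X R i
  rw [projPoint_eq_awayι x hx (MvPolynomial.X i) hX one_pos (by simpa using hi'),
    projPoint_eq_awayι (c • x) hcx (MvPolynomial.X i) hX one_pos (by simpa using hi)]
  congr 3
  ext a
  obtain ⟨n, a, ha, rfl⟩ := Away.mk_surjective (MvPolynomial.homogeneousSubmodule σ R) hX a
  rw [evalAway_mk, evalAway_mk, aeval_smul_of_isHomogeneous c x ha,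
    aeval_smul_of_isHomogeneous c x hX, mul_pow, ← pow_mul, smul_eq_mul, mul_comm 1 n,
    mul_div_mul_left _ _ (pow_ne_zero _ hc)]

theorem projPoint_eq_iff (x y : σ → K) (hx : x ≠ 0) (hy : y ≠ 0) :
    projPoint R x hx = projPoint R y hy ↔ ∃ c : K, c ≠ 0 ∧ y = c • x := by
  constructor
  · intro h
    obtain ⟨i, hi⟩ := Function.ne_iff.mp hx
    have hX : MvPolynomial.X i ∈ MvPolynomial.homogeneousSubmodule σ R 1 :=
    MvPolynomial.isHomogeneous_X R i
    have hpt : projPt R x hx = projPt R y hy := by rw [projPt, h, projPt]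
    have hyi : y i ≠ 0 := by
      have h1 := mem_projPt x hx hX
      rw [hpt, mem_projPt y hy hX, MvPolynomial.aeval_X, MvPolynomial.aeval_X] at h1
      exact fun h => hi (h1.mp h)
    refine ⟨y i / x i, div_ne_zero hyi hi, ?_⟩
    rw [projPoint_eq_awayι x hx (MvPolynomial.X i) hX one_pos (by simpa using hi),
      projPoint_eq_awayι y hy (MvPolynomial.X i) hX one_pos (by simpa using hyi),
      cancel_mono] at h
    have h2 := congrArg CommRingCat.Hom.hom (Spec.map_injective h)
    simp only [CommRingCat.hom_ofHom] at h2
    funext l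
    -- Compare the two ring homomorphisms on the functions `X_l / X_i`.
    have h3 := DFunLike.congr_fun h2 (Away.mk (MvPolynomial.homogeneousSubmodule σ R) hX 1
      (MvPolynomial.X l) (MvPolynomial.isHomogeneous_X R l))
    have h4 : (MvPolynomial.X l : MvPolynomial σ R) ∈
      MvPolynomial.homogeneousSubmodule σ R (1 • 1) := MvPolynomial.isHomogeneous_X R l
    rw [evalAway_mk x _ _ hX 1 _ h4, evalAway_mk y _ _ hX 1 _ h4] at h3
    simp only [MvPolynomial.aeval_X, pow_one] at h3
    simp only [Pi.smul_apply, smul_eq_mul]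
    field_simp at h3
    rw [← h3]
    ring
  · rintro ⟨c, hc, rfl⟩
    exact (projPoint_smul x hx c hy).symm

end

/-! ### The generic point, and rational maps determined by their value there -/

noncomputable section

open HomogeneousLocalization Proj

variable {σ τ R : Type} [CommRing R]

theorem homogeneousLocalization_isReduced {ι A S : Type} [CommRing A] [IsDomain A] [SetLike S A]
    [AddSubgroupClass S A] [AddCommMonoid ι] [DecidableEq ι] (𝒜 : ι → S) [GradedRing 𝒜]
    (P : Ideal A) [P.IsPrime] : _root_.IsReduced (HomogeneousLocalization.AtPrime 𝒜 P) := by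
  have : IsDomain (Localization.AtPrime P) :=
    IsLocalization.isDomain_localization P.primeCompl_le_nonZeroDivisors
  exact isReduced_of_injective
    (algebraMap (HomogeneousLocalization.AtPrime 𝒜 P) (Localization.AtPrime P))
    (HomogeneousLocalization.val_injective _)

/-- The stalks embed into localizations of a polynomial ring over a domain. Reducedness is what lets
a dominant point detect equality of morphisms. -/
instance [IsDomain R] : AlgebraicGeometry.IsReduced (ProjSpace σ R) := by
  have (p : ProjSpace σ R) : _root_.IsReduced ((ProjSpace σ R).presheaf.stalk p) := by
    have hp := p.isPrime
    have := homogeneousLocalization_isReduced (MvPolynomial.homogeneousSubmodule σ R)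
      p.asHomogeneousIdeal.toIdeal
    exact isReduced_of_injective _ (stalkIso _ p).commRingCatIsoToRingEquiv.injective
  exact isReduced_of_isReduced_stalk _

/-- The homogeneous coordinates of the generic point of projective space. -/
def genericVec (σ R : Type) [CommRing R] : σ → FractionRing (MvPolynomial σ R) :=
  fun i => algebraMap (MvPolynomial σ R) _ (MvPolynomial.X i)

theorem aeval_genericVec (f : MvPolynomial σ R) :
    MvPolynomial.aeval (genericVec σ R) f =
      algebraMap (MvPolynomial σ R) (FractionRing (MvPolynomial σ R)) f := by
  have : MvPolynomial.aeval (genericVec σ R) =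
      IsScalarTower.toAlgHom R (MvPolynomial σ R) (FractionRing (MvPolynomial σ R)) := by
    ext i
    simp [genericVec]
  rw [this]
  rfl

theorem genericVec_ne_zero [IsDomain R] [Nonempty σ] : genericVec σ R ≠ 0 := by
  obtain ⟨i⟩ := ‹Nonempty σ›
  refine Function.ne_iff.mpr ⟨i, ?_⟩
  simp [genericVec]

theorem mem_closure_projPt {K : Type} [Field K] [Algebra R K] (x : σ → K) (hx : x ≠ 0)
    (p : ProjSpace σ R) :
    p ∈ closure {projPt R x hx} ↔ ∀ (f : MvPolynomial σ R) (n : ℕ), f.IsHomogeneous n →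
      MvPolynomial.aeval x f = 0 → f ∈ p.asHomogeneousIdeal := by
  refine (ProjectiveSpectrum.le_iff_mem_closure (MvPolynomial.homogeneousSubmodule σ R)
    (projPt R x hx) p).symm.trans ?_
  constructor
  · intro h f n hf hfx
    exact h ((mem_projPt x hx hf).mpr hfx)
  · classical
    intro h f hf
    have hf' : f ∈ (projPt R x hx).asHomogeneousIdeal := hf
    rw [← DirectSum.sum_support_decompose (MvPolynomial.homogeneousSubmodule σ R) f]
    refine Ideal.sum_mem _ fun n _ => ?_
    have h1 : ((DirectSum.decompose (MvPolynomial.homogeneousSubmodule σ R) f n :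
      MvPolynomial.homogeneousSubmodule σ R n) : MvPolynomial σ R).IsHomogeneous n :=
      (DirectSum.decompose (MvPolynomial.homogeneousSubmodule σ R) f n).2
    refine h _ n h1 ((mem_projPt x hx h1).mp ?_)
    exact (projPt R x hx).asHomogeneousIdeal.isHomogeneous n hf'

/-- Only the zero form vanishes at the vector of the variables themselves, so every point lies in
the closure. -/
instance [IsDomain R] [Nonempty σ] : IsDominant (projPoint R (genericVec σ R) genericVec_ne_zero) := by
  constructor
  intro p
  refine closure_mono (s := {projPt R (genericVec σ R) genericVec_ne_zero}) ?_ ?_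
  · rintro _ rfl
    exact ⟨default, rfl⟩
  · rw [mem_closure_projPt]
    intro f n _ h
    rw [aeval_genericVec, FaithfulSMul.algebraMap_eq_zero_iff] at h
    rw [h]
    exact zero_mem _

theorem isDominant_of_comp_ι {Y X : Scheme.{0}} {U : X.Opens} (q : Y ⟶ U.toScheme)
    (h : IsDominant (q ≫ U.ι)) : IsDominant q := by
  constructor
  have h1 := h.denseRange.preimage U.ι.isOpenEmbedding.isOpenMap
  have h2 : U.ι ⁻¹' Set.range (q ≫ U.ι) = Set.range q := by
    ext z
    constructor
    · rintro ⟨y, hy⟩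
      refine ⟨y, U.ι.isOpenEmbedding.injective ?_⟩
      rw [← hy]; rfl
    · rintro ⟨y, rfl⟩
      exact ⟨y, rfl⟩
  rwa [h2] at h1

theorem range_subset_of_mem {X : Scheme.{0}} {K : Type} [Field K] (f : Spec (.of K) ⟶ X)
    {U : X.Opens} (h : f default ∈ U) : Set.range f ⊆ Set.range U.ι := by
  rintro _ ⟨z, rfl⟩
  rw [Scheme.Opens.range_ι, Unique.eq_default z]
  exact h

/-- The lift of a field-valued point to an open subscheme containing its image. -/
def liftPt {X : Scheme.{0}} {K : Type} [Field K] (f : Spec (.of K) ⟶ X)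
    (U : X.Opens) (h : f default ∈ U) : Spec (.of K) ⟶ U.toScheme :=
  IsOpenImmersion.lift U.ι f (range_subset_of_mem f h)

@[simp] theorem liftPt_ι {X : Scheme.{0}} {K : Type} [Field K] (f : Spec (.of K) ⟶ X)
    (U : X.Opens) (h : f default ∈ U) : liftPt f U h ≫ U.ι = f :=
  IsOpenImmersion.lift_fac _ _ _

theorem mem_of_comp_ι {X : Scheme.{0}} {K : Type} [Field K] {f : Spec (.of K) ⟶ X}
    {U : X.Opens} {p : Spec (.of K) ⟶ U.toScheme} (h : p ≫ U.ι = f) : f default ∈ U := by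
  rw [← h]
  exact (p default).2

theorem eq_liftPt {X : Scheme.{0}} {K : Type} [Field K] {f : Spec (.of K) ⟶ X}
    {U : X.Opens} {p : Spec (.of K) ⟶ U.toScheme} (h : p ≫ U.ι = f) :
    p = liftPt f U (mem_of_comp_ι h) := by
  rw [← cancel_mono U.ι, h, liftPt_ι]

/-- On the intersection of the domains, two morphisms from a reduced scheme to a separated one agree
as soon as they agree after a dominant morphism. -/
theorem equiv_of_eq_at_dominant_point {X Y : Scheme.{0}} [AlgebraicGeometry.IsReduced X]
    [Y.IsSeparated] {K : Type}
    [Field K] (η : Spec (.of K) ⟶ X) [IsDominant η] (g g' : X.PartialMap Y)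
    (h : η default ∈ g.domain) (h' : η default ∈ g'.domain)
    (e : liftPt η _ h ≫ g.hom = liftPt η _ h' ≫ g'.hom) : g.equiv g' := by
  have hd : Dense ((g.domain ⊓ g'.domain : X.Opens) : Set X) :=
    g.dense_domain.inter_of_isOpen_left g'.dense_domain g.domain.2
  refine ⟨g.domain ⊓ g'.domain, hd, inf_le_left, inf_le_right, ?_⟩
  have hq : η default ∈ g.domain ⊓ g'.domain := ⟨h, h'⟩
  have : IsDominant (liftPt η _ hq) := isDominant_of_comp_ι _ (by rwa [liftPt_ι])
  have e1 : liftPt η _ hq ≫ X.homOfLE inf_le_left = liftPt η _ h := by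
    rw [← cancel_mono (Scheme.Opens.ι _)]; simp
  have e2 : liftPt η _ hq ≫ X.homOfLE inf_le_right = liftPt η _ h' := by
    rw [← cancel_mono (Scheme.Opens.ι _)]; simp
  refine ext_of_isDominant (X := (g.domain ⊓ g'.domain : X.Opens).toScheme)
    (f := X.homOfLE inf_le_left ≫ g.hom) (g := X.homOfLE inf_le_right ≫ g'.hom)
    (liftPt η _ hq) ?_
  rw [← Category.assoc, ← Category.assoc, e1, e2, e]

/-- Equivalent partial maps take the same values at field-valued points. -/
theorem liftPt_comp_eq_of_equiv {X Y : Scheme.{0}} [AlgebraicGeometry.IsReduced X]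
    [Y.IsSeparated] {K : Type}
    [Field K] (η : Spec (.of K) ⟶ X) (g g' : X.PartialMap Y)
    (h : η default ∈ g.domain) (h' : η default ∈ g'.domain) (e : g.equiv g') :
    liftPt η _ h ≫ g.hom = liftPt η _ h' ≫ g'.hom := by
  have e3 := (Scheme.PartialMap.equiv_iff_of_isSeparated (S := ⊤_ _)).mp e
  have hq : η default ∈ g.domain ⊓ g'.domain := ⟨h, h'⟩
  have e1 : liftPt η _ hq ≫ X.homOfLE inf_le_left = liftPt η _ h := by
    rw [← cancel_mono (Scheme.Opens.ι _)]; simp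
  have e2 : liftPt η _ hq ≫ X.homOfLE inf_le_right = liftPt η _ h' := by
    rw [← cancel_mono (Scheme.Opens.ι _)]; simp
  rw [Scheme.PartialMap.restrict_hom, Scheme.PartialMap.restrict_hom] at e3
  rw [← e1, ← e2, Category.assoc, Category.assoc]
  exact congrArg (fun u => liftPt η _ hq ≫ u) e3

theorem sendsTo_toRationalMap_iff [IsDomain R] {K : Type} [Field K] [Algebra R K]
    (g : (ProjSpace σ R).PartialMap (ProjSpace τ R)) (x : σ → K) (y : τ → K)
    (hx : x ≠ 0) (h : projPt R x hx ∈ g.domain) :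
    SendsTo g.toRationalMap x y ↔ ∃ hy : y ≠ 0,
      liftPt (projPoint R x hx) _ h ≫ g.hom = projPoint R y hy := by
  constructor
  · rintro ⟨_, hy, g', e, p, hp, hp'⟩
    refine ⟨hy, ?_⟩
    rw [eq_liftPt hp] at hp'
    rw [← hp']
    exact liftPt_comp_eq_of_equiv _ _ _ _ _ (Scheme.PartialMap.toRationalMap_eq_iff.mp e.symm)
  · rintro ⟨hy, e⟩
    exact ⟨hx, hy, g, rfl, _, liftPt_ι _ _ _, e⟩

/-- The two values may come from different representatives; these agree wherever both are defined
because the target is separated. -/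
theorem SendsTo.eq_smul [IsDomain R] {K : Type} [Field K] [Algebra R K]
    {Φ : (ProjSpace σ R).RationalMap (ProjSpace τ R)} {x : σ → K} {y y' : τ → K}
    (h : SendsTo Φ x y) (h' : SendsTo Φ x y') : ∃ c : K, c ≠ 0 ∧ y' = c • y := by
  obtain ⟨hx, hy, g, rfl, p, hp, hp'⟩ := h
  have hg : projPt R x hx ∈ g.domain := mem_of_comp_ι hp
  obtain ⟨hy1, e1⟩ := (sendsTo_toRationalMap_iff g x y hx hg).mp ⟨hx, hy, g, rfl, p, hp, hp'⟩
  obtain ⟨hy2, e2⟩ := (sendsTo_toRationalMap_iff g x y' hx hg).mp h'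
  exact (projPoint_eq_iff y y' hy1 hy2).mp (e1.symm.trans e2)

theorem SendsTo.smul [IsDomain R] {K : Type} [Field K] [Algebra R K]
    {Φ : (ProjSpace σ R).RationalMap (ProjSpace τ R)} {x : σ → K} {y : τ → K}
    (h : SendsTo Φ x y) {c : K} (hc : c ≠ 0) : SendsTo Φ x (c • y) := by
  obtain ⟨hx, hy, g, rfl, p, hp, hp'⟩ := h
  have : c • y ≠ 0 := smul_ne_zero hc hy
  exact ⟨hx, this, g, rfl, p, hp, by rw [hp', projPoint_smul y hy c this]⟩

/-- Rational maps of projective spaces agreeing at the generic point are equal. -/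
theorem eq_of_sendsTo_generic [IsDomain R] [Nonempty σ]
    {Φ Φ' : (ProjSpace σ R).RationalMap (ProjSpace τ R)}
    {y : τ → FractionRing (MvPolynomial σ R)}
    (h : SendsTo Φ (genericVec σ R) y) (h' : SendsTo Φ' (genericVec σ R) y) : Φ = Φ' := by
  obtain ⟨hx, hy, g, rfl, p, hp, e⟩ := h
  obtain ⟨_, _, g', rfl, p', hp', e'⟩ := h'
  refine Scheme.PartialMap.toRationalMap_eq_iff.mpr
    (equiv_of_eq_at_dominant_point (projPoint R _ hx) g g' (mem_of_comp_ι hp)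
      (mem_of_comp_ι hp') ?_)
  rw [← eq_liftPt hp, ← eq_liftPt hp', e, e']

theorem projPt_genericVec_mem [IsDomain R] [Nonempty σ] {U : (ProjSpace σ R).Opens}
    (hU : (U : Set (ProjSpace σ R)).Nonempty) :
    projPt R (genericVec σ R) genericVec_ne_zero ∈ U := by
  obtain ⟨_, hp, z, rfl⟩ := ((inferInstance : IsDominant (projPoint R (genericVec σ R)
    genericVec_ne_zero)).denseRange).inter_open_nonempty U U.2 hU
  rwa [projPoint_apply] at hp

theorem dense_of_nonempty [IsDomain R] [Nonempty σ] {U : (ProjSpace σ R).Opens}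
    (hU : (U : Set (ProjSpace σ R)).Nonempty) : Dense (U : Set (ProjSpace σ R)) := by
  refine ((inferInstance : IsDominant (projPoint R (genericVec σ R)
    genericVec_ne_zero)).denseRange).mono ?_
  rintro _ ⟨z, rfl⟩
  rw [projPoint_apply]
  exact projPt_genericVec_mem hU

end

/-! ### The rational map given by forms, on the chart where one form is nonzero -/

noncomputable section

open HomogeneousLocalization Proj

section Chart

variable {σ τ R : Type} [CommRing R] {n : ℕ} {F : τ → MvPolynomial σ R}

/-- The ring homomorphism `y_i ↦ F_i / F_j` to the functions on the basic open `F_j ≠ 0`. -/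
def chartEval (hF : ∀ j, F j ∈ MvPolynomial.homogeneousSubmodule σ R n) (j : τ) :
    MvPolynomial τ R →+* Away (MvPolynomial.homogeneousSubmodule σ R) (F j) :=
  MvPolynomial.eval₂Hom
    ((fromZeroRingHom (MvPolynomial.homogeneousSubmodule σ R) (Submonoid.powers (F j))).comp
      (algebraMap R (MvPolynomial.homogeneousSubmodule σ R 0)))
    fun i => Away.mk (MvPolynomial.homogeneousSubmodule σ R) (d := n) (f := F j) (hF j) 1 (F i)
      (by rw [one_smul]; exact hF i)

theorem isUnit_chartEval_X (hF : ∀ j, F j ∈ MvPolynomial.homogeneousSubmodule σ R n) (j : τ) :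
    IsUnit (chartEval hF j (MvPolynomial.X j)) := by
  have : chartEval hF j (MvPolynomial.X j) = 1 := by
    rw [chartEval, MvPolynomial.eval₂Hom_X']
    apply HomogeneousLocalization.val_injective
    simp only [Away.val_mk, val_one, pow_one]
    exact Localization.mk_self (⟨F j, Submonoid.mem_powers _⟩ : Submonoid.powers (F j))
  rw [this]
  exact isUnit_one

/-- The chart sees the value `[F_i(x)]` through the representative whose `j`-th coordinate is `1`.
-/
theorem evalAway_comp_chartEval (hF : ∀ j, F j ∈ MvPolynomial.homogeneousSubmodule σ R n) (j : τ) {K : Type} [Field K]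
    [Algebra R K] (x : σ → K) (h : MvPolynomial.aeval x (F j) ≠ 0) :
    (evalAway x (F j) h).comp (chartEval hF j) =
      (MvPolynomial.aeval ((MvPolynomial.aeval x (F j))⁻¹ •
        fun i => MvPolynomial.aeval x (F i))).toRingHom := by
  refine MvPolynomial.ringHom_ext ?_ ?_
  · intro r
    rw [RingHom.comp_apply, chartEval, MvPolynomial.eval₂Hom_C, RingHom.comp_apply]
    have h1 : (MvPolynomial.aeval x (MvPolynomial.C r : MvPolynomial σ R)) = algebraMap R K r :=
      MvPolynomial.aeval_C x r
    have h2 : fromZeroRingHom (MvPolynomial.homogeneousSubmodule σ R) (Submonoid.powers (F j))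
        (algebraMap R (MvPolynomial.homogeneousSubmodule σ R 0) r) =
        Away.mk (MvPolynomial.homogeneousSubmodule σ R) (d := n) (f := F j) (hF j) 0
          (MvPolynomial.C r) (by rw [zero_smul]; exact MvPolynomial.isHomogeneous_C σ r) := by
      apply HomogeneousLocalization.val_injective
      rw [Away.val_mk]
      change Localization.mk _ _ = _
      congr 1
    rw [h2, evalAway_mk x (F j) h (hF j), h1, pow_zero, div_one]
    exact (MvPolynomial.aeval_C _ r).symm
  · intro i
    rw [RingHom.comp_apply, chartEval, MvPolynomial.eval₂Hom_X',
      evalAway_mk x (F j) h (hF j), pow_one, div_eq_inv_mul]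
    exact (MvPolynomial.aeval_X (((MvPolynomial.aeval x (F j))⁻¹ •
        fun i => MvPolynomial.aeval x (F i)) : τ → K) i).symm

/-- The morphism `[x] ↦ [F_i(x)]_i` on the basic open `F_j ≠ 0`. -/
def chartHom (hF : ∀ j, F j ∈ MvPolynomial.homogeneousSubmodule σ R n) (hn : 0 < n) (j : τ) :
    (Proj.basicOpen (MvPolynomial.homogeneousSubmodule σ R) (F j)).toScheme ⟶ ProjSpace τ R :=
  (basicOpenIsoSpec _ (F j) (hF j) hn).hom ≫
    Spec.map (CommRingCat.ofHom (awayLift (MvPolynomial.homogeneousSubmodule τ R)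
      (chartEval hF j) (MvPolynomial.X j) (isUnit_chartEval_X hF j))) ≫
    awayι (MvPolynomial.homogeneousSubmodule τ R) (MvPolynomial.X j)
      (MvPolynomial.isHomogeneous_X R j) one_pos

/-- The partial map `[x] ↦ [F_i(x)]_i` on the basic open `F_j ≠ 0`. -/
def chartMap [IsDomain R] [Nonempty σ] (hF : ∀ j, F j ∈ MvPolynomial.homogeneousSubmodule σ R n) (hn : 0 < n) (j : τ)
    (hj : F j ≠ 0) : (ProjSpace σ R).PartialMap (ProjSpace τ R) where
  domain := Proj.basicOpen _ (F j)
  dense_domain := dense_of_nonempty ⟨projPt R (genericVec σ R) genericVec_ne_zero, by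
    change F j ∉ (projPt R (genericVec σ R) genericVec_ne_zero).asHomogeneousIdeal
    rw [mem_projPt _ _ (hF j), aeval_genericVec, FaithfulSMul.algebraMap_eq_zero_iff]
    exact hj⟩
  hom := chartHom hF hn j

theorem ne_zero_of_aeval_ne_zero (hF : ∀ j, F j ∈ MvPolynomial.homogeneousSubmodule σ R n) (hn : 0 < n) {K : Type}
    [Field K] [Algebra R K] {x : σ → K} {j : τ} (h : MvPolynomial.aeval x (F j) ≠ 0) : x ≠ 0 := by
  rintro rfl
  have := aeval_smul_of_isHomogeneous (0 : K) 0 (hF j)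
  rw [smul_zero, zero_pow hn.ne', zero_mul] at this
  exact h this

theorem spec_map_comp_chartHom (hF : ∀ j, F j ∈ MvPolynomial.homogeneousSubmodule σ R n)
    (hn : 0 < n) (j : τ) {K : Type} [Field K] [Algebra R K] (x : σ → K)
    (h : MvPolynomial.aeval x (F j) ≠ 0)
    (hy : (fun i => MvPolynomial.aeval x (F i)) ≠ 0) :
    Spec.map (CommRingCat.ofHom (evalAway x (F j) h)) ≫
      (basicOpenIsoSpec _ (F j) (hF j) hn).inv ≫ chartHom hF hn j = projPoint R _ hy := by
  have hc := inv_ne_zero h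
  have hcy := smul_ne_zero hc hy
  have hX : MvPolynomial.aeval ((MvPolynomial.aeval x (F j))⁻¹ •
      fun i => MvPolynomial.aeval x (F i)) (MvPolynomial.X j : MvPolynomial τ R) ≠ 0 := by
    rw [MvPolynomial.aeval_X]
    exact mul_ne_zero hc h
  rw [← projPoint_smul _ hy _ hcy, projPoint_eq_awayι _ hcy (MvPolynomial.X j)
    (MvPolynomial.isHomogeneous_X R j) one_pos hX, chartHom,
    Iso.inv_hom_id_assoc, ← Category.assoc, ← Spec.map_comp, ← CommRingCat.ofHom_comp]
  have hu : IsUnit (((evalAway x (F j) h).comp (chartEval hF j)) (MvPolynomial.X j)) :=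
    (isUnit_chartEval_X hF j).map (evalAway x (F j) h)
  have e := awayLift_comp (MvPolynomial.homogeneousSubmodule τ R) (chartEval hF j)
    (evalAway x (F j) h) (MvPolynomial.X j) (isUnit_chartEval_X hF j) hu
  rw [← e]
  simp only [evalAway_comp_chartEval hF j x h]

theorem chartMap_sendsTo [IsDomain R] [Nonempty σ] (hF : ∀ j, F j ∈ MvPolynomial.homogeneousSubmodule σ R n)
    (hn : 0 < n) (j : τ) (hj : F j ≠ 0) {K : Type} [Field K] [Algebra R K] (x : σ → K)
    (h : MvPolynomial.aeval x (F j) ≠ 0) :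
    SendsTo (chartMap hF hn j hj).toRationalMap x fun i => MvPolynomial.aeval x (F i) := by
  have hx := ne_zero_of_aeval_ne_zero hF hn h
  have hy : (fun i => MvPolynomial.aeval x (F i)) ≠ 0 := Function.ne_iff.mpr ⟨j, h⟩
  refine ⟨hx, hy, chartMap hF hn j hj, rfl,
    Spec.map (CommRingCat.ofHom (evalAway x (F j) h)) ≫
      (basicOpenIsoSpec _ (F j) (hF j) hn).inv, ?_, ?_⟩
  · rw [projPoint_eq_awayι x hx (F j) (hF j) hn h]
    exact Category.assoc _ _ _
  · exact (Category.assoc _ _ _).trans (spec_map_comp_chartHom hF hn j x h hy)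

end Chart

end

/-! ### Indeterminacy over a unique factorization domain -/

noncomputable section

open HomogeneousLocalization Proj

section Indeterminacy

variable {σ τ R : Type} [CommRing R]

theorem exists_homogeneous_basicOpen_le {p : ProjSpace σ R} {V : (ProjSpace σ R).Opens}
    (hp : p ∈ V) : ∃ (n : ℕ) (h : MvPolynomial σ R), 0 < n ∧
      h ∈ MvPolynomial.homogeneousSubmodule σ R n ∧ h ∉ p.asHomogeneousIdeal ∧
      Proj.basicOpen (MvPolynomial.homogeneousSubmodule σ R) h ≤ V := by
  classical
  obtain ⟨_, ⟨f, rfl⟩, hpf, hf⟩ := (TopologicalSpace.Opens.isBasis_iff_nbhd.mp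
    (isBasis_basicOpen (MvPolynomial.homogeneousSubmodule σ R))) hp
  obtain ⟨i, hi⟩ := exists_notMem_X p
  obtain ⟨k, hk⟩ : ∃ k, ((DirectSum.decompose (MvPolynomial.homogeneousSubmodule σ R) f k :
      MvPolynomial.homogeneousSubmodule σ R k) : MvPolynomial σ R) ∉ p.asHomogeneousIdeal := by
    by_contra! hall
    refine hpf ?_
    rw [← DirectSum.sum_support_decompose (MvPolynomial.homogeneousSubmodule σ R) f]
    exact Ideal.sum_mem _ fun n _ => hall n
  -- A homogeneous component of `f` outside `p` is multiplied by a coordinate outside `p`, so that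
  -- its degree becomes positive.
  refine ⟨k + 1, _, Nat.succ_pos k, SetLike.mul_mem_graded (SetLike.coe_mem _)
    (MvPolynomial.isHomogeneous_X R i), fun hmem => (p.isPrime.mem_or_mem hmem).elim hk hi,
    le_trans ?_ hf⟩
  intro q hq hfq
  exact hq (Ideal.mul_mem_right _ _ (q.asHomogeneousIdeal.isHomogeneous k hfq))

/-- If a rational map is given by the forms `F_j` and is defined at a point where `y_j ≠ 0` on the
image, then `F_j` divides every `F_i` up to a form not vanishing at the point. -/
theorem exists_dvd_mul_pow [IsDomain R] [Nonempty σ] {F : τ → MvPolynomial σ R}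
    {g : (ProjSpace σ R).PartialMap (ProjSpace τ R)}
    (hg : SendsTo g.toRationalMap (genericVec σ R)
      fun i => MvPolynomial.aeval (genericVec σ R) (F i))
    {p : g.domain} {j : τ} (hj : MvPolynomial.X j ∉ (g.hom p).asHomogeneousIdeal) :
    F j ≠ 0 ∧ ∃ h : MvPolynomial σ R, h ∉ p.1.asHomogeneousIdeal ∧
      ∀ i, ∃ N : ℕ, F j ∣ F i * h ^ N := by
  -- On `V` the map lands in the affine chart `y_j ≠ 0`. Shrinking to a basic open of a form `h`
  -- turns it into a map of affine schemes, that is, a ring homomorphism `ρ`.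
  let V : (ProjSpace σ R).Opens := g.domain.ι ''ᵁ (g.hom ⁻¹ᵁ
    Proj.basicOpen (MvPolynomial.homogeneousSubmodule τ R) (MvPolynomial.X j))
  have hpV : p.1 ∈ V := ⟨p, hj, rfl⟩
  obtain ⟨e, h, he, hh, hph, hV⟩ := exists_homogeneous_basicOpen_le hpV
  have hX : MvPolynomial.X j ∈ MvPolynomial.homogeneousSubmodule τ R 1 :=
    MvPolynomial.isHomogeneous_X R j
  have hrange : Set.range (awayι (MvPolynomial.homogeneousSubmodule σ R) h hh he) ⊆ V := by
    have := opensRange_awayι (MvPolynomial.homogeneousSubmodule σ R) h hh he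
    intro q hq
    refine hV ?_
    rw [← this]
    exact hq
  have hVd : (V : Set (ProjSpace σ R)) ⊆ Set.range g.domain.ι := by
    rintro _ ⟨q, _, rfl⟩
    exact ⟨q, rfl⟩
  let l := IsOpenImmersion.lift g.domain.ι (awayι (MvPolynomial.homogeneousSubmodule σ R) h hh he)
    (hrange.trans hVd)
  have hl : l ≫ g.domain.ι = awayι (MvPolynomial.homogeneousSubmodule σ R) h hh he :=
    IsOpenImmersion.lift_fac _ _ _
  have hr2 : Set.range (l ≫ g.hom) ⊆
      Set.range (awayι (MvPolynomial.homogeneousSubmodule τ R) (MvPolynomial.X j) hX one_pos) := by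
    rintro _ ⟨z, rfl⟩
    have h1 : g.domain.ι (l z) ∈ V := hrange ⟨z, by rw [← hl]; rfl⟩
    obtain ⟨q, hq, hq'⟩ := h1
    have h2 : q = l z := g.domain.ι.isOpenEmbedding.injective hq'
    have h3 := opensRange_awayι (MvPolynomial.homogeneousSubmodule τ R) (MvPolynomial.X j) hX
      one_pos
    change (l ≫ g.hom) z ∈ (awayι (MvPolynomial.homogeneousSubmodule τ R) (MvPolynomial.X j) hX
      one_pos).opensRange
    rw [h3]
    rw [h2] at hq
    exact hq
  let l' := IsOpenImmersion.lift (awayι (MvPolynomial.homogeneousSubmodule τ R)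
    (MvPolynomial.X j) hX one_pos) (l ≫ g.hom) hr2
  have hl' : l' ≫ awayι (MvPolynomial.homogeneousSubmodule τ R) (MvPolynomial.X j) hX one_pos =
    l ≫ g.hom := IsOpenImmersion.lift_fac _ _ _
  let ρ := (Spec.preimage l').hom
  have hρ : Spec.map (CommRingCat.ofHom ρ) = l' := Spec.map_preimage l'
  have hh0 : h ≠ 0 := fun h0 => hph (by rw [h0]; exact zero_mem _)
  have hξ : MvPolynomial.aeval (genericVec σ R) h ≠ 0 := by
    rw [aeval_genericVec, Ne, FaithfulSMul.algebraMap_eq_zero_iff]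
    exact hh0
  have hξ0 := genericVec_ne_zero (σ := σ) (R := R)
  let q := Spec.map (CommRingCat.ofHom (evalAway (genericVec σ R) h hξ)) ≫ l
  have hq : q ≫ g.domain.ι = projPoint R (genericVec σ R) hξ0 := by
    rw [projPoint_eq_awayι _ hξ0 h hh he hξ, ← hl]
    exact Category.assoc _ _ _
  obtain ⟨hy, hg'⟩ := (sendsTo_toRationalMap_iff g _ _ hξ0 (mem_of_comp_ι hq)).mp hg
  rw [← eq_liftPt hq] at hg'
  have hq2 : q ≫ g.hom = (Spec.map (CommRingCat.ofHom (evalAway (genericVec σ R) h hξ)) ≫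
      Spec.map (CommRingCat.ofHom ρ)) ≫
      awayι (MvPolynomial.homogeneousSubmodule τ R) (MvPolynomial.X j) hX one_pos := by
    rw [hρ, Category.assoc, Category.assoc, hl']
  rw [hq2] at hg'
  have hFj : MvPolynomial.aeval (genericVec σ R) (F j) ≠ 0 := by
    have h3 := opensRange_awayι (MvPolynomial.homogeneousSubmodule τ R) (MvPolynomial.X j) hX
      one_pos
    have h4 : projPt R _ hy ∈ (awayι (MvPolynomial.homogeneousSubmodule τ R) (MvPolynomial.X j) hX
      one_pos).opensRange := by
      rw [projPt, ← hg']
      exact ⟨_, rfl⟩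
    rw [h3] at h4
    intro h0
    refine h4 ((mem_projPt _ hy hX).mpr ?_)
    rw [MvPolynomial.aeval_X]
    exact h0
  have hFj' : MvPolynomial.aeval (fun i => MvPolynomial.aeval (genericVec σ R) (F i))
      (MvPolynomial.X j : MvPolynomial τ R) ≠ 0 := by
    rwa [MvPolynomial.aeval_X]
  rw [projPoint_eq_awayι _ hy (MvPolynomial.X j) hX one_pos hFj', cancel_mono,
    ← Spec.map_comp, ← CommRingCat.ofHom_comp] at hg'
  have hρ' := congrArg CommRingCat.Hom.hom (Spec.map_injective hg')
  simp only [CommRingCat.hom_ofHom] at hρ'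
  have hFj0 : F j ≠ 0 := fun h0 => hFj (by rw [h0, map_zero])
  refine ⟨hFj0, h, hph, fun i => ?_⟩
  have hXi : (MvPolynomial.X i : MvPolynomial τ R) ∈
    MvPolynomial.homogeneousSubmodule τ R (1 • 1) := MvPolynomial.isHomogeneous_X R i
  have h5 := DFunLike.congr_fun hρ' (Away.mk (MvPolynomial.homogeneousSubmodule τ R) hX 1 _ hXi)
  rw [RingHom.comp_apply, evalAway_mk _ _ hFj' hX 1 _ hXi] at h5
  -- The function `ρ(y_i / y_j)` is some `G / h ^ N`. At the generic point it equals `F_i / F_j`, so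
  -- `G F_j = F_i h ^ N` already holds between polynomials.
  obtain ⟨N, G, hG, hG'⟩ := Away.mk_surjective (MvPolynomial.homogeneousSubmodule σ R) hh
    (ρ (Away.mk (MvPolynomial.homogeneousSubmodule τ R) hX 1 _ hXi))
  rw [← hG', evalAway_mk _ _ hξ hh N G hG, MvPolynomial.aeval_X, MvPolynomial.aeval_X, pow_one,
    div_eq_div_iff (pow_ne_zero _ hξ) hFj, ← map_pow, ← map_mul, ← map_mul, aeval_genericVec,
    aeval_genericVec] at h5
  have h6 := FaithfulSMul.algebraMap_injective _ _ h5
  exact ⟨N, G, by rw [← h6, mul_comm]⟩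

/-- If `F_j` vanished at the point, so would one of its prime factors `q`. As `q` divides every `F_i
h ^ N` but not `h`, which is nonzero at the point, it would be a common factor of the forms. -/
theorem notMem_of_X_notMem [IsDomain R] [UniqueFactorizationMonoid R] [Nonempty σ]
    {F : τ → MvPolynomial σ R} (hcop : ∀ u : MvPolynomial σ R, (∀ j, u ∣ F j) → IsUnit u)
    {g : (ProjSpace σ R).PartialMap (ProjSpace τ R)}
    (hg : SendsTo g.toRationalMap (genericVec σ R)
      fun i => MvPolynomial.aeval (genericVec σ R) (F i))
    {p : g.domain} {j : τ} (hj : MvPolynomial.X j ∉ (g.hom p).asHomogeneousIdeal) :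
    F j ∉ p.1.asHomogeneousIdeal := by
  intro hmem
  obtain ⟨hFj, h, hph, hdvd⟩ := exists_dvd_mul_pow hg hj
  obtain ⟨s, hs, u, hu⟩ := UniqueFactorizationMonoid.exists_prime_factors (F j) hFj
  have hp := p.1.isPrime
  have hprod : s.prod ∈ p.1.asHomogeneousIdeal.toIdeal := by
    have : s.prod * u ∈ p.1.asHomogeneousIdeal.toIdeal := by rw [hu]; exact hmem
    exact (hp.mem_or_mem this).resolve_right fun h1 => hp.ne_top (Ideal.eq_top_of_isUnit_mem _ h1 u.isUnit)
  obtain ⟨q, hqs, hqp⟩ := (hp.multiset_prod_mem_iff_exists_mem s).mp hprod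
  have hq := hs q hqs
  refine hq.not_isUnit (hcop q fun i => ?_)
  obtain ⟨N, hN⟩ := hdvd i
  have hqF : q ∣ F j := (Multiset.dvd_prod hqs).trans ⟨u, hu.symm⟩
  refine (hq.dvd_or_dvd (hqF.trans hN)).resolve_right fun h1 => hph ?_
  obtain ⟨c, hc⟩ := hq.dvd_of_dvd_pow h1
  rw [hc]
  exact Ideal.mul_mem_right _ _ hqp

end Indeterminacy

end

/-! ### Rational maps given by forms: existence, domain, values and image -/

noncomputable section

open HomogeneousLocalization Proj

section GivenBy

variable {σ τ R : Type} [CommRing R]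

/-- The rational map `Φ` is `[x] ↦ [F_j(x)]_j`. -/
def IsGivenBy (Φ : (ProjSpace σ R).RationalMap (ProjSpace τ R)) (F : τ → MvPolynomial σ R) : Prop :=
  ∀ (K : Type) [Field K] [Algebra R K] (x : σ → K),
    (fun j => MvPolynomial.aeval x (F j)) ≠ 0 → SendsTo Φ x (fun j => MvPolynomial.aeval x (F j))

theorem generic_value_ne_zero [IsDomain R] {F : τ → MvPolynomial σ R} (hF0 : F ≠ 0) :
    (fun j => MvPolynomial.aeval (genericVec σ R) (F j)) ≠ 0 := by
  obtain ⟨j, hj⟩ := Function.ne_iff.mp hF0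
  refine Function.ne_iff.mpr ⟨j, ?_⟩
  simp only [aeval_genericVec]
  simpa using hj

theorem IsGivenBy.hasAlgebraicDegree {n : ℕ} {F : τ → MvPolynomial σ R}
    {Φ : (ProjSpace σ R).RationalMap (ProjSpace τ R)} (h : IsGivenBy Φ F)
    (hF : ∀ j, (F j).IsHomogeneous n)
    (hcop : ∀ u : MvPolynomial σ R, (∀ j, u ∣ F j) → IsUnit u) : HasAlgebraicDegree Φ n :=
  ⟨F, hF, hcop, h⟩

variable [IsDomain R] [Nonempty σ] {n : ℕ} {F : τ → MvPolynomial σ R}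

/-- The charts of any two nonzero forms give the same rational map, since they agree at the generic
point. So at each point one may use a form that is nonzero there. -/
theorem chartMap_isGivenBy (hF : ∀ j, F j ∈ MvPolynomial.homogeneousSubmodule σ R n)
    (hn : 0 < n) (j : τ) (hj : F j ≠ 0) : IsGivenBy (chartMap hF hn j hj).toRationalMap F := by
  intro K _ _ x hx
  obtain ⟨i, hi⟩ := Function.ne_iff.mp hx
  have hi0 : F i ≠ 0 := fun h => hi (by simp [h])
  have hgen (l : τ) (hl : F l ≠ 0) :=
    chartMap_sendsTo hF hn l hl (genericVec σ R) (by
      rw [aeval_genericVec, Ne, FaithfulSMul.algebraMap_eq_zero_iff]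
      exact hl)
  rw [eq_of_sendsTo_generic (hgen j hj) (hgen i hi0)]
  exact chartMap_sendsTo hF hn i hi0 x hi

theorem exists_isGivenBy (hF : ∀ j, F j ∈ MvPolynomial.homogeneousSubmodule σ R n)
    (hn : 0 < n) (hF0 : F ≠ 0) :
    ∃ Φ : (ProjSpace σ R).RationalMap (ProjSpace τ R), IsGivenBy Φ F := by
  obtain ⟨j, hj⟩ := Function.ne_iff.mp hF0
  exact ⟨_, chartMap_isGivenBy hF hn j hj⟩

namespace IsGivenBy

variable {Φ : (ProjSpace σ R).RationalMap (ProjSpace τ R)}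

theorem toRationalMap_chartMap (h : IsGivenBy Φ F)
    (hF : ∀ j, F j ∈ MvPolynomial.homogeneousSubmodule σ R n)
    (hn : 0 < n) (j : τ) (hj : F j ≠ 0) : (chartMap hF hn j hj).toRationalMap = Φ := by
  have h0 := generic_value_ne_zero (F := F) (Function.ne_iff.mpr ⟨j, hj⟩)
  exact eq_of_sendsTo_generic (chartMap_isGivenBy hF hn j hj _ _ h0) (h _ _ h0)

theorem mem_domain_iff [UniqueFactorizationMonoid R] (h : IsGivenBy Φ F)
    (hF : ∀ j, F j ∈ MvPolynomial.homogeneousSubmodule σ R n)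
    (hn : 0 < n) (hF0 : F ≠ 0) (hcop : ∀ u : MvPolynomial σ R, (∀ j, u ∣ F j) → IsUnit u)
    (p : ProjSpace σ R) : p ∈ Φ.domain ↔ ∃ j, F j ∉ p.asHomogeneousIdeal := by
  rw [Scheme.RationalMap.mem_domain]
  constructor
  · rintro ⟨g, hp, rfl⟩
    obtain ⟨j, hj⟩ := exists_notMem_X (g.hom ⟨p, hp⟩)
    exact ⟨j, notMem_of_X_notMem hcop (h _ _ (generic_value_ne_zero hF0)) hj⟩
  · rintro ⟨j, hj⟩
    have hj0 : F j ≠ 0 := fun h0 => hj (by rw [h0]; exact zero_mem _)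
    exact ⟨chartMap hF hn j hj0, hj, h.toRationalMap_chartMap hF hn j hj0⟩

theorem sendsTo_iff [UniqueFactorizationMonoid R] (h : IsGivenBy Φ F)
    (hF : ∀ j, F j ∈ MvPolynomial.homogeneousSubmodule σ R n)
    (hF0 : F ≠ 0) (hcop : ∀ u : MvPolynomial σ R, (∀ j, u ∣ F j) → IsUnit u)
    {K : Type} [Field K] [Algebra R K] (x : σ → K) (y : τ → K) :
    SendsTo Φ x y ↔ (fun j => MvPolynomial.aeval x (F j)) ≠ 0 ∧
      ∃ c : K, c ≠ 0 ∧ y = c • fun j => MvPolynomial.aeval x (F j) := by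
  constructor
  · intro hs
    have hne : (fun j => MvPolynomial.aeval x (F j)) ≠ 0 := by
      obtain ⟨hx, hy, g, rfl, p, hp, e⟩ := hs
      obtain ⟨j, hj⟩ := exists_notMem_X (g.hom (p default))
      have h1 := notMem_of_X_notMem hcop (h _ _ (generic_value_ne_zero hF0)) hj
      refine Function.ne_iff.mpr ⟨j, fun h0 => h1 ?_⟩
      have h2 : (p default).1 = projPt R x hx := by
        rw [projPt, ← hp]
        rfl
      rw [h2]
      exact (mem_projPt x hx (hF j)).mpr h0
    exact ⟨hne, (h K x hne).eq_smul hs⟩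
  · rintro ⟨hne, c, hc, rfl⟩
    exact (h K x hne).smul hc

/-- The closure of the image of a rational map is defined by the relations between the forms. -/
theorem closure_range_eq (h : IsGivenBy Φ F) (hF0 : F ≠ 0)
    (g : (ProjSpace σ R).PartialMap (ProjSpace τ R)) (hg : g.toRationalMap = Φ) :
    closure (Set.range g.hom) = {p : ProjSpace τ R | ∀ (f : MvPolynomial τ R) (k : ℕ),
      f.IsHomogeneous k → MvPolynomial.aeval F f = 0 → f ∈ p.asHomogeneousIdeal} := by
  subst hg
  have hs := h _ _ (generic_value_ne_zero hF0)
  have : Nonempty (ProjSpace σ R) := ⟨projPt R _ (genericVec_ne_zero (σ := σ) (R := R))⟩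
  have hd : projPoint R (genericVec σ R) genericVec_ne_zero default ∈ g.domain :=
    projPt_genericVec_mem g.dense_domain.nonempty
  obtain ⟨hy, e⟩ := (sendsTo_toRationalMap_iff g _ _ genericVec_ne_zero hd).mp hs
  have hdom : IsDominant (liftPt (projPoint R (genericVec σ R) genericVec_ne_zero) _ hd) :=
    isDominant_of_comp_ι _ (by rw [liftPt_ι]; infer_instance)
  -- The generic point is dense in the domain, so by continuity its image is dense in the image.
  have hcl : closure (Set.range g.hom) = closure {projPt R _ hy} := by
    refine subset_antisymm ?_ (closure_mono ?_)
    · refine closure_minimal ?_ isClosed_closure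
      rintro _ ⟨p, rfl⟩
      have h1 := hdom.denseRange p
      refine map_mem_closure g.hom.continuous h1 ?_
      rintro _ ⟨z, rfl⟩
      refine Set.mem_singleton_iff.mpr ?_
      rw [← projPoint_apply _ hy z, ← e]
      rfl
    · rintro _ rfl
      exact ⟨_, by rw [projPt, ← e]; rfl⟩
  rw [hcl]
  ext p
  rw [mem_closure_projPt]
  have key (f : MvPolynomial τ R) : MvPolynomial.aeval
      (fun j => MvPolynomial.aeval (genericVec σ R) (F j)) f = 0 ↔ MvPolynomial.aeval F f = 0 := by
    have : MvPolynomial.aeval (fun j => MvPolynomial.aeval (genericVec σ R) (F j)) f =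
        MvPolynomial.aeval (genericVec σ R) (MvPolynomial.aeval F f) := by
      rw [← MvPolynomial.comp_aeval_apply]
    rw [this, aeval_genericVec, FaithfulSMul.algebraMap_eq_zero_iff]
  simp only [key, Set.mem_ofPred_eq]

theorem isDominant (h : IsGivenBy Φ F)
    (hinj : ∀ f : MvPolynomial τ R, MvPolynomial.aeval F f = 0 → f = 0) (hF0 : F ≠ 0) :
    Φ.IsDominant := by
  obtain ⟨g, rfl⟩ := Φ.exists_rep
  rw [Scheme.PartialMap.isDominant_toRationalMap_iff]
  constructor
  rw [DenseRange, dense_iff_closure_eq, h.closure_range_eq hF0 g rfl]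
  refine Set.eq_univ_of_forall fun p f _ _ hf => ?_
  rw [hinj f hf]
  exact zero_mem _

end IsGivenBy

end GivenBy

end

/-! ### Residue parts modulo `m`, and the norm from `R[w]` to `R[w ^ m]` -/

noncomputable section

namespace Polynomial

section ResiduePart

variable {R : Type} [CommRing R] (m k : ℕ)

/-- The polynomial with coefficients `f_k, f_(m + k), f_(2m + k), …`. -/
def residuePart (f : R[X]) : R[X] := contract m (divX^[k] f)

variable [NeZero m]

@[simp] theorem coeff_residuePart (f : R[X]) (n : ℕ) :
    (residuePart m k f).coeff n = f.coeff (n * m + k) := by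
  rw [residuePart, coeff_contract (NeZero.ne m)]
  generalize n * m = l
  induction k generalizing l f with
  | zero => rfl
  | succ k ih => rw [Function.iterate_succ_apply, ih, coeff_divX, add_assoc]

theorem residuePart_add (f g : R[X]) :
    residuePart m k (f + g) = residuePart m k f + residuePart m k g := by
  ext; simp

theorem residuePart_C_mul (c : R) (f : R[X]) :
    residuePart m k (C c * f) = C c * residuePart m k f := by
  ext; simp

theorem residuePart_zero : residuePart m k (0 : R[X]) = 0 := by
  ext; simp

theorem residuePart_sum {ι : Type} (s : Finset ι) (f : ι → R[X]) :
    residuePart m k (∑ i ∈ s, f i) = ∑ i ∈ s, residuePart m k (f i) := by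
  classical
  induction s using Finset.induction_on with
  | empty => simp [residuePart_zero]
  | insert a s ha ih => rw [Finset.sum_insert ha, Finset.sum_insert ha, residuePart_add, ih]

theorem map_residuePart {S : Type} [CommRing S] (φ : R →+* S) (f : R[X]) :
    (residuePart m k f).map φ = residuePart m k (f.map φ) := by
  ext; simp

variable {k}

/-- Taking a residue part is linear over the polynomials in `w ^ m`; all later computations with
residue parts reduce to this and to powers of `w`. -/
theorem residuePart_expand_mul (hk : k < m) (p f : R[X]) :
    residuePart m k (expand R m p * f) = p * residuePart m k f := by
  induction p using Polynomial.induction_on' with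
  | add p q hp hq => rw [map_add, add_mul, residuePart_add, hp, hq, add_mul]
  | monomial j a =>
    ext n
    rw [expand_monomial, ← C_mul_X_pow_eq_monomial, ← C_mul_X_pow_eq_monomial, mul_assoc,
      mul_assoc, coeff_residuePart, coeff_C_mul, coeff_C_mul, coeff_X_pow_mul', coeff_X_pow_mul']
    by_cases h : j ≤ n
    · have h1 : m * j ≤ n * m := by rw [mul_comm]; exact Nat.mul_le_mul_right m h
      rw [mul_comm j m, if_pos h, if_pos (h1.trans (Nat.le_add_right _ _)), coeff_residuePart]
      congr 2
      obtain ⟨l, rfl⟩ := Nat.exists_eq_add_of_le h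
      rw [Nat.add_sub_cancel_left, add_mul, mul_comm m j]
      omega
    · have h1 : ¬ j * m ≤ n * m + k := by
        have : (n + 1) * m ≤ j * m := Nat.mul_le_mul_right m (by omega)
        rw [add_mul] at this
        omega
      rw [if_neg h, if_neg h1]

theorem residuePart_X_pow (hk : k < m) {i : ℕ} (hi : i < m) :
    residuePart m k (X ^ i : R[X]) = if i = k then 1 else 0 := by
  ext n
  rw [coeff_residuePart, coeff_X_pow]
  have : n * m + k = i ↔ i = k ∧ n = 0 := by
    constructor
    · intro h
      rcases n with _ | n
      · omega
      · rw [add_mul] at h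
        omega
    · rintro ⟨rfl, rfl⟩
      omega
  by_cases h : i = k
  · rw [if_pos h, coeff_one]
    exact if_congr (this.trans (and_iff_right h)) rfl rfl
  · rw [if_neg h, coeff_zero, if_neg fun h' => h (this.mp h').1]

/-- The polynomial with the given residue parts. -/
def ofResidueParts (v : Fin m → R[X]) : R[X] := ∑ i : Fin m, expand R m (v i) * X ^ (i : ℕ)

theorem residuePart_ofResidueParts (v : Fin m → R[X]) (i : Fin m) :
    residuePart m i (ofResidueParts m v) = v i := by
  rw [ofResidueParts, residuePart_sum, Finset.sum_eq_single i]
  · rw [residuePart_expand_mul m i.2, residuePart_X_pow m i.2 i.2, if_pos rfl, mul_one]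
  · intro j _ hj
    rw [residuePart_expand_mul m i.2, residuePart_X_pow m i.2 j.2,
      if_neg fun h => hj (Fin.ext h), mul_zero]
  · intro h
    exact absurd (Finset.mem_univ i) h

theorem eq_of_residuePart_eq {f g : R[X]}
    (h : ∀ i : Fin m, residuePart m i f = residuePart m i g) : f = g := by
  ext n
  have h1 := congrArg (fun p : R[X] => p.coeff (n / m))
    (h ⟨n % m, Nat.mod_lt _ (Nat.pos_of_ne_zero (NeZero.ne m))⟩)
  simp only [coeff_residuePart] at h1
  rwa [mul_comm, Nat.div_add_mod] at h1

theorem ofResidueParts_residuePart (f : R[X]) :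
    ofResidueParts m (fun i => residuePart m i f) = f :=
  eq_of_residuePart_eq m fun i => residuePart_ofResidueParts m _ i

end ResiduePart

section NormExpand

variable {R : Type} [CommRing R] (m : ℕ) [NeZero m]

/-- The matrix of the multiplication by `f` on `R[w]` as a free module over `R[w ^ m]`. -/
def residueMatrix (f : R[X]) : Matrix (Fin m) (Fin m) R[X] :=
  Matrix.of fun i j => residuePart m i (X ^ (j : ℕ) * f)

theorem residueMatrix_mulVec (f : R[X]) (v : Fin m → R[X]) (i : Fin m) :
    (residueMatrix m f).mulVec v i = residuePart m i (ofResidueParts m v * f) := by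
  rw [ofResidueParts, Finset.sum_mul, residuePart_sum]
  change ∑ j, residueMatrix m f i j * v j = _
  refine Finset.sum_congr rfl fun j _ => ?_
  rw [mul_assoc, residuePart_expand_mul m i.2, mul_comm]
  rfl

/-- Column `j` holds the coordinates of `w ^ j g`; apply multiplication by `f` to this vector. -/
theorem residueMatrix_mul (f g : R[X]) :
    residueMatrix m (f * g) = residueMatrix m f * residueMatrix m g := by
  ext1 i j
  have h := residueMatrix_mulVec m f (fun l => residuePart m l (X ^ (j : ℕ) * g)) i
  rw [ofResidueParts_residuePart, mul_assoc, mul_comm g f] at h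
  exact h.symm

theorem residueMatrix_C (c : R) : residueMatrix m (C c) = (C c : R[X]) • 1 := by
  ext1 i j
  rw [residueMatrix, Matrix.of_apply, mul_comm, residuePart_C_mul, residuePart_X_pow m i.2 j.2,
    Matrix.smul_apply, Matrix.one_apply, smul_eq_mul]
  congr 1
  exact if_congr ⟨fun h => Fin.ext h.symm, fun h => by rw [h]⟩ rfl rfl

theorem map_residueMatrix {S : Type} [CommRing S] (φ : R →+* S) (f : R[X]) :
    (mapRingHom φ).mapMatrix (residueMatrix m f) = residueMatrix m (f.map φ) := by
  ext1 i j
  simp [residueMatrix, map_residuePart]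

/-- The norm of `f` from `R[w]` to `R[w ^ m]`, as a polynomial in `w ^ m`. If `R` contains a
primitive `m`-th root of unity `ζ`, then its value at `w ^ m` is `∏ f(ζ ^ t * w)`. -/
def normExpand (f : R[X]) : R[X] := (residueMatrix m f).det

/-- The cofactor of `f` in its norm from `R[w]` to `R[w ^ m]`. -/
def normCofactor (f : R[X]) : R[X] :=
  ofResidueParts m fun i => (residueMatrix m f).adjugate i 0

/-- Column `0` of the adjugate is the coordinate vector of the cofactor. The matrix of `f` sends it
to the determinant times the basis vector `1`. -/
theorem normCofactor_mul (f : R[X]) :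
    normCofactor m f * f = expand R m (normExpand m f) := by
  refine eq_of_residuePart_eq m fun i => ?_
  rw [normCofactor, ← residueMatrix_mulVec]
  have h : (residueMatrix m f).mulVec (fun i => (residueMatrix m f).adjugate i 0) i =
      (residueMatrix m f * (residueMatrix m f).adjugate) i 0 := rfl
  rw [h, Matrix.mul_adjugate, ← mul_one (expand R m _), residuePart_expand_mul m i.2,
    ← pow_zero X, residuePart_X_pow m i.2 (NeZero.pos m), Matrix.smul_apply, Matrix.one_apply,
    smul_eq_mul, normExpand]
  congr 1
  exact if_congr ⟨fun h => by rw [h]; rfl, fun h => Fin.ext h.symm⟩ rfl rfl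

theorem normExpand_mul (f g : R[X]) :
    normExpand m (f * g) = normExpand m f * normExpand m g := by
  rw [normExpand, residueMatrix_mul, Matrix.det_mul]
  rfl

theorem normExpand_C (c : R) : normExpand m (C c) = C (c ^ m) := by
  rw [normExpand, residueMatrix_C, Matrix.det_smul, Matrix.det_one, mul_one, Fintype.card_fin,
    C_pow]

theorem normExpand_prod {ι : Type} (s : Finset ι) (f : ι → R[X]) :
    normExpand m (∏ i ∈ s, f i) = ∏ i ∈ s, normExpand m (f i) := by
  classical
  induction s using Finset.induction_on with
  | empty => simpa using normExpand_C m (1 : R)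
  | insert a s ha ih => rw [Finset.prod_insert ha, Finset.prod_insert ha, normExpand_mul, ih]

theorem map_normExpand {S : Type} [CommRing S] (φ : R →+* S) (f : R[X]) :
    (normExpand m f).map φ = normExpand m (f.map φ) := by
  rw [normExpand, normExpand, ← map_residueMatrix, ← RingHom.map_det]
  rfl

theorem map_normCofactor {S : Type} [CommRing S] (φ : R →+* S) (f : R[X]) :
    (normCofactor m f).map φ = normCofactor m (f.map φ) := by
  rw [normCofactor, normCofactor, ← map_residueMatrix, ← RingHom.map_adjugate, ofResidueParts,
    ofResidueParts, Polynomial.map_sum]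
  refine Finset.sum_congr rfl fun i _ => ?_
  rw [Polynomial.map_mul, map_expand, Polynomial.map_pow, map_X]
  rfl

/-- Multiplication by `w` has ones below the diagonal and `X` in the upper right corner; subtract
`β` on the diagonal. Expansion along row `0` leaves two triangular minors, `(-β) ^ (m - 1)` for the
entry `-β` and `1` for the entry `X`. -/
theorem normExpand_X_sub_C (β : R) :
    normExpand m (X - C β) = (-1) ^ (m - 1) * (X - C (β ^ m)) := by
  obtain ⟨n, rfl⟩ := Nat.exists_eq_succ_of_ne_zero (NeZero.ne m)
  have hM (i j : Fin (n + 1)) : residueMatrix (n + 1) (X - C β) i j =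
      (if (i : ℕ) = j + 1 then 1 else 0) + (if i = 0 then (if j = Fin.last n then X else 0) else 0) -
        if i = j then C β else 0 := by
    have h1 : (X : R[X]) ^ (j : ℕ) * (X - C β) = X ^ ((j : ℕ) + 1) + C (-β) * X ^ (j : ℕ) := by
      rw [C_neg]; ring
    rw [residueMatrix, Matrix.of_apply, h1, residuePart_add, residuePart_C_mul,
      residuePart_X_pow (n + 1) i.2 j.2]
    have h2 : residuePart (n + 1) i (X ^ ((j : ℕ) + 1) : R[X]) =
        (if (i : ℕ) = j + 1 then 1 else 0) +
          (if i = 0 then (if j = Fin.last n then X else 0) else 0) := by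
      by_cases hj : j = Fin.last n
      · have h3 : (X : R[X]) ^ ((j : ℕ) + 1) = expand R (n + 1) X * X ^ 0 := by
          rw [hj, expand_X, Fin.val_last, pow_zero, mul_one]
        have h4 : ¬ (i : ℕ) = j + 1 := by
          rw [hj, Fin.val_last]
          exact i.2.ne
        rw [h3, residuePart_expand_mul _ i.2, residuePart_X_pow _ i.2 (Nat.succ_pos n), if_neg h4,
          zero_add, if_pos hj, mul_ite, mul_one, mul_zero]
        exact if_congr ⟨fun h => Fin.ext h.symm, fun h => by rw [h]; rfl⟩ rfl rfl
      · have h4 : (j : ℕ) + 1 < n + 1 := by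
          have := j.2
          have : (j : ℕ) ≠ n := fun h => hj (Fin.ext h)
          omega
        rw [residuePart_X_pow _ i.2 h4, if_neg hj, ite_self, add_zero]
        exact if_congr eq_comm rfl rfl
    rw [h2, C_neg, neg_mul, ← sub_eq_add_neg, mul_ite, mul_one, mul_zero]
    congr 1
    exact if_congr ⟨fun h => Fin.ext h.symm, fun h => by rw [h]⟩ rfl rfl
  have hlow : ((residueMatrix (n + 1) (X - C β)).submatrix Fin.succ Fin.succ).det =
      (-C β) ^ n := by
    rw [Matrix.det_of_isLowerTriangular]
    · simp [hM, Fin.succ_ne_zero]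
    · intro i j hij
      have hij' : i < j := hij
      have h1 : ¬ ((i : ℕ) = j + 1) := by have := Fin.lt_def.mp hij'; omega
      simp [hM, Fin.succ_ne_zero, h1, hij'.ne]
  have hup : ((residueMatrix (n + 1) (X - C β)).submatrix Fin.succ Fin.castSucc).det = 1 := by
    rw [Matrix.det_of_isUpperTriangular]
    · have h1 (i : Fin n) : i.succ ≠ i.castSucc := fun h => by
        have := congrArg Fin.val h
        simp at this
      simp [hM, Fin.succ_ne_zero, h1]
    · intro i j hij
      have hij' : (j : ℕ) < i := hij
      have h1 : ¬ (i.succ = j.castSucc) := fun h => by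
        have := congrArg Fin.val h
        simp at this
        omega
      simp [hM, Fin.succ_ne_zero, h1, hij'.ne']
  rw [normExpand, Matrix.det_succ_row_zero]
  have h0 (j : Fin (n + 1)) : residueMatrix (n + 1) (X - C β) 0 j =
      (if j = Fin.last n then X else 0) - if j = 0 then C β else 0 := by
    rw [hM, if_neg (by simp), zero_add, if_pos rfl]
    congr 1
    exact if_congr eq_comm rfl rfl
  simp only [h0, mul_sub, sub_mul, Finset.sum_sub_distrib, mul_ite, mul_zero, ite_mul, zero_mul,
    Finset.sum_ite_eq', Finset.mem_univ, if_true, Fin.succAbove_zero]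
  rw [hlow, Fin.succAbove_last, hup, Fin.val_last, Fin.val_zero, pow_zero, one_mul, mul_one,
    neg_pow (C β), C_pow, Nat.succ_sub_one, show C β ^ n.succ = C β ^ n * C β from pow_succ _ _]
  ring

end NormExpand

end Polynomial

end

/-! ### The norm over a field: roots, degree and extreme coefficients -/

noncomputable section

namespace Polynomial

theorem monic_prod_X_sub_C_pow {K : Type} [Field K] (m : ℕ) (s : Multiset K) :
    (s.map fun r => X - C (r ^ m)).prod.Monic :=
  monic_multiset_prod_of_monic _ _ fun _ _ => monic_X_sub_C _

section Field

variable {K : Type} [Field K] (m : ℕ) [NeZero m]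

/-- The norm is multiplicative, so constants and linear factors suffice. -/
theorem normExpand_of_splits {f : K[X]} (hf : f.Splits) :
    normExpand m f = C (((-1) ^ (m - 1)) ^ f.natDegree * f.leadingCoeff ^ m) *
      (f.roots.map fun r => X - C (r ^ m)).prod := by
  have h (s : Multiset K) : normExpand m (s.map fun r => X - C r).prod =
      C (((-1) ^ (m - 1)) ^ s.card) * (s.map fun r => X - C (r ^ m)).prod := by
    induction s using Multiset.induction_on with
    | empty => simpa using normExpand_C m (1 : K)
    | cons a s ih =>
      rw [Multiset.map_cons, Multiset.prod_cons, normExpand_mul, ih, normExpand_X_sub_C,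
        Multiset.map_cons, Multiset.prod_cons, Multiset.card_cons, pow_succ, C_mul]
      simp only [C_pow, C_neg, C_1]
      ring
  conv_lhs => rw [hf.eq_prod_roots]
  rw [normExpand_mul, normExpand_C, h, hf.natDegree_eq_card_roots, C_mul, ← mul_assoc,
    mul_comm (C (f.leadingCoeff ^ m))]

theorem natDegree_normExpand_of_splits {f : K[X]} (hf : f.Splits) (hf0 : f ≠ 0) :
    (normExpand m f).natDegree = f.natDegree := by
  have h : ((-1) ^ (m - 1)) ^ f.natDegree * f.leadingCoeff ^ m ≠ 0 :=
    mul_ne_zero (pow_ne_zero _ (pow_ne_zero _ (neg_ne_zero.mpr one_ne_zero)))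
      (pow_ne_zero _ (leadingCoeff_ne_zero.mpr hf0))
  rw [normExpand_of_splits m hf, natDegree_C_mul h, natDegree_multiset_prod_of_monic]
  · simp only [Multiset.map_map, Function.comp_def, natDegree_X_sub_C]
    simp [hf.natDegree_eq_card_roots]
  · intro g hg
    obtain ⟨r, _, rfl⟩ := Multiset.mem_map.mp hg
    exact monic_X_sub_C _

theorem normExpand_ne_zero {f : K[X]} (hf0 : f ≠ 0) : normExpand m f ≠ 0 := by
  let φ := algebraMap K (AlgebraicClosure K)
  have hs : (f.map φ).Splits := IsAlgClosed.splits _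
  have h0 : f.map φ ≠ 0 := (Polynomial.map_ne_zero_iff φ.injective).mpr hf0
  intro h
  have h1 := normExpand_of_splits m hs
  rw [← map_normExpand, h, Polynomial.map_zero] at h1
  refine mul_ne_zero ?_ ?_ h1.symm
  · rw [Ne, C_eq_zero]
    exact mul_ne_zero (pow_ne_zero _ (pow_ne_zero _ (neg_ne_zero.mpr one_ne_zero)))
      (pow_ne_zero _ (leadingCoeff_ne_zero.mpr h0))
  · exact (monic_prod_X_sub_C_pow m _).ne_zero

theorem natDegree_normExpand (f : K[X]) : (normExpand m f).natDegree = f.natDegree := by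
  by_cases hf0 : f = 0
  · have h := normExpand_C m (0 : K)
    rw [C_0, zero_pow (NeZero.ne m), C_0] at h
    rw [hf0, h]
  let φ := algebraMap K (AlgebraicClosure K)
  rw [← natDegree_map_eq_of_injective φ.injective, map_normExpand,
    natDegree_normExpand_of_splits m (IsAlgClosed.splits _)
      ((Polynomial.map_ne_zero_iff φ.injective).mpr hf0),
    natDegree_map_eq_of_injective φ.injective]

theorem leadingCoeff_normExpand (f : K[X]) : (normExpand m f).leadingCoeff =
    ((-1) ^ (m - 1)) ^ f.natDegree * f.leadingCoeff ^ m := by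
  let φ := algebraMap K (AlgebraicClosure K)
  apply φ.injective
  rw [← leadingCoeff_map_of_injective φ.injective, map_normExpand,
    normExpand_of_splits m (IsAlgClosed.splits _), leadingCoeff_mul, leadingCoeff_C,
    (monic_prod_X_sub_C_pow m _).leadingCoeff, mul_one]
  simp [natDegree_map_eq_of_injective φ.injective, leadingCoeff_map_of_injective φ.injective]

theorem coeff_zero_normExpand (f : K[X]) : (normExpand m f).coeff 0 = f.coeff 0 ^ m := by
  let φ := algebraMap K (AlgebraicClosure K)
  apply φ.injective
  have hs : (f.map φ).Splits := IsAlgClosed.splits _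
  rw [map_pow, ← coeff_map, ← coeff_map, map_normExpand, normExpand_of_splits m hs]
  conv_rhs => rw [hs.eq_prod_roots]
  rw [hs.natDegree_eq_card_roots]
  generalize (f.map φ).roots = s
  simp only [mul_coeff_zero, coeff_C_zero]
  rw [mul_pow, mul_comm _ ((f.map φ).leadingCoeff ^ m), mul_assoc]
  congr 1
  induction s using Multiset.induction_on with
  | empty => simp
  | cons a s ih =>
    rw [Multiset.map_cons, Multiset.prod_cons, Multiset.map_cons, Multiset.prod_cons,
      Multiset.card_cons, mul_coeff_zero, mul_coeff_zero, mul_pow, ← ih, pow_succ]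
    -- Each root contributes `(-1) ^ (m - 1)` from the norm and `-1` from the constant term.
    -- Together these give the sign of `(-a) ^ m`, so no sign remains, unlike for the leading
    -- coefficient.
    have h : (-1 : AlgebraicClosure K) ^ (m - 1) * -1 = (-1) ^ m := by
      rw [← pow_succ, Nat.sub_add_cancel (NeZero.pos m)]
    simp only [coeff_sub, coeff_X_zero, coeff_C_zero, zero_sub]
    rw [neg_pow a m, ← h]
    ring

theorem normCofactor_ne_zero {f : K[X]} (hf0 : f ≠ 0) : normCofactor m f ≠ 0 := by
  intro h
  have h1 := normCofactor_mul m f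
  rw [h, zero_mul] at h1
  exact normExpand_ne_zero m hf0 ((expand_eq_zero (NeZero.pos m)).mp h1.symm)

theorem natDegree_normCofactor {f : K[X]} (hf0 : f ≠ 0) :
    (normCofactor m f).natDegree + f.natDegree = m * f.natDegree := by
  rw [← natDegree_mul (normCofactor_ne_zero m hf0) hf0, normCofactor_mul, natDegree_expand,
    natDegree_normExpand, mul_comm]

/-- The cofactor has degree at most `(m - 1) d`, so the product has degree at most `m d`, whereas
the coefficient in question is the one at exponent `n m + k`. At `n = d` that is out of range only
if `k > 0` or the degree of `f` drops. -/
theorem coeff_residuePart_eq_zero {f g : K[X]} {d n k : ℕ} (hg0 : g ≠ 0) (hf : f.natDegree ≤ d)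
    (hg : g.natDegree ≤ d) (h : d < n ∨ d ≤ n ∧ (0 < k ∨ f.natDegree < d)) :
    (residuePart m k (f * normCofactor m g)).coeff n = 0 := by
  rw [coeff_residuePart]
  refine coeff_eq_zero_of_natDegree_lt (natDegree_mul_le.trans_lt ?_)
  have h1 := natDegree_normCofactor m hg0
  obtain ⟨l, rfl⟩ : ∃ l, m = l + 1 := ⟨m - 1, (Nat.sub_add_cancel (NeZero.pos m)).symm⟩
  rw [Nat.succ_mul] at h1
  have h2 : (normCofactor (l + 1) g).natDegree ≤ l * d := by
    have := Nat.mul_le_mul_left l hg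
    omega
  rw [mul_comm n, Nat.succ_mul]
  rcases h with h | ⟨h, h'⟩
  · have := Nat.mul_le_mul_left l h.le
    omega
  · have := Nat.mul_le_mul_left l h
    omega

end Field

/-! ### Degrees of the norm and the cofactor in the coefficients -/

section Homogeneous

variable {σ R : Type} [CommRing R]

/-- The coefficients of `f` are forms of degree `n`. -/
def CoeffsHomogeneous (f : (MvPolynomial σ R)[X]) (n : ℕ) : Prop :=
  ∀ j, (f.coeff j).IsHomogeneous n

namespace CoeffsHomogeneous

theorem mul {f g : (MvPolynomial σ R)[X]} {a b : ℕ} (hf : CoeffsHomogeneous f a)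
    (hg : CoeffsHomogeneous g b) : CoeffsHomogeneous (f * g) (a + b) := by
  intro j
  rw [coeff_mul]
  exact MvPolynomial.IsHomogeneous.sum _ _ _ fun x _ => (hf _).mul (hg _)

theorem sum {ι : Type} (s : Finset ι) {f : ι → (MvPolynomial σ R)[X]} {a : ℕ}
    (h : ∀ i ∈ s, CoeffsHomogeneous (f i) a) : CoeffsHomogeneous (∑ i ∈ s, f i) a := by
  intro j
  rw [finsetSum_coeff]
  exact MvPolynomial.IsHomogeneous.sum _ _ _ fun x hx => h x hx j

theorem X_pow (i : ℕ) : CoeffsHomogeneous (X ^ i : (MvPolynomial σ R)[X]) 0 := by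
  intro j
  rw [coeff_X_pow]
  split_ifs
  · exact MvPolynomial.isHomogeneous_one _ _
  · exact MvPolynomial.isHomogeneous_zero _ _ _

theorem zero (a : ℕ) : CoeffsHomogeneous (0 : (MvPolynomial σ R)[X]) a := fun j => by
  rw [coeff_zero]
  exact MvPolynomial.isHomogeneous_zero _ _ _

theorem one : CoeffsHomogeneous (1 : (MvPolynomial σ R)[X]) 0 := by
  simpa using X_pow (σ := σ) (R := R) 0

theorem prod {ι : Type} (s : Finset ι) {f : ι → (MvPolynomial σ R)[X]} {a : ι → ℕ}
    (h : ∀ i ∈ s, CoeffsHomogeneous (f i) (a i)) :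
    CoeffsHomogeneous (∏ i ∈ s, f i) (∑ i ∈ s, a i) := by
  classical
  induction s using Finset.induction_on with
  | empty => simpa using one
  | insert b s hb ih =>
    rw [Finset.prod_insert hb, Finset.sum_insert hb]
    exact (h b (Finset.mem_insert_self _ _)).mul
      (ih fun i hi => h i (Finset.mem_insert_of_mem hi))

theorem det {ι : Type} [Fintype ι] [DecidableEq ι] {M : Matrix ι ι (MvPolynomial σ R)[X]}
    {a : ι → ℕ} (h : ∀ i j, CoeffsHomogeneous (M i j) (a i)) :
    CoeffsHomogeneous M.det (∑ i, a i) := by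
  rw [← Matrix.det_transpose, Matrix.det_apply]
  refine sum _ fun s _ => ?_
  have h1 : CoeffsHomogeneous (∏ i, M i (s i)) (∑ i, a i) := prod _ fun i _ => h _ _
  intro j
  rw [Units.smul_def, coeff_smul]
  exact (MvPolynomial.homogeneousSubmodule σ R _).toAddSubgroup.zsmul_mem (h1 j) _

variable (m : ℕ) [NeZero m]

theorem residuePart {f : (MvPolynomial σ R)[X]} {a : ℕ} (hf : CoeffsHomogeneous f a) (k : ℕ) :
    CoeffsHomogeneous (residuePart m k f) a := fun j => by
  rw [coeff_residuePart]
  exact hf _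

theorem residueMatrix {f : (MvPolynomial σ R)[X]} (hf : CoeffsHomogeneous f 1) (i j : Fin m) :
    CoeffsHomogeneous (residueMatrix m f i j) 1 := by
  have := (X_pow (σ := σ) (R := R) j).mul hf
  rw [zero_add] at this
  exact this.residuePart m i

theorem normExpand {f : (MvPolynomial σ R)[X]} (hf : CoeffsHomogeneous f 1) :
    CoeffsHomogeneous (normExpand m f) m := by
  have h := det (a := fun _ => 1) fun i j => hf.residueMatrix m i j
  rw [Finset.sum_const, Finset.card_univ, Fintype.card_fin, smul_eq_mul, mul_one] at h
  exact h

theorem normCofactor {f : (MvPolynomial σ R)[X]} (hf : CoeffsHomogeneous f 1) :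
    CoeffsHomogeneous (normCofactor m f) (m - 1) := by
  rw [Polynomial.normCofactor, ofResidueParts]
  refine sum _ fun i _ => ?_
  rw [← add_zero (m - 1)]
  refine mul ?_ (X_pow _)
  have h1 : CoeffsHomogeneous ((Polynomial.residueMatrix m f).adjugate i 0) (m - 1) := by
    rw [Matrix.adjugate_apply]
    -- An adjugate entry is the determinant with row `0` replaced by constants: one row of degree
    -- `0`, and `m - 1` rows of degree `1`.
    have h := det (M := (Polynomial.residueMatrix m f).updateRow 0 (Pi.single i 1))
      (a := Function.update (fun _ => 1) 0 0) fun i' j => ?_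
    · rw [Finset.sum_update_of_mem (Finset.mem_univ _)] at h
      simpa [Finset.card_sdiff] using h
    · by_cases hi : i' = 0
      · subst hi
        rw [Matrix.updateRow_self, Function.update_self, Pi.single_apply]
        split_ifs
        · exact one
        · exact zero _
      · rw [Matrix.updateRow_ne hi, Function.update_of_ne hi]
        exact hf.residueMatrix m i' j
  intro j
  rw [coeff_expand (NeZero.pos m)]
  split_ifs
  · exact h1 _
  · exact MvPolynomial.isHomogeneous_zero _ _ _

end CoeffsHomogeneous

end Homogeneous

end Polynomial

end

/-! ### The forms of the Landen map, with their special coordinates -/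

noncomputable section

open Polynomial

section VecPoly

variable {R : Type} [CommRing R] {d : ℕ}

/-- The polynomial `a_0 z^d + ⋯ + a_d` over a commutative ring. -/
def vecPoly (a : Fin (d + 1) → R) : R[X] := ∑ i : Fin (d + 1), C (a i) * X ^ (d - (i : ℕ))

theorem coeff_vecPoly (a : Fin (d + 1) → R) (i : Fin (d + 1)) :
    (vecPoly a).coeff (d - (i : ℕ)) = a i := by
  rw [vecPoly, finsetSum_coeff, Finset.sum_eq_single i]
  · rw [coeff_C_mul, coeff_X_pow, if_pos rfl, mul_one]
  · intro j _ hj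
    rw [coeff_C_mul, coeff_X_pow, if_neg, mul_zero]
    intro h
    have := j.2
    have := i.2
    exact hj (Fin.ext (by omega))
  · intro h
    exact absurd (Finset.mem_univ i) h

theorem natDegree_vecPoly_le (a : Fin (d + 1) → R) : (vecPoly a).natDegree ≤ d :=
  natDegree_sum_le_of_forall_le _ _ fun _ _ =>
    (natDegree_C_mul_X_pow_le _ _).trans (Nat.sub_le _ _)

theorem natDegree_vecPoly_lt {a : Fin (d + 1) → R} (hd : 0 < d) (ha : a 0 = 0) :
    (vecPoly a).natDegree < d := by
  refine lt_of_le_of_ne (natDegree_vecPoly_le a) fun h => ?_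
  have h1 := coeff_vecPoly a 0
  rw [Fin.val_zero, Nat.sub_zero, ha] at h1
  have h2 : (vecPoly a).leadingCoeff = 0 := by rw [leadingCoeff, h, h1]
  rw [leadingCoeff_eq_zero.mp h2, natDegree_zero] at h
  omega

theorem vecPoly_coeff {f : R[X]} (hf : f.natDegree ≤ d) :
    vecPoly (fun i : Fin (d + 1) => f.coeff (d - (i : ℕ))) = f := by
  ext n
  by_cases hn : n ≤ d
  · have h := coeff_vecPoly (fun i : Fin (d + 1) => f.coeff (d - (i : ℕ)))
      ⟨d - n, Nat.lt_succ_of_le (Nat.sub_le _ _)⟩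
    simpa only [Nat.sub_sub_self hn] using h
  · rw [coeff_eq_zero_of_natDegree_lt (hf.trans_lt (not_le.mp hn)),
      coeff_eq_zero_of_natDegree_lt ((natDegree_vecPoly_le _).trans_lt (not_le.mp hn))]

theorem map_vecPoly {S : Type} [CommRing S] (φ : R →+* S) (a : Fin (d + 1) → R) :
    (vecPoly a).map φ = vecPoly fun i => φ (a i) := by
  simp [vecPoly, Polynomial.map_sum]

theorem vecPoly_injective {a b : Fin (d + 1) → R} (h : vecPoly a = vecPoly b) : a = b := by
  funext i
  rw [← coeff_vecPoly a, h, coeff_vecPoly]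

theorem vecPoly_ne_zero {a : Fin (d + 1) → R} (h : a ≠ 0) : vecPoly a ≠ 0 := fun h0 =>
  h (vecPoly_injective (h0.trans (by simp [vecPoly])))

end VecPoly

section LandenVec

variable {d : ℕ} (m k : ℕ) [NeZero m]

section Ring

variable {R : Type} [CommRing R]

/-- The numerator of the Landen transform. -/
def landenNum (x : Coord d → R) : R[X] :=
  residuePart m k (vecPoly (fun i => x (Sum.inl i)) *
    normCofactor m (vecPoly fun i => x (Sum.inr i)))

/-- The denominator of the Landen transform. -/
def landenDen (x : Coord d → R) : R[X] := normExpand m (vecPoly fun i => x (Sum.inr i))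

/-- The homogeneous coordinates of the Landen transform. -/
def landenVec (x : Coord d → R) : Coord d → R :=
  Sum.elim (fun i => (landenNum m k x).coeff (d - (i : ℕ)))
    fun i => (landenDen m x).coeff (d - (i : ℕ))

theorem map_landenVec {S : Type} [CommRing S] (φ : R →+* S) (x : Coord d → R) (j : Coord d) :
    φ (landenVec m k x j) = landenVec m k (fun i => φ (x i)) j := by
  rcases j with i | i
  · simp only [landenVec, Sum.elim_inl, landenNum]
    rw [← coeff_map, map_residuePart, Polynomial.map_mul, map_normCofactor, map_vecPoly,
      map_vecPoly]
  · simp only [landenVec, Sum.elim_inr, landenDen]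
    rw [← coeff_map, map_normExpand, map_vecPoly]

end Ring

section Field

variable {K : Type} [Field K]

theorem landenDen_ne_zero {x : Coord d → K} (hx : (fun i => x (Sum.inr i)) ≠ 0) :
    landenDen m x ≠ 0 :=
  normExpand_ne_zero m (vecPoly_ne_zero hx)

theorem natDegree_landenDen_le (x : Coord d → K) : (landenDen m x).natDegree ≤ d := by
  rw [landenDen, natDegree_normExpand]
  exact natDegree_vecPoly_le _

theorem vecPoly_landenVec_inr (x : Coord d → K) :
    vecPoly (fun i => landenVec m k x (Sum.inr i)) = landenDen m x :=
  vecPoly_coeff (natDegree_landenDen_le m x)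

theorem natDegree_landenNum_le {x : Coord d → K} (hx : (fun i => x (Sum.inr i)) ≠ 0) :
    (landenNum m k x).natDegree ≤ d :=
  natDegree_le_iff_coeff_eq_zero.mpr fun _ hn =>
    coeff_residuePart_eq_zero m (vecPoly_ne_zero hx) (natDegree_vecPoly_le _)
      (natDegree_vecPoly_le _) (Or.inl hn)

theorem vecPoly_landenVec_inl {x : Coord d → K} (hx : (fun i => x (Sum.inr i)) ≠ 0) :
    vecPoly (fun i => landenVec m k x (Sum.inl i)) = landenNum m k x :=
  vecPoly_coeff (natDegree_landenNum_le m k hx)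

end Field

section Universal

theorem landenVec_inr_ne_zero {K : Type} [Field K] {x : Coord d → K}
    (hx : (fun i => x (Sum.inr i)) ≠ 0) : (fun i => landenVec m k x (Sum.inr i)) ≠ 0 := by
  intro h
  have h1 := vecPoly_landenVec_inr m k x
  rw [h] at h1
  refine landenDen_ne_zero m hx (h1.symm.trans ?_)
  simp [vecPoly]

/-- An identity for the coordinates of the Landen transform holds over every ring if it holds for
generic coordinates. -/
theorem landenVec_eq_of_injective {S K R : Type} [CommRing S] [CommRing K] [CommRing R]
    (ι : S →+* K) (hι : Function.Injective ι) (φ : S →+* R) (y : Coord d → S) (j : Coord d)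
    (f : S) (h : landenVec m k (fun i => ι (y i)) j = ι f) :
    landenVec m k (fun i => φ (y i)) j = φ f := by
  have h1 : landenVec m k y j = f := hι ((map_landenVec m k ι y j).trans h)
  rw [← h1, map_landenVec]

theorem landenVec_eq_of_generic {σ : Type} (y : Coord d → MvPolynomial σ ℤ) (j : Coord d)
    (f : MvPolynomial σ ℤ)
    (h : landenVec m k (fun i => algebraMap (MvPolynomial σ ℤ)
      (FractionRing (MvPolynomial σ ℤ)) (y i)) j =
      algebraMap (MvPolynomial σ ℤ) (FractionRing (MvPolynomial σ ℤ)) f)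
    {R : Type} [CommRing R] (x : σ → R) :
    landenVec m k (fun i => MvPolynomial.aeval x (y i)) j = MvPolynomial.aeval x f :=
  landenVec_eq_of_injective m k (algebraMap (MvPolynomial σ ℤ) (FractionRing (MvPolynomial σ ℤ)))
    (IsFractionRing.injective _ _) (MvPolynomial.aeval x).toRingHom y j f h

variable {R : Type} [CommRing R]

theorem landenVec_inr_zero (x : Coord d → R) :
    landenVec m k x (Sum.inr 0) = ((-1) ^ (m - 1)) ^ d * x (Sum.inr 0) ^ m := by
  have h := landenVec_eq_of_generic m k (d := d) (fun i => MvPolynomial.X i) (Sum.inr 0)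
    (((-1) ^ (m - 1)) ^ d * MvPolynomial.X (Sum.inr 0) ^ m) ?_ x
  · simpa using h
  · set y : Coord d → FractionRing (MvPolynomial (Coord d) ℤ) :=
      fun i => algebraMap (MvPolynomial (Coord d) ℤ) _ (MvPolynomial.X i)
    -- For generic coordinates the denominator has degree exactly `d`, so the coefficient of `z ^ d`
    -- is the leading coefficient.
    have hy : y (Sum.inr 0) ≠ 0 := by
      simp [y]
    have h1 := coeff_vecPoly (fun i => y (Sum.inr i)) 0
    rw [Fin.val_zero, Nat.sub_zero] at h1
    have h2 : (vecPoly fun i => y (Sum.inr i)).natDegree = d :=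
      le_antisymm (natDegree_vecPoly_le _) (le_natDegree_of_ne_zero (by rw [h1]; exact hy))
    have h3 := leadingCoeff_normExpand m (vecPoly fun i => y (Sum.inr i))
    rw [leadingCoeff, natDegree_normExpand, leadingCoeff, h2, h1] at h3
    simp only [landenVec, Sum.elim_inr, landenDen, Fin.val_zero, Nat.sub_zero]
    rw [h3]
    simp [y]

theorem landenVec_inr_last (x : Coord d → R) :
    landenVec m k x (Sum.inr (Fin.last d)) = x (Sum.inr (Fin.last d)) ^ m := by
  have h := landenVec_eq_of_generic m k (d := d) (fun i => MvPolynomial.X i) (Sum.inr (Fin.last d))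
    (MvPolynomial.X (Sum.inr (Fin.last d)) ^ m) ?_ x
  · simpa using h
  · set y : Coord d → FractionRing (MvPolynomial (Coord d) ℤ) :=
      fun i => algebraMap (MvPolynomial (Coord d) ℤ) _ (MvPolynomial.X i)
    have h1 := coeff_vecPoly (fun i => y (Sum.inr i)) (Fin.last d)
    rw [Fin.val_last, Nat.sub_self] at h1
    have h3 := coeff_zero_normExpand m (vecPoly fun i => y (Sum.inr i))
    simp only [landenVec, Sum.elim_inr, landenDen, Fin.val_last, Nat.sub_self]
    rw [h3, h1]
    simp [y]

theorem landenVec_inl_zero (hk : 0 < k) (x : Coord d → R) :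
    landenVec m k x (Sum.inl 0) = 0 := by
  have h := landenVec_eq_of_generic m k (d := d) (fun i => MvPolynomial.X i) (Sum.inl 0) 0 ?_ x
  · simpa using h
  · rw [map_zero]
    refine coeff_residuePart_eq_zero m (vecPoly_ne_zero ?_) (natDegree_vecPoly_le _)
      (natDegree_vecPoly_le _) (Or.inr ⟨le_rfl, Or.inl hk⟩)
    exact Function.ne_iff.mpr ⟨0, by simp⟩

/-- The hyperplane is preserved even for `k = 0`: there the numerator has degree below `d`, so its
product with the cofactor has degree below `m d`. -/
theorem landenVec_hypIncl_inl_zero (hd : 0 < d) (x : HypCoord d → R) :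
    landenVec m k (hypIncl x) (Sum.inl 0) = 0 := by
  have hx : (hypIncl x) = fun i =>
      MvPolynomial.aeval x (hypIncl (K := MvPolynomial (HypCoord d) ℤ) MvPolynomial.X i) := by
    funext i
    rcases i with i | i
    · refine Fin.cases ?_ (fun i => ?_) i <;> simp [hypIncl]
    · simp [hypIncl]
  have h := landenVec_eq_of_generic m k (d := d) (hypIncl (K := MvPolynomial (HypCoord d) ℤ)
    MvPolynomial.X) (Sum.inl 0) 0 ?_ x
  · rw [hx, h, map_zero]
  · rw [map_zero]
    refine coeff_residuePart_eq_zero m (vecPoly_ne_zero ?_) (natDegree_vecPoly_le _)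
      (natDegree_vecPoly_le _) (Or.inr ⟨le_rfl, Or.inr (natDegree_vecPoly_lt hd ?_)⟩)
    · exact Function.ne_iff.mpr ⟨0, by simp [hypIncl]⟩
    · simp [hypIncl]

end Universal

section Forms

variable (d) (R : Type) [CommRing R]

/-- The forms defining the rational map induced by the Landen transform. -/
def landenForm : Coord d → MvPolynomial (Coord d) R := landenVec m k MvPolynomial.X

/-- The inclusion of the coordinates on the hyperplane `a_0 = 0` into all coordinates. -/
abbrev inclCoord : HypCoord d → Coord d := Sum.map Fin.succ id

/-- The forms defining the rational map induced by the Landen transform on the hyperplane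
`a_0 = 0`. -/
def hypForm : HypCoord d → MvPolynomial (HypCoord d) R :=
  fun j => landenVec m k (hypIncl MvPolynomial.X) (inclCoord d j)

variable {R d}

theorem map_hypIncl {S : Type} [CommRing S] (φ : R →+* S) (x : HypCoord d → R) :
    (fun i => φ (hypIncl x i)) = hypIncl fun i => φ (x i) := by
  funext i
  rcases i with i | i
  · refine Fin.cases ?_ (fun i => ?_) i <;> simp [hypIncl]
  · simp [hypIncl]

theorem aeval_landenForm {S : Type} [CommRing S] [Algebra R S] (x : Coord d → S) (j : Coord d) :
    MvPolynomial.aeval x (landenForm d m k R j) = landenVec m k x j := by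
  have h := map_landenVec m k (MvPolynomial.aeval x : MvPolynomial (Coord d) R →ₐ[R] S).toRingHom
    MvPolynomial.X j
  refine h.trans ?_
  congr 1
  funext i
  exact MvPolynomial.aeval_X x i

theorem aeval_hypForm {S : Type} [CommRing S] [Algebra R S] (x : HypCoord d → S)
    (j : HypCoord d) :
    MvPolynomial.aeval x (hypForm d m k R j) = landenVec m k (hypIncl x) (inclCoord d j) := by
  have h := map_landenVec m k
    (MvPolynomial.aeval x : MvPolynomial (HypCoord d) R →ₐ[R] S).toRingHom
    (hypIncl MvPolynomial.X) (inclCoord d j)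
  refine h.trans ?_
  rw [map_hypIncl]
  congr 2
  funext i
  exact MvPolynomial.aeval_X x i

theorem landenVec_isHomogeneous {σ : Type} {y : Coord d → MvPolynomial σ R}
    (hy : ∀ i, (y i).IsHomogeneous 1) (j : Coord d) : (landenVec m k y j).IsHomogeneous m := by
  have h (a : Fin (d + 1) → MvPolynomial σ R) (ha : ∀ i, (a i).IsHomogeneous 1) :
      CoeffsHomogeneous (vecPoly a) 1 := by
    refine CoeffsHomogeneous.sum _ fun i _ => ?_
    refine CoeffsHomogeneous.mul (a := 1) (b := 0) (fun l => ?_) (CoeffsHomogeneous.X_pow _)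
    rw [coeff_C]
    split_ifs
    · exact ha i
    · exact MvPolynomial.isHomogeneous_zero _ _ _
  have hB := h (fun i => y (Sum.inr i)) fun i => hy _
  have hA := h (fun i => y (Sum.inl i)) fun i => hy _
  rcases j with i | i
  · have h1 := ((hA.mul (hB.normCofactor m)).residuePart m k)
    rw [Nat.add_sub_of_le (NeZero.pos m)] at h1
    exact h1 _
  · exact hB.normExpand m _

theorem landenForm_isHomogeneous (j : Coord d) : (landenForm d m k R j).IsHomogeneous m :=
  landenVec_isHomogeneous m k (fun i => MvPolynomial.isHomogeneous_X R i) j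

theorem hypForm_isHomogeneous (j : HypCoord d) : (hypForm d m k R j).IsHomogeneous m := by
  refine landenVec_isHomogeneous m k (fun i => ?_) _
  rcases i with i | i
  · refine Fin.cases ?_ (fun i => ?_) i
    · exact MvPolynomial.isHomogeneous_zero _ _ _
    · exact MvPolynomial.isHomogeneous_X R _
  · exact MvPolynomial.isHomogeneous_X R _

theorem isUnit_of_dvd_X_pow [IsDomain R] {σ : Type} {i j : σ} (hij : i ≠ j)
    {u : MvPolynomial σ R} {a b : ℕ} (hi : u ∣ MvPolynomial.X i ^ a)
    (hj : u ∣ MvPolynomial.X j ^ b) : IsUnit u := by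
  obtain ⟨c, _, hc⟩ := (dvd_prime_pow (MvPolynomial.X_prime (i := i)) a).mp hi
  rcases Nat.eq_zero_or_pos c with rfl | hc0
  · rw [pow_zero] at hc
    exact hc.symm.isUnit isUnit_one
  · have h1 := ((dvd_pow_self (MvPolynomial.X i : MvPolynomial σ R) hc0.ne').trans
      hc.symm.dvd).trans hj
    exact absurd (MvPolynomial.X_dvd_X.mp (MvPolynomial.X_prime.dvd_of_dvd_pow h1)) hij

/-- Up to sign, two of the forms are `b_0 ^ m` and `b_d ^ m`, powers of distinct primes because `d >
0`. -/
theorem isUnit_of_dvd_landenForm [IsDomain R] (hd : 0 < d) {u : MvPolynomial (Coord d) R}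
    (hu : ∀ j, u ∣ landenForm d m k R j) : IsUnit u := by
  have h0 := hu (Sum.inr 0)
  have h1 := hu (Sum.inr (Fin.last d))
  rw [landenForm, landenVec_inr_zero, ((isUnit_one.neg.pow _).pow _).dvd_mul_left] at h0
  rw [landenForm, landenVec_inr_last] at h1
  refine isUnit_of_dvd_X_pow (fun h => ?_) h0 h1
  exact hd.ne (congrArg Fin.val (Sum.inr_injective h))

theorem isUnit_of_dvd_hypForm [IsDomain R] (hd : 0 < d) {u : MvPolynomial (HypCoord d) R}
    (hu : ∀ j, u ∣ hypForm d m k R j) : IsUnit u := by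
  have h0 := hu (Sum.inr 0)
  have h1 := hu (Sum.inr (Fin.last d))
  simp only [hypForm, Sum.map_inr, id, landenVec_inr_last] at h1
  simp only [hypForm, Sum.map_inr, id] at h0
  rw [landenVec_inr_zero, ((isUnit_one.neg.pow _).pow _).dvd_mul_left] at h0
  refine isUnit_of_dvd_X_pow (fun h => ?_) h0 h1
  exact hd.ne (congrArg Fin.val (Sum.inr_injective h))

theorem landenForm_ne_zero [IsDomain R] : landenForm d m k R ≠ 0 := by
  refine Function.ne_iff.mpr ⟨Sum.inr (Fin.last d), ?_⟩
  rw [landenForm, landenVec_inr_last]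
  exact pow_ne_zero _ (MvPolynomial.X_ne_zero _)

theorem hypForm_ne_zero [IsDomain R] : hypForm d m k R ≠ 0 := by
  refine Function.ne_iff.mpr ⟨Sum.inr (Fin.last d), ?_⟩
  simp only [hypForm, Sum.map_inr, id, landenVec_inr_last]
  exact pow_ne_zero _ (MvPolynomial.X_ne_zero _)

end Forms

end LandenVec

end

/-! ### The forms compute the Landen transform -/

noncomputable section

open Polynomial

section SubstRat

variable {K L : Type} [Field K] [Field L] [Algebra K L]

theorem eval₂_algebraMap_eq (t : L[X]) (p : K[X]) :
    p.eval₂ ((RatFunc.C : L →+* RatFunc L).comp (algebraMap K L)) (algebraMap L[X] (RatFunc L) t) =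
      algebraMap L[X] (RatFunc L) ((p.map (algebraMap K L)).comp t) := by
  rw [comp, eval₂_map, hom_eval₂]
  rfl

theorem comp_map_ne_zero {t : L[X]} (ht : t.natDegree ≠ 0) {p : K[X]} (hp : p ≠ 0) :
    (p.map (algebraMap K L)).comp t ≠ 0 := by
  rw [Ne, comp_eq_zero_iff, not_or]
  refine ⟨(Polynomial.map_ne_zero_iff (algebraMap K L).injective).mpr hp, fun h => ht ?_⟩
  rw [h.2, natDegree_C]

theorem substRat_div {t : L[X]} (ht : t.natDegree ≠ 0) (p : K[X]) {q : K[X]} (hq : q ≠ 0) :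
    substRat (algebraMap L[X] (RatFunc L) t)
        (algebraMap K[X] (RatFunc K) p / algebraMap K[X] (RatFunc K) q) =
      algebraMap L[X] (RatFunc L) ((p.map (algebraMap K L)).comp t) /
        algebraMap L[X] (RatFunc L) ((q.map (algebraMap K L)).comp t) := by
  set φ := algebraMap K[X] (RatFunc K) p / algebraMap K[X] (RatFunc K) q with hφ
  have h := (RatFunc.num_mul_eq_mul_denom_iff (x := φ) hq).mpr hφ
  rw [substRat, RatFunc.eval, eval₂_algebraMap_eq, eval₂_algebraMap_eq, div_eq_div_iff
    (RatFunc.algebraMap_ne_zero (comp_map_ne_zero ht φ.denom_ne_zero))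
    (RatFunc.algebraMap_ne_zero (comp_map_ne_zero ht hq)), ← map_mul, ← map_mul, ← mul_comp,
    ← mul_comp, ← Polynomial.map_mul, ← Polynomial.map_mul, h]

theorem substRat_injective {t : L[X]} (ht : t.natDegree ≠ 0) :
    Function.Injective (substRat (K := K) (algebraMap L[X] (RatFunc L) t)) := by
  intro φ ψ h
  rw [← RatFunc.num_div_denom φ, ← RatFunc.num_div_denom ψ] at h ⊢
  rw [substRat_div ht _ φ.denom_ne_zero, substRat_div ht _ ψ.denom_ne_zero, div_eq_div_iff
    (RatFunc.algebraMap_ne_zero (comp_map_ne_zero ht φ.denom_ne_zero))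
    (RatFunc.algebraMap_ne_zero (comp_map_ne_zero ht ψ.denom_ne_zero)), ← map_mul, ← map_mul,
    ← mul_comp, ← mul_comp, ← Polynomial.map_mul, ← Polynomial.map_mul] at h
  have h1 := RatFunc.algebraMap_injective L h
  rw [← sub_eq_zero, ← sub_comp, ← Polynomial.map_sub] at h1
  have h2 := sub_eq_zero.mp (not_not.mp fun h0 => comp_map_ne_zero ht h0 h1)
  rw [div_eq_div_iff (RatFunc.algebraMap_ne_zero φ.denom_ne_zero)
    (RatFunc.algebraMap_ne_zero ψ.denom_ne_zero), ← map_mul, ← map_mul, h2]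

end SubstRat

/-- Averaging over the roots of unity picks the exponents that are congruent to `k`. -/
theorem sum_comp_primitiveRoot {L : Type} [Field L] {m k : ℕ} [NeZero m] (hk : k < m) {ζ : L}
    (hζ : IsPrimitiveRoot ζ m) (Q : L[X]) :
    ∑ t ∈ Finset.range m, C (ζ⁻¹ ^ (k * t)) * Q.comp (C (ζ ^ t) * X) =
      (m : L[X]) * X ^ k * expand L m (residuePart m k Q) := by
  have hζ0 : ζ ≠ 0 := hζ.ne_zero (NeZero.ne m)
  ext n
  have h1 : (∑ t ∈ Finset.range m, C (ζ⁻¹ ^ (k * t)) * Q.comp (C (ζ ^ t) * X)).coeff n =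
      Q.coeff n * ∑ t ∈ Finset.range m, (ζ ^ ((n : ℤ) - k)) ^ t := by
    rw [finsetSum_coeff, Finset.mul_sum]
    refine Finset.sum_congr rfl fun t _ => ?_
    rw [coeff_C_mul, comp_C_mul_X_coeff, zpow_sub₀ hζ0, zpow_natCast, zpow_natCast, div_pow,
      pow_mul, inv_pow, inv_pow, ← pow_mul ζ t, mul_comm t n, pow_mul ζ n]
    ring
  rw [h1, mul_assoc, ← C_eq_natCast, coeff_C_mul, coeff_X_pow_mul', coeff_expand (NeZero.pos m)]
  by_cases h : ζ ^ ((n : ℤ) - k) = 1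
  · rw [h]
    obtain ⟨c, hc⟩ := (hζ.zpow_eq_one_iff_dvd _).mp h
    -- From `n - k = m c` and `c < 0` would follow `n ≤ k - m < 0`.
    have hc0 : 0 ≤ c := by
      by_contra hneg
      have : (m : ℤ) * c ≤ m * (-1) := by
        apply mul_le_mul_of_nonneg_left <;> omega
      omega
    lift c to ℕ using hc0
    have hn : n = c * m + k := by
      have : (n : ℤ) = c * m + k := by rw [mul_comm]; omega
      exact_mod_cast this
    rw [if_pos (by omega), hn, Nat.add_sub_cancel, if_pos (dvd_mul_left _ _),
      Nat.mul_div_cancel _ (NeZero.pos m), coeff_residuePart]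
    simp [mul_comm]
  -- The geometric sum of an `m`-th root of unity different from `1` is zero.
  · have h2 := geom_sum_mul (ζ ^ ((n : ℤ) - k)) m
    rw [← zpow_natCast, ← zpow_mul, mul_comm, mul_comm _ (m : ℤ), zpow_mul, zpow_natCast,
      hζ.pow_eq_one, one_zpow, sub_self] at h2
    rw [(mul_eq_zero.mp h2).resolve_left (sub_ne_zero.mpr h), mul_zero]
    split_ifs with h3 h4
    · refine absurd ((hζ.zpow_eq_one_iff_dvd _).mpr ?_) h
      rw [← Nat.cast_sub h3]
      exact Int.natCast_dvd_natCast.mpr h4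
    · rw [mul_zero]
    · rw [mul_zero]

section Landen

variable {d m k : ℕ} [NeZero m] {K : Type} [Field K]

theorem ratFun_eq (a b : Fin (d + 1) → K) :
    ratFun a b = algebraMap K[X] (RatFunc K) (vecPoly a) / algebraMap K[X] (RatFunc K) (vecPoly b) :=
  rfl

theorem isLandenTransform_landenVec (hm : (m : K) ≠ 0) (hk : k < m) (x : Coord d → K)
    (hx : (fun i => x (Sum.inr i)) ≠ 0) :
    IsLandenTransform m k (ratFun (fun i => x (Sum.inl i)) fun i => x (Sum.inr i))
      (ratFun (fun i => landenVec m k x (Sum.inl i)) fun i => landenVec m k x (Sum.inr i)) := by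
  intro L _ _ ζ hζ
  have hζ0 : ζ ≠ 0 := hζ.ne_zero (NeZero.ne m)
  have hmL : (m : L) ≠ 0 := by
    rw [← map_natCast (algebraMap K L)]
    exact (_root_.map_ne_zero _).mpr hm
  rw [ratFun_eq, ratFun_eq, vecPoly_landenVec_inl m k hx, vecPoly_landenVec_inr]
  set A := vecPoly fun i => x (Sum.inl i) with hA
  set B := vecPoly fun i => x (Sum.inr i) with hB
  have hB0 : B ≠ 0 := vecPoly_ne_zero hx
  have hXm : (X ^ m : L[X]).natDegree ≠ 0 := by rw [natDegree_X_pow]; exact NeZero.ne m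
  have e1 : (RatFunc.X : RatFunc L) ^ m = algebraMap L[X] (RatFunc L) (X ^ m) := by
    rw [map_pow, RatFunc.algebraMap_X]
  have hlin (t : ℕ) : (C (ζ ^ t) * X : L[X]).natDegree ≠ 0 := by
    rw [natDegree_C_mul_X _ (pow_ne_zero _ hζ0)]
    exact one_ne_zero
  have e2 (t : ℕ) : (RatFunc.C (ζ ^ t) * RatFunc.X : RatFunc L) =
      algebraMap L[X] (RatFunc L) (C (ζ ^ t) * X) := by
    rw [map_mul, RatFunc.algebraMap_X, RatFunc.algebraMap_C]
  set Q : L[X] := (A * normCofactor m B).map (algebraMap K L)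
  set D : L[X] := (landenDen m x).map (algebraMap K L) with hD
  have hD0 : expand L m D ≠ 0 :=
    comp_map_ne_zero hXm (landenDen_ne_zero m hx)
  have hED : (normCofactor m B).map (algebraMap K L) * B.map (algebraMap K L) = expand L m D := by
    rw [← Polynomial.map_mul, normCofactor_mul, map_expand]
    rfl
  -- Since `D(w ^ m)` is invariant under `w ↦ ζ ^ t w`, it is a common denominator of all the
  -- summands.
  have h3 (t : ℕ) : substRat (algebraMap L[X] (RatFunc L) (C (ζ ^ t) * X))
      (algebraMap K[X] (RatFunc K) A / algebraMap K[X] (RatFunc K) B) =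
      algebraMap L[X] (RatFunc L) (Q.comp (C (ζ ^ t) * X)) /
        algebraMap L[X] (RatFunc L) (expand L m D) := by
    have h4 : (expand L m D).comp (C (ζ ^ t) * X) = expand L m D := by
      rw [expand_eq_comp_X_pow, comp_assoc, X_pow_comp, mul_pow, ← C_pow, ← pow_mul, mul_comm t,
        pow_mul, hζ.pow_eq_one, one_pow, C_1, one_mul]
    rw [substRat_div (hlin t) _ hB0, div_eq_div_iff
      (RatFunc.algebraMap_ne_zero (comp_map_ne_zero (hlin t) hB0))
      (RatFunc.algebraMap_ne_zero hD0), ← map_mul, ← map_mul]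
    congr 1
    rw [← h4, ← hED, ← mul_comp, ← mul_comp, ← mul_assoc, ← Polynomial.map_mul]
  have h5 : landenNum m k x = residuePart m k (A * normCofactor m B) := rfl
  have h6 : ∑ t ∈ Finset.range m, RatFunc.C (ζ⁻¹ ^ (k * t)) *
      (algebraMap L[X] (RatFunc L) (Q.comp (C (ζ ^ t) * X)) /
        algebraMap L[X] (RatFunc L) (expand L m D)) =
      algebraMap L[X] (RatFunc L) ((m : L[X]) * X ^ k * expand L m (residuePart m k Q)) /
        algebraMap L[X] (RatFunc L) (expand L m D) := by
    rw [← sum_comp_primitiveRoot hk hζ, map_sum, Finset.sum_div]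
    refine Finset.sum_congr rfl fun t _ => ?_
    rw [map_mul, RatFunc.algebraMap_C, mul_div_assoc]
  rw [e1, substRat_div hXm _ (landenDen_ne_zero m hx), h5, map_residuePart]
  simp only [e2, h3]
  rw [h6, map_mul, map_mul, map_natCast, map_pow, RatFunc.algebraMap_X]
  have hm' : (m : RatFunc L) ≠ 0 := by
    rw [← map_natCast (RatFunc.C : L →+* RatFunc L)]
    exact (_root_.map_ne_zero _).mpr hmL
  have hX' : (RatFunc.X : RatFunc L) ≠ 0 := RatFunc.X_ne_zero
  rw [← mul_div_assoc, ← mul_assoc, inv_mul_cancel₀ (mul_ne_zero hm' (pow_ne_zero _ hX')), one_mul]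
  rfl

/-- As `m ≠ 0` in `K`, the algebraic closure contains a primitive root, so the defining condition is
not vacuous. Substituting `w ^ m` is injective. -/
theorem IsLandenTransform.unique (hm : (m : K) ≠ 0) {φ ψ ψ' : RatFunc K}
    (h : IsLandenTransform m k φ ψ) (h' : IsLandenTransform m k φ ψ') : ψ = ψ' := by
  have : NeZero (m : AlgebraicClosure K) := ⟨by
    rw [← map_natCast (algebraMap K (AlgebraicClosure K))]
    exact (_root_.map_ne_zero _).mpr hm⟩
  obtain ⟨ζ, hζ⟩ := HasEnoughRootsOfUnity.exists_primitiveRoot (AlgebraicClosure K) m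
  have h1 := (h _ ζ hζ).trans (h' _ ζ hζ).symm
  have e1 : (RatFunc.X : RatFunc (AlgebraicClosure K)) ^ m =
      algebraMap (AlgebraicClosure K)[X] _ (X ^ m) := by
    rw [map_pow, RatFunc.algebraMap_X]
  rw [e1] at h1
  exact substRat_injective (t := (X ^ m : (AlgebraicClosure K)[X]))
    (by rw [natDegree_X_pow]; exact NeZero.ne m) h1

theorem denominator_ne_zero (hd : 0 < d) {a b : Fin (d + 1) → K} (h : ratDegree (ratFun a b) = d) :
    b ≠ 0 := by
  rintro rfl
  have h0 : vecPoly (0 : Fin (d + 1) → K) = 0 := by simp [vecPoly]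
  -- A zero denominator gives, by convention, the rational function `0`, whose degree is `0 < d`.
  rw [ratFun_eq, h0, map_zero, div_zero, ratDegree, RatFunc.num_zero, RatFunc.denom_zero,
    natDegree_zero, natDegree_one] at h
  exact hd.ne h

/-- The reduced numerator or denominator already has degree `d`, leaving no room for a nonconstant
common factor. Hence a rational function of degree `d` determines its point of projective space. -/
theorem exists_C_mul_num_denom (hd : 0 < d) {a b : Fin (d + 1) → K}
    (h : ratDegree (ratFun a b) = d) : ∃ c : K, c ≠ 0 ∧
      vecPoly a = C c * (ratFun a b).num ∧ vecPoly b = C c * (ratFun a b).denom := by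
  have hb := vecPoly_ne_zero (denominator_ne_zero hd h)
  set φ := ratFun a b with hφ
  have h1 := (RatFunc.num_mul_eq_mul_denom_iff (x := φ) hb).mpr (ratFun_eq a b)
  obtain ⟨g, hg⟩ := (RatFunc.denom_dvd (x := φ) hb).mpr ⟨_, ratFun_eq a b⟩
  have h2 : vecPoly a = φ.num * g := by
    rw [hg] at h1
    refine mul_right_cancel₀ φ.denom_ne_zero ?_
    rw [← h1]
    ring
  have hg0 : g ≠ 0 := by
    rintro rfl
    exact hb (by rw [hg, mul_zero])
  have hgd : g.natDegree = 0 := by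
    have hda := natDegree_vecPoly_le a
    have hdb := natDegree_vecPoly_le b
    rw [hg, natDegree_mul φ.denom_ne_zero hg0] at hdb
    rcases max_choice φ.num.natDegree φ.denom.natDegree with hc | hc
    · rw [ratDegree, hc] at h
      have hn : φ.num ≠ 0 := by
        intro h0
        rw [h0, natDegree_zero] at h
        omega
      rw [h2, natDegree_mul hn hg0] at hda
      omega
    · rw [ratDegree, hc] at h
      omega
  rw [eq_C_of_natDegree_eq_zero hgd] at hg h2 hg0
  exact ⟨g.coeff 0, by simpa using hg0, by rw [h2, mul_comm], by rw [hg, mul_comm]⟩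

theorem vecPoly_smul {R : Type} [CommRing R] (c : R) (a : Fin (d + 1) → R) :
    vecPoly (c • a) = C c * vecPoly a := by
  simp [vecPoly, Finset.mul_sum, mul_assoc]

theorem exists_eq_smul_of_ratFun_eq (hd : 0 < d) {a b a' b' : Fin (d + 1) → K}
    (h : ratFun a b = ratFun a' b') (hdeg : ratDegree (ratFun a b) = d) :
    ∃ c : K, c ≠ 0 ∧ Sum.elim a' b' = c • Sum.elim a b := by
  obtain ⟨c, hc, h1, h2⟩ := exists_C_mul_num_denom hd hdeg
  obtain ⟨c', hc', h1', h2'⟩ := exists_C_mul_num_denom hd (h ▸ hdeg)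
  refine ⟨c' * c⁻¹, mul_ne_zero hc' (inv_ne_zero hc), ?_⟩
  have key (u v : Fin (d + 1) → K) (p : K[X]) (hu : vecPoly u = C c * p)
      (hv : vecPoly v = C c' * p) : v = (c' * c⁻¹) • u := by
    refine vecPoly_injective ?_
    rw [vecPoly_smul, hu, hv, ← mul_assoc, ← C_mul, mul_assoc, inv_mul_cancel₀ hc, mul_one]
  rw [← h] at h1' h2'
  rw [key a a' _ h1 h1', key b b' _ h2 h2']
  funext i
  rcases i with i | i <;> rfl

/-- The value of the Landen transform at a Landen pair. -/
theorem IsLandenPair.exists_eq_smul (hd : 0 < d) (hk : k < m) {a b a' b' : Fin (d + 1) → K}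
    (h : IsLandenPair m k a b a' b') : b ≠ 0 ∧
      ∃ c : K, c ≠ 0 ∧ Sum.elim a' b' = c • landenVec m k (Sum.elim a b) := by
  have hb := denominator_ne_zero hd h.degree_source
  refine ⟨hb, ?_⟩
  have h1 := h.isLanden.unique h.cast_ne_zero
    (isLandenTransform_landenVec h.cast_ne_zero hk (Sum.elim a b) hb)
  obtain ⟨c, hc, h2⟩ := exists_eq_smul_of_ratFun_eq hd h1 h.degree_target
  refine ⟨c⁻¹, inv_ne_zero hc, ?_⟩
  rw [← Sum.elim_comp_inl_inr (landenVec m k (Sum.elim a b))]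
  change _ = c⁻¹ • Sum.elim (fun i => landenVec m k (Sum.elim a b) (Sum.inl i)) fun i =>
    landenVec m k (Sum.elim a b) (Sum.inr i)
  rw [h2, smul_smul, inv_mul_cancel₀ hc, one_smul]

theorem ratDegree_ratFun {a b : Fin (d + 1) → K} (hb : b 0 ≠ 0)
    (hcop : IsCoprime (vecPoly a) (vecPoly b)) : ratDegree (ratFun a b) = d := by
  have hb0 : vecPoly b ≠ 0 := vecPoly_ne_zero fun h => hb (congrFun h 0)
  have hdb : (vecPoly b).natDegree = d := by
    refine le_antisymm (natDegree_vecPoly_le _) (le_natDegree_of_ne_zero ?_)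
    have := coeff_vecPoly b 0
    rw [Fin.val_zero, Nat.sub_zero] at this
    rwa [this]
  set φ := ratFun a b with hφ
  have h1 := (RatFunc.num_mul_eq_mul_denom_iff (x := φ) hb0).mpr (ratFun_eq a b)
  have h2 : vecPoly b ∣ φ.denom := hcop.symm.dvd_of_dvd_mul_left ⟨φ.num, by rw [← h1, mul_comm]⟩
  have h3 := natDegree_le_of_dvd h2 φ.denom_ne_zero
  have h4 : φ.denom ∣ vecPoly b := (RatFunc.denom_dvd (x := φ) hb0).mpr ⟨_, ratFun_eq a b⟩
  obtain ⟨g, hg⟩ := h4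
  have hg0 : g ≠ 0 := by
    rintro rfl
    exact hb0 (by rw [hg, mul_zero])
  have h5 : vecPoly a = φ.num * g := by
    rw [hg] at h1
    refine mul_right_cancel₀ φ.denom_ne_zero ?_
    rw [← h1]
    ring
  have h6 := natDegree_le_of_dvd (Dvd.intro _ hg.symm) hb0
  have h7 : φ.num.natDegree ≤ d := by
    rcases eq_or_ne φ.num 0 with h0 | h0
    · rw [h0, natDegree_zero]
      exact Nat.zero_le _
    · have := natDegree_vecPoly_le a
      rw [h5, natDegree_mul h0 hg0] at this
      omega
  rw [ratDegree]
  omega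

end Landen

end

/-! ### Coprimality and separability from a transcendental constant coefficient -/

noncomputable section

open Polynomial

section Transcendental

variable {R L : Type} [CommRing R] [Field L] [Algebra R L] {S : Subalgebra R L}

/-- At a root of a nonzero polynomial over `S`, no polynomial over `S` takes the value `-y` if `y`
is transcendental over `S`. -/
theorem eval_add_ne_zero_of_transcendental {y : L} (hy : Transcendental S y) {f p : L[X]}
    (hf0 : f ≠ 0) (hf : ∀ n, f.coeff n ∈ S) (hp : ∀ n, p.coeff n ∈ S) {β : L}
    (hβ : f.eval β = 0) : p.eval β + y ≠ 0 := by
  intro h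
  -- The root `β` is algebraic over `S`, hence so is `p(β)`, and it cannot be `-y`.
  have hβS : IsAlgebraic S β := by
    obtain ⟨q, hq⟩ := (mem_lifts (f := algebraMap S L) f).mp
      ((lifts_iff_coeff_lifts f).mpr fun n => ⟨⟨_, hf n⟩, rfl⟩)
    refine ⟨q, ?_, ?_⟩
    · rintro rfl
      exact hf0 (by rw [← hq, Polynomial.map_zero])
    · rw [aeval_def, ← Polynomial.eval_map, hq, hβ]
  have h1 : p.eval β ∈ Subalgebra.algebraicClosure S L := by
    rw [eval_eq_sum_range]
    exact sum_mem fun n _ => mul_mem (isAlgebraic_algebraMap (⟨_, hp n⟩ : S)) (pow_mem hβS n)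
  refine hy ?_
  rw [← neg_eq_of_add_eq_zero_right h]
  exact (Subalgebra.algebraicClosure S L).neg_mem h1

variable {d : ℕ}

theorem coeff_vecPoly_mem {a : Fin (d + 1) → L} (ha : ∀ i, a i ∈ S) (n : ℕ) :
    (vecPoly a).coeff n ∈ S := by
  by_cases hn : n ≤ d
  · have h := coeff_vecPoly a ⟨d - n, Nat.lt_succ_of_le (Nat.sub_le _ _)⟩
    simp only [Nat.sub_sub_self hn] at h
    rw [h]
    exact ha _
  · rw [coeff_eq_zero_of_natDegree_lt ((natDegree_vecPoly_le _).trans_lt (not_le.mp hn))]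
    exact zero_mem S

theorem vecPoly_eq_update_add (a : Fin (d + 1) → L) :
    vecPoly a = vecPoly (Function.update a (Fin.last d) 0) + C (a (Fin.last d)) := by
  rw [vecPoly, vecPoly, Fin.sum_univ_castSucc, Fin.sum_univ_castSucc]
  simp

theorem update_last_mem {a : Fin (d + 1) → L} (ha : ∀ i, i ≠ Fin.last d → a i ∈ S)
    (i : Fin (d + 1)) : Function.update a (Fin.last d) 0 i ∈ S := by
  rw [Function.update_apply]
  split_ifs with h
  · exact zero_mem S
  · exact ha i h

variable [IsAlgClosed L]

theorem isCoprime_vecPoly {a b : Fin (d + 1) → L} (hy : Transcendental S (a (Fin.last d)))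
    (ha : ∀ i, i ≠ Fin.last d → a i ∈ S) (hb : ∀ i, b i ∈ S) (hb0 : b ≠ 0) :
    IsCoprime (vecPoly a) (vecPoly b) := by
  rw [isCoprime_iff_aeval_ne_zero_of_isAlgClosed L L]
  intro β
  rw [or_iff_not_imp_right, not_not]
  intro hβ
  rw [coe_aeval_eq_eval] at hβ
  rw [vecPoly_eq_update_add, coe_aeval_eq_eval, eval_add, eval_C]
  exact eval_add_ne_zero_of_transcendental hy (vecPoly_ne_zero hb0) (coeff_vecPoly_mem hb)
    (coeff_vecPoly_mem (update_last_mem ha)) hβ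

/-- The derivative does not involve the constant coefficient `b_d`, so at its roots the remaining
terms of the polynomial are algebraic over `S` and cannot cancel `b_d`. The derivative is nonzero in
every characteristic because its own constant term is `b_(d-1)`. -/
theorem separable_vecPoly {b : Fin (d + 1) → L} (hy : Transcendental S (b (Fin.last d)))
    (hb : ∀ i, i ≠ Fin.last d → b i ∈ S) {i : Fin (d + 1)} (hi : (i : ℕ) + 1 = d)
    (hi0 : b i ≠ 0) : (vecPoly b).Separable := by
  rw [separable_def, isCoprime_iff_aeval_ne_zero_of_isAlgClosed L L]
  intro β
  rw [or_iff_not_imp_right, not_not]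
  intro hβ
  have h1 : derivative (vecPoly b) =
      derivative (vecPoly (Function.update b (Fin.last d) 0)) := by
    conv_lhs => rw [vecPoly_eq_update_add, derivative_add, derivative_C, add_zero]
  rw [coe_aeval_eq_eval] at hβ
  rw [vecPoly_eq_update_add, coe_aeval_eq_eval, eval_add, eval_C]
  refine eval_add_ne_zero_of_transcendental hy (f := derivative (vecPoly b)) ?_ ?_
    (coeff_vecPoly_mem (update_last_mem hb)) hβ
  · intro h
    have h2 := congrArg (fun f => f.coeff 0) h
    have h3 := coeff_vecPoly b i
    rw [show d - (i : ℕ) = 1 by omega] at h3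
    simp only [coeff_derivative, zero_add, h3, coeff_zero] at h2
    simp at h2
    exact hi0 h2
  · intro n
    rw [h1, coeff_derivative]
    exact mul_mem (coeff_vecPoly_mem (update_last_mem hb) _)
      (add_mem (natCast_mem S n) (one_mem S))

end Transcendental

end

/-! ### Solving for a preimage by partial fractions -/

noncomputable section

open Polynomial

section Preimage

/-- Lagrange interpolation. -/
theorem exists_eq_sum_prod_erase {K : Type} [Field K] [DecidableEq K] (s : Finset K) {f : K[X]}
    (hf : f.degree < s.card) :
    ∃ c : K → K, f = ∑ r ∈ s, C (c r) * ∏ r' ∈ s.erase r, (X - C r') := by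
  have heval (r x : K) (hx : x ∈ s) : eval x (∏ r' ∈ s.erase r, (X - C r')) = 0 ↔ r ≠ x := by
    rw [eval_prod, Finset.prod_eq_zero_iff]
    constructor
    · rintro ⟨a, ha, h⟩ rfl
      rw [eval_sub, eval_X, eval_C, sub_eq_zero] at h
      exact (Finset.mem_erase.mp ha).1 h.symm
    · intro h
      exact ⟨x, Finset.mem_erase.mpr ⟨h.symm, hx⟩, by simp⟩
  refine ⟨fun r => eval r f / eval r (∏ r' ∈ s.erase r, (X - C r')),
    eq_of_degrees_lt_of_eval_finset_eq s hf ?_ fun x hx => ?_⟩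
  · rw [← mem_degreeLT]
    refine Submodule.sum_mem _ fun r hr => ?_
    rw [mem_degreeLT]
    refine (degree_mul_le _ _).trans_lt ?_
    refine (add_le_add degree_C_le le_rfl).trans_lt ?_
    rw [zero_add]
    refine degree_le_natDegree.trans_lt ?_
    rw [natDegree_finsetProd_X_sub_C_eq_card, Nat.cast_lt]
    exact Finset.card_erase_lt_of_mem hr
  · rw [eval_finsetSum, Finset.sum_eq_single x]
    · rw [eval_mul, eval_C, div_mul_cancel₀]
      exact fun h => (heval x x hx).mp h rfl
    · intro r _ hr
      rw [eval_mul, (heval r x hx).mpr hr, mul_zero]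
    · exact fun h => absurd hx h

variable {d m k : ℕ} [NeZero m] {K : Type} [Field K]

theorem residuePart_geom_sum₂ (hk : k < m) (β : K) :
    residuePart m k (∑ i ∈ Finset.range m, X ^ i * C β ^ (m - 1 - i)) = C β ^ (m - 1 - k) := by
  rw [residuePart_sum, Finset.sum_eq_single k]
  · rw [mul_comm, ← C_pow, residuePart_C_mul, residuePart_X_pow m hk hk, if_pos rfl, mul_one]
  · intro i hi hik
    rw [mul_comm, ← C_pow, residuePart_C_mul, residuePart_X_pow m hk (Finset.mem_range.mp hi),
      if_neg hik, mul_zero]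
  · exact fun h => absurd (Finset.mem_range.mpr hk) h

theorem residuePart_mul_normCofactor_self (hk : k < m) (B : K[X]) :
    residuePart m k (B * normCofactor m B) = if k = 0 then normExpand m B else 0 := by
  rw [mul_comm, normCofactor_mul, ← mul_one (expand K m _), residuePart_expand_mul m hk,
    ← pow_zero X, residuePart_X_pow m hk (NeZero.pos m)]
  split_ifs with h1 h2 h2
  · exact mul_one _
  · exact absurd h1.symm h2
  · exact absurd h2.symm h1
  · exact mul_zero _

/-- If `B = b A' (X - β)`, then the `k`-th residue part of `A' E`, where `E` is the cofactor of `B`,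
is a multiple of the quotient of the norm of `B` by `X - β ^ m`. -/
theorem residuePart_mul_normCofactor_of_eq (hk : k < m) {A B Q : K[X]} {b c β : K}
    (hB : B = C b * A * (X - C β))
    (hD : normExpand m B = C c * Q * (X - C (β ^ m))) :
    C b * residuePart m k (A * normCofactor m B) = C (c * β ^ (m - 1 - k)) * Q := by
  -- Cancel `w - β` from `w ^ m - β ^ m`. The quotient is a sum over the powers of `w` below `m`,
  -- each with a nonzero multiple of a power of `β`, if `β ≠ 0`.
  have h1 : C b * (A * normCofactor m B) =
      expand K m (C c * Q) * ∑ i ∈ Finset.range m, X ^ i * C β ^ (m - 1 - i) := by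
    refine mul_right_cancel₀ (X_sub_C_ne_zero β) ?_
    rw [mul_assoc (expand K m _), geom_sum₂_mul, ← C_pow]
    calc _ = normCofactor m B * (C b * A * (X - C β)) := by ring
      _ = expand K m (normExpand m B) := by rw [← hB, normCofactor_mul]
      _ = _ := by rw [hD, map_mul _ _ (X - _), map_sub, expand_X, expand_C]
  rw [← residuePart_C_mul, h1, residuePart_expand_mul m hk, residuePart_geom_sum₂ hk, C_mul, C_pow]
  ring

variable [IsAlgClosed K]

/-- Every vector outside of a proper closed subset is a value of the Landen transform. -/
theorem exists_landenVec_eq (hk : k < m) {y : Coord d → K}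
    (h0 : y (Sum.inr 0) ≠ 0) (hlast : y (Sum.inr (Fin.last d)) ≠ 0)
    (hsep : (vecPoly fun i => y (Sum.inr i)).Separable) (hy : k = 0 ∨ y (Sum.inl 0) = 0) :
    ∃ x : Coord d → K, landenVec m k x = y ∧ (y (Sum.inl 0) = 0 → x (Sum.inl 0) = 0) := by
  classical
  set G := vecPoly fun i => y (Sum.inr i) with hG
  set N := vecPoly fun i => y (Sum.inl i) with hN
  have hGc : G.coeff d = y (Sum.inr 0) := coeff_vecPoly (fun i => y (Sum.inr i)) 0
  have hG0 : G.coeff 0 = y (Sum.inr (Fin.last d)) := by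
    rw [← coeff_vecPoly (fun i => y (Sum.inr i)) (Fin.last d), Fin.val_last, Nat.sub_self]
  have hNc : N.coeff d = y (Sum.inl 0) := coeff_vecPoly (fun i => y (Sum.inl i)) 0
  have hGd : G.natDegree = d :=
    le_antisymm (natDegree_vecPoly_le _) (le_natDegree_of_ne_zero (by rwa [hGc]))
  set s := G.roots.toFinset with hs
  have hcard : s.card = d := by
    rw [hs, Multiset.toFinset_card_of_nodup (nodup_roots hsep),
      splits_iff_card_roots.mp (IsAlgClosed.splits G), hGd]
  have hGprod : G = C (y (Sum.inr 0)) * ∏ r ∈ s, (X - C r) := by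
    have := (IsAlgClosed.splits G).eq_prod_roots
    rw [leadingCoeff, hGd, hGc] at this
    rw [Finset.prod, hs, Multiset.toFinset_val, (nodup_roots hsep).dedup]
    exact this
  have hs0 : ∀ r ∈ s, r ≠ 0 := by
    rintro r hr rfl
    rw [hs, Multiset.mem_toFinset] at hr
    refine hlast ?_
    rw [← hG0, coeff_zero_eq_eval_zero]
    exact isRoot_of_mem_roots hr
  -- The root `X - β r` of `B` will contribute `X - r` to its norm, up to the sign `(-1) ^ (m - 1)`.
  -- The scalar `b` is chosen to absorb the `d` signs and match the leading coefficient of `G`.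
  choose β hβ using fun r : K => IsAlgClosed.exists_pow_nat_eq r (NeZero.pos m)
  obtain ⟨b, hb⟩ := IsAlgClosed.exists_pow_nat_eq
    (y (Sum.inr 0) * (((-1) ^ (m - 1)) ^ d)⁻¹) (NeZero.pos m)
  have hε : (((-1) ^ (m - 1)) ^ d : K) ≠ 0 := pow_ne_zero _ (pow_ne_zero _ (by simp))
  have hb0 : b ≠ 0 := by
    rintro rfl
    rw [zero_pow (NeZero.ne m)] at hb
    exact mul_ne_zero h0 (inv_ne_zero hε) hb.symm
  set B := C b * ∏ r ∈ s, (X - C (β r)) with hB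
  have hBd : B.natDegree ≤ d := by
    rw [hB, natDegree_C_mul hb0, natDegree_finsetProd_X_sub_C_eq_card, hcard]
  have hD : normExpand m B = G := by
    rw [hB, normExpand_mul, normExpand_C, normExpand_prod, hb, hGprod]
    simp only [normExpand_X_sub_C, hβ]
    rw [Finset.prod_mul_distrib, Finset.prod_const, hcard, ← mul_assoc]
    congr 1
    rw [show (((-1) ^ (m - 1)) ^ d : K[X]) = C (((-1) ^ (m - 1)) ^ d) by simp, ← C_mul, mul_assoc,
      inv_mul_cancel₀ hε, mul_one]
  -- This is the value of `N / G` at infinity. Subtracting it leaves degree below `d`, so partial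
  -- fractions have only the simple poles in `s`.
  set c₀ := y (Sum.inl 0) / y (Sum.inr 0) with hc₀
  obtain ⟨c, hc⟩ := exists_eq_sum_prod_erase s (f := N - C c₀ * G) (by
    rw [hcard, degree_lt_iff_coeff_zero]
    intro n hn
    rcases hn.eq_or_lt with rfl | hn
    · rw [coeff_sub, coeff_C_mul, hNc, hGc, hc₀, div_mul_cancel₀ _ h0, sub_self]
    · rw [coeff_sub, coeff_C_mul, coeff_eq_zero_of_natDegree_lt (hGd.trans_lt hn),
        coeff_eq_zero_of_natDegree_lt ((natDegree_vecPoly_le _).trans_lt hn), mul_zero, sub_zero])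
  -- The factor by which the transform scales the polar part at `r`. It is nonzero because the
  -- prescribed `b_d`, hence every root `r`, is nonzero.
  set u : K → K := fun r => y (Sum.inr 0) * β r ^ (m - 1 - k) / b with hu
  have hβ0 : ∀ r ∈ s, β r ≠ 0 := by
    intro r hr h
    have := hβ r
    rw [h, zero_pow (NeZero.ne m)] at this
    exact hs0 r hr this.symm
  have hu0 : ∀ r ∈ s, u r ≠ 0 := fun r hr =>
    div_ne_zero (mul_ne_zero h0 (pow_ne_zero _ (hβ0 r hr))) hb0
  have hres (r : K) (hr : r ∈ s) : residuePart m k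
      ((∏ r' ∈ s.erase r, (X - C (β r'))) * normCofactor m B) =
      C (u r) * ∏ r' ∈ s.erase r, (X - C r') := by
    have h1 := residuePart_mul_normCofactor_of_eq hk (A := ∏ r' ∈ s.erase r, (X - C (β r')))
      (B := B) (b := b) (β := β r) (c := y (Sum.inr 0)) (Q := ∏ r' ∈ s.erase r, (X - C r'))
      (by rw [hB, mul_assoc, Finset.prod_erase_mul s _ hr])
      (by rw [hD, hGprod, hβ, mul_assoc, Finset.prod_erase_mul s _ hr])
    refine mul_left_cancel₀ (C_ne_zero.mpr hb0) ?_
    rw [h1, ← mul_assoc, ← C_mul, hu, mul_div_cancel₀ _ hb0]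
  set A := C c₀ * B + ∑ r ∈ s, C (c r / u r) * ∏ r' ∈ s.erase r, (X - C (β r')) with hA
  have hsum : (∑ r ∈ s, C (c r / u r) * ∏ r' ∈ s.erase r, (X - C (β r'))).degree < d := by
    rw [← mem_degreeLT]
    refine Submodule.sum_mem _ fun r hr => ?_
    rw [mem_degreeLT]
    refine (degree_mul_le _ _).trans_lt ?_
    refine (add_le_add degree_C_le le_rfl).trans_lt ?_
    rw [zero_add]
    refine degree_le_natDegree.trans_lt ?_
    rw [natDegree_finsetProd_X_sub_C_eq_card, Nat.cast_lt, ← hcard]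
    exact Finset.card_erase_lt_of_mem hr
  have hAd : A.natDegree ≤ d :=
    natDegree_add_le_of_degree_le ((natDegree_C_mul_le _ _).trans hBd)
      (natDegree_le_of_degree_le hsum.le)
  have hAE : residuePart m k (A * normCofactor m B) = N := by
    rw [hA, add_mul, residuePart_add, mul_assoc, residuePart_C_mul,
      residuePart_mul_normCofactor_self hk, hD, Finset.sum_mul, residuePart_sum]
    -- For `k > 0` the transform kills constants, which is harmless since then `c₀ = 0`.
    have h1 : C c₀ * (if k = 0 then G else 0) = C c₀ * G := by
      rcases hy with h | h
      · rw [if_pos h]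
      · rw [hc₀, h, zero_div, C_0, zero_mul, zero_mul]
    rw [h1, eq_comm, ← sub_eq_iff_eq_add', hc]
    refine Finset.sum_congr rfl fun r hr => Eq.symm ?_
    rw [mul_assoc, residuePart_C_mul, hres r hr, ← mul_assoc, ← C_mul, div_mul_cancel₀ _ (hu0 r hr)]
  refine ⟨Sum.elim (fun i => A.coeff (d - (i : ℕ))) fun i => B.coeff (d - (i : ℕ)), ?_, ?_⟩
  · funext j
    rcases j with i | i
    · simp only [landenVec, landenNum, Sum.elim_inl, Sum.elim_inr]
      rw [vecPoly_coeff hAd, vecPoly_coeff hBd, hAE, hN, coeff_vecPoly]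
    · simp only [landenVec, landenDen, Sum.elim_inr]
      rw [vecPoly_coeff hBd, hD, hG, coeff_vecPoly]
  · intro h
    simp only [Sum.elim_inl, Fin.val_zero, Nat.sub_zero]
    rw [hA, coeff_add, hc₀, h, zero_div, C_0, zero_mul, coeff_zero, zero_add]
    exact (degree_lt_iff_coeff_zero _ _).mp hsum d le_rfl

end Preimage

end

/-! ### Relations between the forms -/

noncomputable section

open Polynomial

section Independence

variable {d m k : ℕ} {R : Type} [CommRing R]

theorem hypIncl_comp_inclCoord {K : Type} [Zero K] (x : HypCoord d → K) :
    hypIncl x ∘ inclCoord d = x := by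
  funext i
  rcases i with i | i <;> simp [hypIncl]

theorem hypIncl_eq {K : Type} [Zero K] {x : Coord d → K} (hx : x (Sum.inl 0) = 0) :
    hypIncl (x ∘ inclCoord d) = x := by
  funext i
  rcases i with i | i
  · refine Fin.cases ?_ (fun i => ?_) i
    · simp [hypIncl, hx]
    · simp [hypIncl]
  · simp [hypIncl]

theorem hypIncl_inl_zero {K : Type} [Zero K] (x : HypCoord d → K) : hypIncl x (Sum.inl 0) = 0 :=
  rfl

/-- Modulo an ideal containing the variable `a_0`, every polynomial equals its restriction to `a_0 =
0`. -/
theorem mem_of_aeval_hypIncl_eq_zero {I : Ideal (MvPolynomial (Coord d) R)}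
    (hI : MvPolynomial.X (Sum.inl 0) ∈ I) {Q : MvPolynomial (Coord d) R}
    (hQ : MvPolynomial.aeval (hypIncl (MvPolynomial.X : HypCoord d → MvPolynomial (HypCoord d) R)) Q
      = 0) : Q ∈ I := by
  rw [← Ideal.Quotient.eq_zero_iff_mem]
  have h : ((Ideal.Quotient.mkₐ R I).comp (MvPolynomial.rename (inclCoord d))).comp
      (MvPolynomial.aeval (hypIncl (MvPolynomial.X : HypCoord d → MvPolynomial (HypCoord d) R))) =
      Ideal.Quotient.mkₐ R I := by
    refine MvPolynomial.algHom_ext fun i => ?_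
    rw [AlgHom.comp_apply, MvPolynomial.aeval_X]
    rcases i with i | i
    · refine Fin.cases ?_ (fun i => ?_) i
      · rw [hypIncl_inl_zero, map_zero]
        exact (Ideal.Quotient.eq_zero_iff_mem.mpr hI).symm
      · simp [hypIncl]
    · simp [hypIncl]
  have h2 := DFunLike.congr_fun h Q
  rw [AlgHom.comp_apply, hQ, map_zero] at h2
  exact h2.symm

section Field

variable {L : Type} [Field L] [Algebra R L] [IsAlgClosed L] [Nontrivial R]

theorem separable_vecPoly_of_algebraicIndependent (hd : 0 < d) {b : Fin (d + 1) → L}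
    (hb : AlgebraicIndependent R b) : (vecPoly b).Separable := by
  refine separable_vecPoly (S := Algebra.adjoin R (b '' {Fin.last d}ᶜ))
    (hb.transcendental_adjoin (by simp))
    (fun i hi => Algebra.subset_adjoin ⟨i, hi, rfl⟩) (i := ⟨d - 1, by omega⟩)
    (Nat.sub_add_cancel hd) (hb.ne_zero _)

theorem isCoprime_vecPoly_of_algebraicIndependent {z : Coord d → L}
    (hz : AlgebraicIndependent R z) :
    IsCoprime (vecPoly fun i => z (Sum.inl i)) (vecPoly fun i => z (Sum.inr i)) := by
  refine isCoprime_vecPoly (S := Algebra.adjoin R (z '' {Sum.inl (Fin.last d)}ᶜ))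
    (hz.transcendental_adjoin (by simp))
    (fun i hi => Algebra.subset_adjoin ⟨_, by simpa using hi, rfl⟩)
    (fun i => Algebra.subset_adjoin ⟨_, by simp, rfl⟩)
    (Function.ne_iff.mpr ⟨0, hz.ne_zero _⟩)

theorem isCoprime_vecPoly_of_algebraicIndependent_comp (hd : 0 < d) {z : Coord d → L}
    (hz : AlgebraicIndependent R (z ∘ inclCoord d)) (hz0 : z (Sum.inl 0) = 0) :
    IsCoprime (vecPoly fun i => z (Sum.inl i)) (vecPoly fun i => z (Sum.inr i)) := by
  -- With `d > 0` the constant coefficient `a_d` is not `a_0`, so it is among the independent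
  -- coordinates; `a_0 = 0` lies in every subalgebra.
  obtain ⟨d, rfl⟩ := Nat.exists_eq_succ_of_ne_zero hd.ne'
  refine isCoprime_vecPoly
    (S := Algebra.adjoin R ((z ∘ inclCoord (d + 1)) '' {Sum.inl (Fin.last d)}ᶜ))
    ?_ (fun i => ?_)
    (fun i => Algebra.subset_adjoin ⟨Sum.inr i, by simp, rfl⟩)
    (Function.ne_iff.mpr ⟨0, hz.ne_zero (Sum.inr 0)⟩)
  · exact hz.transcendental_adjoin (i := Sum.inl (Fin.last d)) (by simp)
  · refine Fin.cases (fun _ => ?_) (fun i hi => ?_) i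
    · change z (Sum.inl 0) ∈ _
      rw [hz0]
      exact zero_mem _
    · refine Algebra.subset_adjoin ⟨Sum.inl i, ?_, rfl⟩
      intro h
      refine hi ?_
      rw [Sum.inl_injective (Set.mem_singleton_iff.mp h), Fin.succ_last]

end Field

section Generic

variable (R) [IsDomain R] (τ : Type)

/-- The generic vector, with entries in an algebraically closed field. -/
def closedGenericVec (i : τ) : AlgebraicClosure (FractionRing (MvPolynomial τ R)) :=
  algebraMap (FractionRing (MvPolynomial τ R)) _ (genericVec τ R i)

theorem aeval_closedGenericVec (f : MvPolynomial τ R) :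
    MvPolynomial.aeval (closedGenericVec R τ) f =
      algebraMap (FractionRing (MvPolynomial τ R)) _ (algebraMap _ _ f) := by
  have : MvPolynomial.aeval (closedGenericVec R τ) f = algebraMap (FractionRing (MvPolynomial τ R))
      (AlgebraicClosure (FractionRing (MvPolynomial τ R)))
      (MvPolynomial.aeval (genericVec τ R) f) := by
    rw [← MvPolynomial.aeval_algebraMap_apply]
    rfl
  rw [this, aeval_genericVec]

theorem algebraicIndependent_closedGenericVec :
    AlgebraicIndependent R (closedGenericVec R τ) := by
  rw [algebraicIndependent_iff]
  intro f hf
  rwa [aeval_closedGenericVec, FaithfulSMul.algebraMap_eq_zero_iff,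
    FaithfulSMul.algebraMap_eq_zero_iff] at hf

end Generic

variable [NeZero m]

theorem aeval_aeval_landenForm {L : Type} [CommRing L] [Algebra R L] (x : Coord d → L)
    (Q : MvPolynomial (Coord d) R) :
    MvPolynomial.aeval x (MvPolynomial.aeval (landenForm d m k R) Q) =
      MvPolynomial.aeval (landenVec m k x) Q := by
  rw [MvPolynomial.comp_aeval_apply]
  congr 2
  funext j
  exact aeval_landenForm m k x j

theorem aeval_aeval_hypForm {L : Type} [CommRing L] [Algebra R L] (x : HypCoord d → L)
    (Q : MvPolynomial (HypCoord d) R) :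
    MvPolynomial.aeval x (MvPolynomial.aeval (hypForm d m k R) Q) =
      MvPolynomial.aeval (landenVec m k (hypIncl x) ∘ inclCoord d) Q := by
  rw [MvPolynomial.comp_aeval_apply]
  congr 2
  funext j
  exact aeval_hypForm m k x j

variable [IsDomain R]

/-- Algebraically independent entries satisfy the open conditions for a preimage: `b_0`, `b_d` are
nonzero and the denominator is separable. A relation between the forms then holds at the generic
vector, hence is trivial. -/
theorem exists_landenVec_eq_closedGenericVec (hd : 0 < d) :
    ∃ x, landenVec m 0 x = closedGenericVec R (Coord d) := by
  have h := algebraicIndependent_closedGenericVec R (Coord d)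
  obtain ⟨x, hx, _⟩ := exists_landenVec_eq (NeZero.pos m) (h.ne_zero _) (h.ne_zero _)
    (separable_vecPoly_of_algebraicIndependent hd (h.comp _ Sum.inr_injective)) (Or.inl rfl)
  exact ⟨x, hx⟩

theorem exists_landenVec_eq_hypIncl (hd : 0 < d) (hk : k < m) :
    ∃ x, landenVec m k (hypIncl x) = hypIncl (closedGenericVec R (HypCoord d)) := by
  have h := algebraicIndependent_closedGenericVec R (HypCoord d)
  obtain ⟨x, hx, hx0⟩ := exists_landenVec_eq hk
    (y := hypIncl (closedGenericVec R (HypCoord d))) (h.ne_zero _) (h.ne_zero _)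
    (separable_vecPoly_of_algebraicIndependent hd (h.comp _ Sum.inr_injective)) (Or.inr rfl)
  exact ⟨x ∘ inclCoord d, by rw [hypIncl_eq (hx0 rfl), hx]⟩

/-- There is no relation between the forms `landenForm d m 0 R`. -/
theorem eq_zero_of_aeval_landenForm (hd : 0 < d) {Q : MvPolynomial (Coord d) R}
    (hQ : MvPolynomial.aeval (landenForm d m 0 R) Q = 0) : Q = 0 := by
  obtain ⟨x, hx⟩ := exists_landenVec_eq_closedGenericVec (m := m) (R := R) hd
  refine algebraicIndependent_iff.mp (algebraicIndependent_closedGenericVec R (Coord d)) Q ?_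
  rw [← hx, ← aeval_aeval_landenForm, hQ, map_zero]

theorem eq_zero_of_aeval_hypForm (hd : 0 < d) (hk : k < m) {Q : MvPolynomial (HypCoord d) R}
    (hQ : MvPolynomial.aeval (hypForm d m k R) Q = 0) : Q = 0 := by
  obtain ⟨x, hx⟩ := exists_landenVec_eq_hypIncl (R := R) hd hk
  refine algebraicIndependent_iff.mp (algebraicIndependent_closedGenericVec R (HypCoord d)) Q ?_
  rw [← hypIncl_comp_inclCoord (closedGenericVec R (HypCoord d)), ← hx, ← aeval_aeval_hypForm, hQ,
    map_zero]

/-- The relations between the forms `landenForm d m k R` vanish on the hyperplane `a_0 = 0`. -/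
theorem aeval_hypIncl_eq_zero_of_aeval_landenForm (hd : 0 < d) (hk : k < m)
    {Q : MvPolynomial (Coord d) R} (hQ : MvPolynomial.aeval (landenForm d m k R) Q = 0) :
    MvPolynomial.aeval (hypIncl (MvPolynomial.X : HypCoord d → MvPolynomial (HypCoord d) R)) Q =
      0 := by
  obtain ⟨x, hx⟩ := exists_landenVec_eq_hypIncl (R := R) hd hk
  refine algebraicIndependent_iff.mp (algebraicIndependent_closedGenericVec R (HypCoord d)) _ ?_
  rw [MvPolynomial.comp_aeval_apply]
  have h := map_hypIncl (MvPolynomial.aeval (R := R) (closedGenericVec R (HypCoord d))).toRingHom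
    MvPolynomial.X
  have h1 : (fun i => MvPolynomial.aeval (closedGenericVec R (HypCoord d))
      (hypIncl (MvPolynomial.X : HypCoord d → MvPolynomial (HypCoord d) R) i)) =
      landenVec m k (hypIncl x) := by
    refine h.trans ?_
    rw [hx]
    congr 1
    funext i
    exact MvPolynomial.aeval_X _ _
  rw [h1, ← aeval_aeval_landenForm, hQ, map_zero]

theorem algebraicIndependent_landenVec_zero (hd : 0 < d) {L : Type} [CommRing L] [Algebra R L]
    {x : Coord d → L} (hx : AlgebraicIndependent R x) :
    AlgebraicIndependent R (landenVec m 0 x) := by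
  rw [algebraicIndependent_iff] at hx ⊢
  intro Q hQ
  rw [← aeval_aeval_landenForm] at hQ
  exact eq_zero_of_aeval_landenForm hd (hx _ hQ)

theorem algebraicIndependent_landenVec_comp_inclCoord (hd : 0 < d) (hk : k < m) {L : Type}
    [CommRing L] [Algebra R L] {x : Coord d → L} (hx : AlgebraicIndependent R x) :
    AlgebraicIndependent R (landenVec m k x ∘ inclCoord d) := by
  rw [algebraicIndependent_iff] at hx ⊢
  intro Q hQ
  -- View `Q` as a relation not involving `a_0`; restriction to `a_0 = 0` loses nothing of it.
  rw [← MvPolynomial.aeval_rename, ← aeval_aeval_landenForm] at hQ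
  have h := aeval_hypIncl_eq_zero_of_aeval_landenForm hd hk (hx _ hQ)
  rw [MvPolynomial.aeval_rename, hypIncl_comp_inclCoord, MvPolynomial.aeval_X_left_apply] at h
  exact h

/-- For `k = 0` all transformed coordinates are independent. For `k > 0` the `a_0`-coordinate is
zero and the others are independent, which still suffices. -/
theorem isCoprime_landenVec (hd : 0 < d) (hk : k < m) {L : Type} [Field L] [IsAlgClosed L]
    [Algebra R L] {x : Coord d → L} (hx : AlgebraicIndependent R x) :
    IsCoprime (vecPoly fun i => landenVec m k x (Sum.inl i))
      (vecPoly fun i => landenVec m k x (Sum.inr i)) := by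
  rcases Nat.eq_zero_or_pos k with rfl | hk0
  · exact isCoprime_vecPoly_of_algebraicIndependent (algebraicIndependent_landenVec_zero hd hx)
  · exact isCoprime_vecPoly_of_algebraicIndependent_comp hd
      (algebraicIndependent_landenVec_comp_inclCoord hd hk hx) (landenVec_inl_zero m k hk0 x)

end Independence

end

/-! ### Every field-valued point over the integers has homogeneous coordinates -/

noncomputable section

open HomogeneousLocalization Proj

section IntegralPoints

variable {τ : Type}

theorem map_aeval_int {A B : Type} [CommRing A] [CommRing B] [Algebra ℤ A] [Algebra ℤ B]
    (g : A →+* B) (u : τ → A) (f : MvPolynomial τ ℤ) :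
    g (MvPolynomial.aeval u f) = MvPolynomial.aeval (fun j => g (u j)) f :=
  MvPolynomial.comp_aeval_apply (φ := ({ g with commutes' := fun n => by simp } : A →ₐ[ℤ] B)) u f

/-- Dehomogenization: `f / X_i ^ n` is `f` evaluated at the quotients `X_j / X_i`. So a ring
homomorphism out of the chart is determined by its values on these quotients. -/
theorem awayMk_eq_aeval (i : τ)
    (hX : ∀ j, (MvPolynomial.X j : MvPolynomial τ ℤ) ∈ MvPolynomial.homogeneousSubmodule τ ℤ (1 • 1))
    (hXi : (MvPolynomial.X i : MvPolynomial τ ℤ) ∈ MvPolynomial.homogeneousSubmodule τ ℤ 1)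
    (n : ℕ) (f : MvPolynomial τ ℤ) (hf : f ∈ MvPolynomial.homogeneousSubmodule τ ℤ (n • 1)) :
    Away.mk (MvPolynomial.homogeneousSubmodule τ ℤ) hXi n f hf =
      MvPolynomial.aeval (fun j => Away.mk (MvPolynomial.homogeneousSubmodule τ ℤ) hXi 1
        (MvPolynomial.X j) (hX j)) f := by
  apply HomogeneousLocalization.val_injective
  have h := map_aeval_int (algebraMap (Away (MvPolynomial.homogeneousSubmodule τ ℤ)
    (MvPolynomial.X i)) (Localization.Away (MvPolynomial.X i : MvPolynomial τ ℤ)))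
    (fun j => Away.mk (MvPolynomial.homogeneousSubmodule τ ℤ) hXi 1
        (MvPolynomial.X j) (hX j)) f
  refine Eq.trans ?_ h.symm
  set c : Localization.Away (MvPolynomial.X i : MvPolynomial τ ℤ) :=
    Localization.mk 1 ⟨MvPolynomial.X i, Submonoid.mem_powers _⟩ with hc
  have h1 : (fun j => algebraMap (Away (MvPolynomial.homogeneousSubmodule τ ℤ)
      (MvPolynomial.X i)) (Localization.Away (MvPolynomial.X i : MvPolynomial τ ℤ))
      (Away.mk (MvPolynomial.homogeneousSubmodule τ ℤ) hXi 1 (MvPolynomial.X j) (hX j))) =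
      fun j => c * algebraMap (MvPolynomial τ ℤ) _ (MvPolynomial.X j) := by
    funext j
    rw [← Localization.mk_one_eq_algebraMap, hc, Localization.mk_mul]
    change (Away.mk _ hXi 1 (MvPolynomial.X j) (hX j)).val = _
    rw [Away.val_mk]
    congr 1
    · rw [one_mul]
    · ext1
      simp
  have h2 := map_aeval_int (algebraMap (MvPolynomial τ ℤ)
    (Localization.Away (MvPolynomial.X i : MvPolynomial τ ℤ))) MvPolynomial.X f
  rw [MvPolynomial.aeval_X_left_apply] at h2
  rw [h1]
  refine Eq.trans ?_ (aeval_mul_of_isHomogeneous c _ hf).symm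
  refine Eq.trans ?_ (congrArg (c ^ (n • 1) * ·) h2)
  simp only [← Localization.mk_one_eq_algebraMap]
  rw [hc, Localization.mk_pow, Localization.mk_mul, Away.val_mk]
  congr 1
  · simp
  · ext1
    simp

/-- Every field-valued point of projective space over `ℤ` has homogeneous coordinates. -/
theorem exists_eq_projPoint {K : Type} [Field K] [inst : Algebra ℤ K]
    (p : Spec (.of K) ⟶ ProjSpace τ ℤ) : ∃ (x : τ → K) (hx : x ≠ 0), p = projPoint ℤ x hx := by
  obtain rfl : inst = Ring.toIntAlgebra K := Subsingleton.elim _ _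
  obtain ⟨i, hi⟩ := exists_notMem_X (p default)
  have hXi : (MvPolynomial.X i : MvPolynomial τ ℤ) ∈ MvPolynomial.homogeneousSubmodule τ ℤ 1 :=
    MvPolynomial.isHomogeneous_X ℤ i
  have hX (j : τ) : (MvPolynomial.X j : MvPolynomial τ ℤ) ∈
      MvPolynomial.homogeneousSubmodule τ ℤ (1 • 1) := MvPolynomial.isHomogeneous_X ℤ j
  have hr : Set.range p ⊆ Set.range
      (awayι (MvPolynomial.homogeneousSubmodule τ ℤ) (MvPolynomial.X i) hXi one_pos) := by
    rintro _ ⟨z, rfl⟩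
    rw [← Scheme.Hom.coe_opensRange, opensRange_awayι, Unique.eq_default z]
    exact hi
  let q := IsOpenImmersion.lift _ p hr
  have hq : q ≫ awayι (MvPolynomial.homogeneousSubmodule τ ℤ) (MvPolynomial.X i) hXi one_pos = p :=
    IsOpenImmersion.lift_fac _ _ hr
  obtain ⟨φ, hφ⟩ := Spec.map_surjective q
  -- The coordinates are the values of `X_j / X_i`, normalized so that the `i`-th is `1`.
  let x : τ → K := fun j => φ.hom (Away.mk (MvPolynomial.homogeneousSubmodule τ ℤ) hXi 1
    (MvPolynomial.X j) (hX j))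
  have hval (n : ℕ) (f : MvPolynomial τ ℤ)
      (hf : f ∈ MvPolynomial.homogeneousSubmodule τ ℤ (n • 1)) :
      φ.hom (Away.mk (MvPolynomial.homogeneousSubmodule τ ℤ) hXi n f hf) =
        MvPolynomial.aeval x f := by
    rw [awayMk_eq_aeval i hX]
    exact map_aeval_int φ.hom _ f
  have hxi : x i = 1 := by
    have h1 : Away.mk (MvPolynomial.homogeneousSubmodule τ ℤ) hXi 1 (MvPolynomial.X i) (hX i) =
        1 := by
      apply HomogeneousLocalization.val_injective
      rw [Away.val_mk, HomogeneousLocalization.val_one, ← Localization.mk_self ⟨MvPolynomial.X i,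
        Submonoid.mem_powers _⟩]
      congr 1
      ext1
      simp
    change φ.hom _ = 1
    rw [h1, map_one]
  have hx : x ≠ 0 := Function.ne_iff.mpr ⟨i, by rw [hxi]; exact one_ne_zero⟩
  refine ⟨x, hx, ?_⟩
  rw [projPoint_eq_awayι x hx (MvPolynomial.X i) hXi one_pos (by
    rw [MvPolynomial.aeval_X, hxi]; exact one_ne_zero), ← hq, ← hφ]
  congr 2
  ext a
  obtain ⟨n, f, hf, rfl⟩ := Away.mk_surjective (MvPolynomial.homogeneousSubmodule τ ℤ) hXi a
  rw [CommRingCat.hom_ofHom, evalAway_mk, MvPolynomial.aeval_X, hxi, one_pow, div_one]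
  exact hval n f hf

/-- The generic point lies in every nonempty open set, so every rational map is defined there.
Uniqueness therefore needs no assumption on where a competing map is defined. -/
theorem exists_sendsTo_generic {σ : Type} [Nonempty σ]
    (Φ : (ProjSpace σ ℤ).RationalMap (ProjSpace τ ℤ)) : ∃ y, SendsTo Φ (genericVec σ ℤ) y := by
  obtain ⟨g, rfl⟩ := Φ.exists_rep
  have : Nonempty (ProjSpace σ ℤ) := ⟨projPt ℤ _ (genericVec_ne_zero (σ := σ) (R := ℤ))⟩
  have hd := projPt_genericVec_mem g.dense_domain.nonempty
  obtain ⟨y, hy, e⟩ := exists_eq_projPoint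
    (liftPt (projPoint ℤ (genericVec σ ℤ) genericVec_ne_zero) _ hd ≫ g.hom)
  exact ⟨y, (sendsTo_toRationalMap_iff g _ y genericVec_ne_zero hd).mpr ⟨hy, e⟩⟩

end IntegralPoints

end

/-! ### The Landen map over the integers and over fields -/

noncomputable section

theorem exists_hom_toRationalMap_eq {X Y : Scheme.{0}} [AlgebraicGeometry.IsReduced X]
    [Y.IsSeparated] {Φ : X.RationalMap Y} {U : X.Opens} (hU : Dense (U : Set X))
    (h : U ≤ Φ.domain) :
    ∃ g : U.toScheme ⟶ Y, (Scheme.PartialMap.mk U hU g).toRationalMap = Φ :=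
  ⟨X.homOfLE h ≫ Φ.toPartialMap.hom, (Φ.toPartialMap.restrict_toRationalMap U hU h).trans
    Φ.toRationalMap_toPartialMap⟩

section LandenMap

variable {d m k : ℕ} [NeZero m]

theorem natCast_ne_zero_of_algebraicIndependent {ι L : Type} [Nonempty ι] [Field L] [Algebra ℤ L]
    {x : ι → L} (hx : AlgebraicIndependent ℤ x) : (m : L) ≠ 0 := by
  have h := hx.algebraMap_injective
  intro h0
  refine NeZero.ne m (Int.natCast_eq_zero.mp (h ?_))
  rw [map_natCast, map_zero, h0]

/-- For `m ≥ 2` the adjugate of the zero matrix is zero, so the cofactor vanishes with the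
denominator. For `m = 1` the cofactor is `1` and the numerator would survive. -/
theorem landenVec_eq_zero (hm : 2 ≤ m) {K : Type} [Field K] {x : Coord d → K}
    (hx : (fun i => x (Sum.inr i)) = 0) : landenVec m k x = 0 := by
  have : Nontrivial (Fin m) := Fin.nontrivial_iff_two_le.mpr hm
  have h0 : vecPoly (fun i => x (Sum.inr i)) = 0 := by
    rw [hx]
    simp [vecPoly]
  have h1 : Polynomial.residueMatrix m (0 : Polynomial K) = 0 := by
    ext1 i j
    simp [Polynomial.residueMatrix, Polynomial.residuePart_zero]
  have hE : Polynomial.normCofactor m (0 : Polynomial K) = 0 := by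
    simp [Polynomial.normCofactor, h1, Polynomial.ofResidueParts]
  have hD : Polynomial.normExpand m (0 : Polynomial K) = 0 := by
    rw [Polynomial.normExpand, h1, Matrix.det_zero]
  funext j
  rcases j with i | i
  · simp [landenVec, landenNum, h0, hE, Polynomial.residuePart_zero]
  · simp [landenVec, landenDen, h0, hD]

section Given

variable {R : Type} [CommRing R] [IsDomain R]

variable (d m k R) in
theorem exists_isGivenBy_landenForm :
    ∃ Φ : (ProjSpace (Coord d) R).RationalMap (ProjSpace (Coord d) R),
      IsGivenBy Φ (landenForm d m k R) :=
  exists_isGivenBy (landenForm_isHomogeneous m k) (NeZero.pos m) (landenForm_ne_zero m k)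

variable (d m k R) in
theorem exists_isGivenBy_hypForm :
    ∃ Ψ : (ProjSpace (HypCoord d) R).RationalMap (ProjSpace (HypCoord d) R),
      IsGivenBy Ψ (hypForm d m k R) :=
  exists_isGivenBy (hypForm_isHomogeneous m k) (NeZero.pos m) (hypForm_ne_zero m k)

theorem isDominant_landen (hd : 0 < d)
    {Φ : (ProjSpace (Coord d) R).RationalMap (ProjSpace (Coord d) R)}
    (h : IsGivenBy Φ (landenForm d m 0 R)) : Φ.IsDominant :=
  h.isDominant (fun _ => eq_zero_of_aeval_landenForm hd) (landenForm_ne_zero m 0)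

theorem isDominant_hyp (hd : 0 < d) (hk : k < m)
    {Ψ : (ProjSpace (HypCoord d) R).RationalMap (ProjSpace (HypCoord d) R)}
    (h : IsGivenBy Ψ (hypForm d m k R)) : Ψ.IsDominant :=
  h.isDominant (fun _ => eq_zero_of_aeval_hypForm hd hk) (hypForm_ne_zero m k)

theorem hasAlgebraicDegree_landen (hd : 0 < d)
    {Φ : (ProjSpace (Coord d) R).RationalMap (ProjSpace (Coord d) R)}
    (h : IsGivenBy Φ (landenForm d m k R)) : HasAlgebraicDegree Φ m :=
  h.hasAlgebraicDegree (landenForm_isHomogeneous m k)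
    fun _ => isUnit_of_dvd_landenForm m k hd

theorem hasAlgebraicDegree_hyp (hd : 0 < d)
    {Ψ : (ProjSpace (HypCoord d) R).RationalMap (ProjSpace (HypCoord d) R)}
    (h : IsGivenBy Ψ (hypForm d m k R)) : HasAlgebraicDegree Ψ m :=
  h.hasAlgebraicDegree (hypForm_isHomogeneous m k)
    fun _ => isUnit_of_dvd_hypForm m k hd

variable [UniqueFactorizationMonoid R]

theorem sendsTo_landen_iff (hd : 0 < d)
    {Φ : (ProjSpace (Coord d) R).RationalMap (ProjSpace (Coord d) R)}
    (h : IsGivenBy Φ (landenForm d m k R)) {K : Type} [Field K] [Algebra R K] (x y : Coord d → K) :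
    SendsTo Φ x y ↔ landenVec m k x ≠ 0 ∧ ∃ c : K, c ≠ 0 ∧ y = c • landenVec m k x := by
  have hv : (fun j => MvPolynomial.aeval x (landenForm d m k R j)) = landenVec m k x :=
    funext fun j => aeval_landenForm m k x j
  rw [h.sendsTo_iff (landenForm_isHomogeneous m k) (landenForm_ne_zero m k)
    (fun u => isUnit_of_dvd_landenForm m k hd), hv]

theorem sendsTo_hyp_iff (hd : 0 < d)
    {Ψ : (ProjSpace (HypCoord d) R).RationalMap (ProjSpace (HypCoord d) R)}
    (h : IsGivenBy Ψ (hypForm d m k R)) {K : Type} [Field K] [Algebra R K] (x y : HypCoord d → K) :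
    SendsTo Ψ x y ↔ landenVec m k (hypIncl x) ∘ inclCoord d ≠ 0 ∧
      ∃ c : K, c ≠ 0 ∧ y = c • (landenVec m k (hypIncl x) ∘ inclCoord d) := by
  have hv : (fun j => MvPolynomial.aeval x (hypForm d m k R j)) =
      landenVec m k (hypIncl x) ∘ inclCoord d :=
    funext fun j => aeval_hypForm m k x j
  rw [h.sendsTo_iff (hypForm_isHomogeneous m k) (hypForm_ne_zero m k)
    (fun u => isUnit_of_dvd_hypForm m k hd), hv]

theorem landenVec_ne_zero {K : Type} [Field K] {x : Coord d → K}
    (hx : (fun i => x (Sum.inr i)) ≠ 0) : landenVec m k x ≠ 0 := fun h =>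
  landenVec_inr_ne_zero m k hx (by rw [h]; rfl)

/-- Over `ℤ` and over `F` the values are described by the same vector `landenVec`, which does not
see the base ring. -/
theorem hasBaseChange_landen (hd : 0 < d) {F : Type} [Field F]
    {Φ : (ProjSpace (Coord d) ℤ).RationalMap (ProjSpace (Coord d) ℤ)}
    (h : IsGivenBy Φ (landenForm d m k ℤ))
    {ΦF : (ProjSpace (Coord d) F).RationalMap (ProjSpace (Coord d) F)}
    (hF : IsGivenBy ΦF (landenForm d m k F)) : HasBaseChange Φ ΦF := by
  refine ⟨⟨F, inferInstance, inferInstance, fun _ => 1, _, (sendsTo_landen_iff hd h _ _).mpr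
    ⟨landenVec_ne_zero (Function.ne_iff.mpr ⟨0, one_ne_zero⟩), 1, one_ne_zero, rfl⟩⟩, ?_⟩
  intro K _ _ x y hxy
  rw [sendsTo_landen_iff hd h] at hxy
  rwa [sendsTo_landen_iff hd hF]

theorem hypIncl_landenVec (hd : 0 < d) {K : Type} [Field K] (x : HypCoord d → K) :
    hypIncl (landenVec m k (hypIncl x) ∘ inclCoord d) = landenVec m k (hypIncl x) :=
  hypIncl_eq (landenVec_hypIncl_inl_zero m k hd x)

theorem hypIncl_zero {K : Type} [Field K] : hypIncl (0 : HypCoord d → K) = 0 :=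
  hypIncl_eq (x := (0 : Coord d → K)) rfl

theorem landenVec_comp_inclCoord_ne_zero (hd : 0 < d) {K : Type} [Field K] {x : HypCoord d → K}
    (hx : landenVec m k (hypIncl x) ≠ 0) : landenVec m k (hypIncl x) ∘ inclCoord d ≠ 0 := fun h =>
  hx (by rw [← hypIncl_landenVec hd, h, hypIncl_zero])

theorem hasBaseChange_hyp (hd : 0 < d) {F : Type} [Field F]
    {Ψ : (ProjSpace (HypCoord d) ℤ).RationalMap (ProjSpace (HypCoord d) ℤ)}
    (h : IsGivenBy Ψ (hypForm d m k ℤ))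
    {ΨF : (ProjSpace (HypCoord d) F).RationalMap (ProjSpace (HypCoord d) F)}
    (hF : IsGivenBy ΨF (hypForm d m k F)) : HasBaseChange Ψ ΨF := by
  refine ⟨⟨F, inferInstance, inferInstance, fun _ => 1, _, (sendsTo_hyp_iff hd h _ _).mpr
    ⟨landenVec_comp_inclCoord_ne_zero hd
      (landenVec_ne_zero (Function.ne_iff.mpr ⟨0, one_ne_zero⟩)), 1, one_ne_zero, rfl⟩⟩, ?_⟩
  intro K _ _ x y hxy
  rw [sendsTo_hyp_iff hd h] at hxy
  rwa [sendsTo_hyp_iff hd hF]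

theorem restrictsToHyperplane_landen (hd : 0 < d)
    {Φ : (ProjSpace (Coord d) ℤ).RationalMap (ProjSpace (Coord d) ℤ)}
    (h : IsGivenBy Φ (landenForm d m k ℤ))
    {Ψ : (ProjSpace (HypCoord d) ℤ).RationalMap (ProjSpace (HypCoord d) ℤ)}
    (h' : IsGivenBy Ψ (hypForm d m k ℤ)) : RestrictsToHyperplane Φ Ψ := by
  refine ⟨⟨ℚ, inferInstance, fun _ => 1, _, (sendsTo_landen_iff hd h _ _).mpr
    ⟨landenVec_ne_zero (Function.ne_iff.mpr ⟨0, one_ne_zero⟩), 1, one_ne_zero, rfl⟩⟩, ?_⟩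
  intro K _ x y hxy
  obtain ⟨hne, c, hc, rfl⟩ := (sendsTo_landen_iff hd h _ _).mp hxy
  refine ⟨c • (landenVec m k (hypIncl x) ∘ inclCoord d), ?_, (sendsTo_hyp_iff hd h' _ _).mpr
    ⟨landenVec_comp_inclCoord_ne_zero hd hne, c, hc, rfl⟩⟩
  refine (hypIncl_eq (x := c • landenVec m k (hypIncl x)) ?_).symm
  rw [Pi.smul_apply, landenVec_hypIncl_inl_zero m k hd, smul_zero]

theorem inducedByLanden (hd : 0 < d) (hk : k < m)
    {Φ : (ProjSpace (Coord d) ℤ).RationalMap (ProjSpace (Coord d) ℤ)}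
    (h : IsGivenBy Φ (landenForm d m k ℤ)) : InducedByLanden d m k Φ := by
  intro K _ a b a' b' hp
  obtain ⟨hb, c, hc, e⟩ := hp.exists_eq_smul hd hk
  exact (sendsTo_landen_iff hd h _ _).mpr ⟨landenVec_ne_zero hb, c, hc, e⟩

/-- Coprimality is tested on roots in the algebraically closed field `L` and descends to `K`. With
`b_0 ≠ 0`, and hence `b_0 ^ m ≠ 0`, both rational functions have degree `d`. -/
theorem isLandenPair_of_algebraicIndependent (hd : 0 < d) (hk : k < m) {K L : Type} [Field K]
    [Field L] [IsAlgClosed L] [Algebra ℤ L] (φ : K →+* L) {x : Coord d → K}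
    (hx : AlgebraicIndependent ℤ fun i => φ (x i)) :
    IsLandenPair m k (fun i => x (Sum.inl i)) (fun i => x (Sum.inr i))
      (fun i => landenVec m k x (Sum.inl i)) (fun i => landenVec m k x (Sum.inr i)) := by
  have hm : (m : K) ≠ 0 := by
    intro h0
    refine natCast_ne_zero_of_algebraicIndependent (m := m) hx ?_
    rw [← map_natCast φ, h0, map_zero]
  have hne (i : Coord d) : x i ≠ 0 := by
    intro h0
    refine hx.ne_zero i ?_
    simp only [h0, map_zero]
  refine ⟨hm, ratDegree_ratFun (hne _) ?_, isLandenTransform_landenVec hm hk _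
    (Function.ne_iff.mpr ⟨0, hne _⟩), ratDegree_ratFun ?_ ?_⟩
  · rw [← Polynomial.isCoprime_map φ, map_vecPoly, map_vecPoly]
    exact isCoprime_vecPoly_of_algebraicIndependent (z := fun i => φ (x i)) hx
  · rw [landenVec_inr_zero]
    exact mul_ne_zero (pow_ne_zero _ (pow_ne_zero _ (neg_ne_zero.mpr one_ne_zero)))
      (pow_ne_zero _ (hne _))
  · rw [← Polynomial.isCoprime_map φ, map_vecPoly, map_vecPoly]
    simp only [map_landenVec]
    exact isCoprime_landenVec (x := fun i => φ (x i)) hd hk hx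

theorem eq_of_agreesWithLanden (hd : 0 < d) (hk : k < m)
    {Φ Φ' : (ProjSpace (Coord d) ℤ).RationalMap (ProjSpace (Coord d) ℤ)}
    (h : InducedByLanden d m k Φ) (h' : AgreesWithLanden d m k Φ') : Φ' = Φ := by
  have hp := isLandenPair_of_algebraicIndependent hd hk
    (algebraMap (FractionRing (MvPolynomial (Coord d) ℤ)) (AlgebraicClosure _))
    (algebraicIndependent_closedGenericVec ℤ (Coord d))
  have h1 := h _ _ _ _ _ hp
  have h2 := h' _ _ _ _ _ hp
  have e : Sum.elim (fun i => genericVec (Coord d) ℤ (Sum.inl i))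
      (fun i => genericVec (Coord d) ℤ (Sum.inr i)) = genericVec (Coord d) ℤ :=
    funext fun i => by rcases i with i | i <;> rfl
  rw [e] at h1 h2
  -- The canonical `ℤ`-algebra structure used for Landen pairs and the one inherited from the
  -- polynomial ring coincide.
  have hA : (Ring.toIntAlgebra (FractionRing (MvPolynomial (Coord d) ℤ))) =
      OreLocalization.instAlgebra := Subsingleton.elim _ _
  rw [hA] at h1 h2
  exact eq_of_sendsTo_generic (h2 (exists_sendsTo_generic Φ')) h1

theorem mem_bNonzero {p : ProjSpace (Coord d) ℤ} : p ∈ bNonzero d ↔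
    ∃ i, (MvPolynomial.X (Sum.inr i) : MvPolynomial (Coord d) ℤ) ∉ p.asHomogeneousIdeal := by
  rw [bNonzero, TopologicalSpace.Opens.mem_iSup]
  rfl

theorem projPt_mem_bNonzero {K : Type} [Field K] [Algebra ℤ K] {x : Coord d → K} (hx : x ≠ 0) :
    projPt ℤ x hx ∈ bNonzero d ↔ (fun i => x (Sum.inr i)) ≠ 0 := by
  rw [mem_bNonzero, Function.ne_iff]
  refine exists_congr fun i => not_congr ?_
  rw [mem_projPt x hx (MvPolynomial.isHomogeneous_X ℤ _), MvPolynomial.aeval_X]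
  rfl

theorem projPt_mem_domain_iff (hd : 0 < d)
    {Φ : (ProjSpace (Coord d) ℤ).RationalMap (ProjSpace (Coord d) ℤ)}
    (h : IsGivenBy Φ (landenForm d m k ℤ)) {K : Type} [Field K] [Algebra ℤ K]
    {x : Coord d → K} (hx : x ≠ 0) : projPt ℤ x hx ∈ Φ.domain ↔ landenVec m k x ≠ 0 := by
  rw [h.mem_domain_iff (landenForm_isHomogeneous m k) (NeZero.pos m) (landenForm_ne_zero m k)
    (fun u => isUnit_of_dvd_landenForm m k hd), Function.ne_iff]
  refine exists_congr fun j => not_congr ?_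
  rw [mem_projPt x hx (landenForm_isHomogeneous m k j), aeval_landenForm]
  rfl

theorem bNonzero_le_domain (hd : 0 < d)
    {Φ : (ProjSpace (Coord d) ℤ).RationalMap (ProjSpace (Coord d) ℤ)}
    (h : IsGivenBy Φ (landenForm d m k ℤ)) : bNonzero d ≤ Φ.domain := by
  intro p hp
  obtain ⟨K, _, _, x, hx, rfl⟩ := exists_projPt_eq p
  exact (projPt_mem_domain_iff hd h hx).mpr (landenVec_ne_zero ((projPt_mem_bNonzero hx).mp hp))

theorem domain_eq_bNonzero (hd : 0 < d) (hm : 2 ≤ m)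
    {Φ : (ProjSpace (Coord d) ℤ).RationalMap (ProjSpace (Coord d) ℤ)}
    (h : IsGivenBy Φ (landenForm d m k ℤ)) : Φ.domain = bNonzero d := by
  refine le_antisymm (fun p hp => ?_) (bNonzero_le_domain hd h)
  obtain ⟨K, _, _, x, hx, rfl⟩ := exists_projPt_eq p
  exact (projPt_mem_bNonzero hx).mpr fun h0 =>
    (projPt_mem_domain_iff hd h hx).mp hp (landenVec_eq_zero hm h0)

variable (d) in
theorem dense_bNonzero : Dense (bNonzero d : Set (ProjSpace (Coord d) ℤ)) := by
  have hx : (fun _ => 1 : Coord d → ℚ) ≠ 0 := Function.ne_iff.mpr ⟨Sum.inr 0, one_ne_zero⟩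
  exact dense_of_nonempty ⟨projPt ℤ _ hx,
    (projPt_mem_bNonzero hx).mpr (Function.ne_iff.mpr ⟨0, one_ne_zero⟩)⟩

theorem exists_hom_bNonzero (hd : 0 < d)
    {Φ : (ProjSpace (Coord d) ℤ).RationalMap (ProjSpace (Coord d) ℤ)}
    (h : IsGivenBy Φ (landenForm d m k ℤ)) :
    ∃ f : (bNonzero d).toScheme ⟶ (bNonzero d).toScheme,
      (Scheme.PartialMap.mk (bNonzero d) (dense_bNonzero d)
        (f ≫ (bNonzero d).ι)).toRationalMap = Φ := by
  obtain ⟨g, hg⟩ := exists_hom_toRationalMap_eq (dense_bNonzero d) (bNonzero_le_domain hd h)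
  have hr : Set.range g ⊆ Set.range (bNonzero d).ι := by
    rintro _ ⟨⟨p, hp⟩, rfl⟩
    rw [Scheme.Opens.range_ι]
    obtain ⟨K, _, _, x, hx, rfl⟩ := exists_projPt_eq p
    have hb := (projPt_mem_bNonzero hx).mp hp
    -- The image of the point is read off from its coordinates: the new denominator is the norm of a
    -- nonzero polynomial, so the image avoids `b = 0`.
    have hs := (sendsTo_landen_iff hd h x _).mpr ⟨landenVec_ne_zero hb, 1, one_ne_zero, rfl⟩
    rw [one_smul, ← hg] at hs
    obtain ⟨hy, e⟩ := (sendsTo_toRationalMap_iff _ x _ hx hp).mp hs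
    have h1 : projPt ℤ (landenVec m k x) hy = g ⟨projPt ℤ x hx, hp⟩ := by
      rw [projPt, ← e]
      exact congrArg g (Subtype.ext (congrArg (fun q : Spec (.of K) ⟶ ProjSpace (Coord d) ℤ =>
        q default) (liftPt_ι (projPoint ℤ x hx) (bNonzero d) hp)))
    change g ⟨projPt ℤ x hx, hp⟩ ∈ bNonzero d
    rw [← h1]
    exact (projPt_mem_bNonzero hy).mpr (landenVec_inr_ne_zero m k hb)
  refine ⟨IsOpenImmersion.lift (bNonzero d).ι g hr, ?_⟩
  rw [IsOpenImmersion.lift_fac]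
  exact hg

theorem closure_range_landen (hd : 0 < d) (hk0 : 0 < k) (hk : k < m)
    {Φ : (ProjSpace (Coord d) ℤ).RationalMap (ProjSpace (Coord d) ℤ)}
    (h : IsGivenBy Φ (landenForm d m k ℤ))
    (g : (ProjSpace (Coord d) ℤ).PartialMap (ProjSpace (Coord d) ℤ)) (hg : g.toRationalMap = Φ) :
    closure (Set.range g.hom) = {p : ProjSpace (Coord d) ℤ |
      (MvPolynomial.X (Sum.inl 0) : MvPolynomial (Coord d) ℤ) ∈ p.asHomogeneousIdeal} := by
  rw [h.closure_range_eq (landenForm_ne_zero m k) g hg]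
  ext p
  constructor
  · intro hp
    refine hp _ 1 (MvPolynomial.isHomogeneous_X ℤ _) ?_
    rw [MvPolynomial.aeval_X]
    exact landenVec_inl_zero m k hk0 _
  · intro hp f _ _ hf
    exact mem_of_aeval_hypIncl_eq_zero (I := p.asHomogeneousIdeal.toIdeal) hp
      (aeval_hypIncl_eq_zero_of_aeval_landenForm hd hk hf)

end Given

end LandenMap

end

theorem theorem2 (m k d : ℕ) (hm : 1 ≤ m) (hk : k < m) (hd : 1 ≤ d) :
    ∃ Φ : (ProjSpace (Coord d) ℤ).RationalMap (ProjSpace (Coord d) ℤ),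
      -- (a) existence and uniqueness
      InducedByLanden d m k Φ ∧
      (∀ Φ' : (ProjSpace (Coord d) ℤ).RationalMap (ProjSpace (Coord d) ℤ),
        AgreesWithLanden d m k Φ' → Φ' = Φ) ∧
      -- (b) the indeterminacy locus, and the morphism on its complement
      (2 ≤ m → Φ.domain = bNonzero d) ∧
      (∃ (hdense : Dense (bNonzero d : Set (ProjSpace (Coord d) ℤ)))
        (f : (bNonzero d).toScheme ⟶ (bNonzero d).toScheme),
        (Scheme.PartialMap.mk (bNonzero d) hdense (f ≫ (bNonzero d).ι)).toRationalMap = Φ) ∧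
      -- (c) dominance and algebraic degree, over the integers and over every field
      (k = 0 →
        Φ.IsDominant ∧ HasAlgebraicDegree Φ m ∧
        ∀ (F : Type) [Field F],
          ∃ ΦF : (ProjSpace (Coord d) F).RationalMap (ProjSpace (Coord d) F),
            HasBaseChange Φ ΦF ∧ ΦF.IsDominant ∧ HasAlgebraicDegree ΦF m) ∧
      -- (d) the (closure of the) image is the hyperplane
      (1 ≤ k →
        ∀ g : (ProjSpace (Coord d) ℤ).PartialMap (ProjSpace (Coord d) ℤ), g.toRationalMap = Φ →
          closure (Set.range g.hom) =
            {p : ProjSpace (Coord d) ℤ |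
              (MvPolynomial.X (Sum.inl 0) : MvPolynomial (Coord d) ℤ) ∈ p.asHomogeneousIdeal}) ∧
      -- (d) the induced self-map of the hyperplane
      ∃ Ψ : (ProjSpace (HypCoord d) ℤ).RationalMap (ProjSpace (HypCoord d) ℤ),
        RestrictsToHyperplane Φ Ψ ∧ Ψ.IsDominant ∧ HasAlgebraicDegree Ψ m ∧
        ∀ (F : Type) [Field F],
          ∃ ΨF : (ProjSpace (HypCoord d) F).RationalMap (ProjSpace (HypCoord d) F),
            HasBaseChange Ψ ΨF ∧ ΨF.IsDominant ∧ HasAlgebraicDegree ΨF m := by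
  have : NeZero m := ⟨by omega⟩
  obtain ⟨Φ, hΦ⟩ := exists_isGivenBy_landenForm d m k ℤ
  obtain ⟨Ψ, hΨ⟩ := exists_isGivenBy_hypForm d m k ℤ
  refine ⟨Φ, inducedByLanden hd hk hΦ,
    fun Φ' hΦ' => eq_of_agreesWithLanden hd hk (inducedByLanden hd hk hΦ) hΦ',
    fun hm2 => domain_eq_bNonzero hd hm2 hΦ, ⟨dense_bNonzero d, exists_hom_bNonzero hd hΦ⟩, ?_,
    fun hk0 g hg => closure_range_landen hd hk0 hk hΦ g hg, Ψ,
    restrictsToHyperplane_landen hd hΦ hΨ, isDominant_hyp hd hk hΨ, hasAlgebraicDegree_hyp hd hΨ,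
    ?_⟩
  · rintro rfl
    refine ⟨isDominant_landen hd hΦ, hasAlgebraicDegree_landen hd hΦ, fun F _ => ?_⟩
    obtain ⟨ΦF, hΦF⟩ := exists_isGivenBy_landenForm d m 0 F
    exact ⟨ΦF, hasBaseChange_landen hd hΦ hΦF, isDominant_landen hd hΦF,
      hasAlgebraicDegree_landen hd hΦF⟩
  · intro F _
    obtain ⟨ΨF, hΨF⟩ := exists_isGivenBy_hypForm d m k F
    exact ⟨ΨF, hasBaseChange_hyp hd hΨ hΨF, isDominant_hyp hd hk hΨF, hasAlgebraicDegree_hyp hd hΨF⟩
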